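/- Fix $\tau\in(0,1)$. For each $n$ let $T=T_n\ge1$, $p=p_n\ge1$, let $(Y_{it},X_{it})\in\mathbb R\times\mathbb R^p$ ($i\le n$, $t\le T$) be random, and let $\theta=\theta_n\in\mathbb R^p$ and $\Pi=\Pi_n\in\mathbb R^{n\times T}$ be (non-random) parameters such that the conditional $\tau$-quantile of $Y_{it}$ given $X_{it}$ is $X_{it}'\theta+\Pi_{it}$. Write $r=\operatorname{rank}\Pi$ and $X\theta=(X_{it}'\theta)_{i,t}$. Assume: (a) $\{(Y_{it},X_{it})\}_{t\le T}$ is independent across $i$, and for some $\mu>2$ its $\beta$-mixing coefficients satisfy $\sup_{n,\,i\le n}\gamma_{n,i}(k)=O(k^{-\mu})$; for some $\mu'\in(0,\mu)$, $npT\lfloor T^{1/(1+\mu')}\rfloor^{-\mu}\to0$. Put $c_T=\lceil T^{1/(1+\mu')}\rceil$ and $d_T=\lfloor T/(2c_T)\rfloor$. (b) For almost every value $x$ of $X_{it}$ the conditional law of $Y_{it}$ given $X_{it}=x$ has a differentiable density $f_{it}(\cdot\mid x)$ with $f_{it}(x'\theta+\Pi_{it}\mid x)\ge\underline f$, $f_{it}\le\bar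 f$ and $|\partial_yf_{it}|\le\bar f'$, where the bounds $\underline f,\bar f,\bar f'$ may depend on $n$, with $\underline f$ bounded below by a positive constant. (c) $\mathbb E X_{itj}^2=1$ for all $i,t,j$, and with $\hat\sigma_j^2=\frac1{nT}\sum_{i,t}X_{itj}^2$ we have $\mathbb P(\max_j|\hat\sigma_j^2-1|\le\frac14)\to1$. (d) There are random matrices $\xi\in\mathbb R^{n\times T}$ and a sequence $\phi_n$ with $\phi_n/(\sqrt{\underline f}\,\log(1+c_T))\to\infty$ such that, for some constant $K$, $\operatorname{rank}(X\theta+\xi)\le Kr$ with probability tending to one, and $$\frac{\|\xi\|_*}{\sqrt{nT}}=O_{\mathbb P}\Big(\frac{c_T\phi_n\sqrt r(\sqrt n+\sqrt{d_T})}{\sqrt{nT}\,\underline f}\Big),\qquad \|X\theta+\Pi\|_\infty=O_{\mathbb P}(1),$$ where $\|\cdot\|_*$ is the nuclear norm and $\|\cdot\|_\infty$ is the largest absolute value of an entry. With $\rho_\tau(u)=(\tau-1\{u\le0\})u$, let $(\hat\theta,\hat\Pi)$ be a minimizer of $$\frac1{nT}\sum_{i,t}\rho_\tau(Y_{it}-X_{it}'\tilde\theta-\tilde\Pi_{it})+\nu_1\sum_j\hat\sigma_j|\tilde\theta_j|+\nu_2\|\tilde\Pi\|_*$$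 over $\tilde\theta\in\mathbb R^p$ and $\tilde\Pi\in\mathbb R^{n\times T}$ with $\|\tilde\Pi\|_\infty\le C$. Then there are absolute constants $a_1,a_2>0$ and, for each such array, a constant $C_0$ such that for every $C\ge C_0$, all constants $b_1,b_2$, and all tuning parameters with, for large $n$, $$\frac{a_1}{nT}\sum_{i,t}\|X_{it}\|_\infty\le\nu_1\le\frac{b_1}{nT}\sum_{i,t}\|X_{it}\|_\infty,\qquad \frac{a_2c_T}{nT}(\sqrt n+\sqrt{d_T})\le\nu_2\le\frac{b_2c_T}{nT}(\sqrt n+\sqrt{d_T}),$$ we have $\mathbb P(\hat\theta=0)\to1$ and $$\frac1{nT}\|\hat\Pi-(X\theta+\Pi)\|_F^2=O_{\mathbb P}\Big(\frac{(\bar f')^2\phi_n^2c_Tr}{\underline f^4}\Big(\frac1n+\frac1{d_T}\Big)\Big).$$ -/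

import Mathlib

open MeasureTheory ProbabilityTheory Filter Topology
open scoped ENNReal MatrixOrder

namespace PanelQR

noncomputable section

/-! ### Matrix norms -/

/-- The nuclear norm `trace (√(Aᵀ A))`. -/
def nuclearNorm {n T : ℕ} (A : Matrix (Fin n) (Fin T) ℝ) : ℝ :=
  (CFC.sqrt (A.transpose * A)).trace

/-- The Frobenius norm. -/
def frobeniusNorm {n T : ℕ} (A : Matrix (Fin n) (Fin T) ℝ) : ℝ :=
  √(∑ i, ∑ t, A i t ^ 2)

/-- The entrywise maximum norm `max |A i t|` (the norm of iterated function spaces over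
finite types is the maximum norm). -/
def maxNorm {n T : ℕ} (A : Matrix (Fin n) (Fin T) ℝ) : ℝ :=
  ‖(fun i t => A i t : Fin n → Fin T → ℝ)‖

/-! ### The estimator -/

/-- The quantile (check) loss `ρ_τ(u) = (τ - 1{u ≤ 0}) u`. -/
def checkLoss (τ u : ℝ) : ℝ := (τ - if u ≤ 0 then 1 else 0) * u

/-- The product of the tensor `x` with the vector `θ`: the matrix with entries `x_{it}' θ`. -/
def tensorMul {n T p : ℕ} (x : Fin n → Fin T → Fin p → ℝ) (θ : Fin p → ℝ) :
    Matrix (Fin n) (Fin T) ℝ :=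
  Matrix.of fun i t => ∑ j, x i t j * θ j

/-- The empirical second moment `σ̂_j²` of the `j`-th covariate. -/
def sigmaHatSq {n T p : ℕ} (x : Fin n → Fin T → Fin p → ℝ) (j : Fin p) : ℝ :=
  1 / ((n : ℝ) * T) * ∑ i, ∑ t, x i t j ^ 2

/-- The weighted `ℓ₁` norm `∑ σ̂_j |θ_j|`. -/
def weightedL1 {n T p : ℕ} (x : Fin n → Fin T → Fin p → ℝ) (θ : Fin p → ℝ) : ℝ :=
  ∑ j, √(sigmaHatSq x j) * |θ j|

/-- The empirical quantile risk. -/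
def empiricalRisk {n T p : ℕ} (τ : ℝ) (y : Fin n → Fin T → ℝ) (x : Fin n → Fin T → Fin p → ℝ)
    (θ : Fin p → ℝ) (A : Matrix (Fin n) (Fin T) ℝ) : ℝ :=
  1 / ((n : ℝ) * T) * ∑ i, ∑ t, checkLoss τ (y i t - (∑ j, x i t j * θ j) - A i t)

/-- The penalized objective function. -/
def objective {n T p : ℕ} (τ ν₁ ν₂ : ℝ) (y : Fin n → Fin T → ℝ)
    (x : Fin n → Fin T → Fin p → ℝ) (θ : Fin p → ℝ) (A : Matrix (Fin n) (Fin T) ℝ) : ℝ :=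
  empiricalRisk τ y x θ A + ν₁ * weightedL1 x θ + ν₂ * nuclearNorm A

/-- `(θ, A)` minimizes the penalized objective over all `(θ', A')` with `‖A'‖_∞ ≤ C`. -/
structure IsEstimate {n T p : ℕ} (τ ν₁ ν₂ C : ℝ) (y : Fin n → Fin T → ℝ)
    (x : Fin n → Fin T → Fin p → ℝ) (θ : Fin p → ℝ) (A : Matrix (Fin n) (Fin T) ℝ) : Prop where
  feasible : maxNorm A ≤ C
  minimal : ∀ (θ' : Fin p → ℝ) (A' : Matrix (Fin n) (Fin T) ℝ), maxNorm A' ≤ C →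
    objective τ ν₁ ν₂ y x θ A ≤ objective τ ν₁ ν₂ y x θ' A'

/-- The average `(nT)⁻¹ ∑ ‖x_{it}‖_∞` (the norm of `Fin p → ℝ` is the maximum norm). -/
def avgSupNorm {n T p : ℕ} (x : Fin n → Fin T → Fin p → ℝ) : ℝ :=
  1 / ((n : ℝ) * T) * ∑ i, ∑ t, ‖x i t‖

/-! ### Block lengths and the two deterministic rates -/

/-- `c_T = ⌈T^{1/(1+μ')}⌉`. -/
def blockLength (μ' : ℝ) (T : ℕ) : ℕ := ⌈(T : ℝ) ^ (1 / (1 + μ'))⌉₊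

/-- `d_T = ⌊T/(2 c_T)⌋`. -/
def numBlocks (μ' : ℝ) (T : ℕ) : ℕ := T / (2 * blockLength μ' T)

/-- `c_T (√n + √d_T) / (nT)`, the order of the nuclear norm penalty. -/
def nuclearTuning (μ' : ℝ) (n T : ℕ) : ℝ :=
  (blockLength μ' T : ℝ) / ((n : ℝ) * T) * (√(n : ℝ) + √(numBlocks μ' T : ℝ))

/-! ### Stochastic order, dependence, quantiles and densities -/

/-- `Z n = O_ℙ(a n)` for random variables `Z n` on possibly different probability spaces. -/
def IsBigOP {Ω : ℕ → Type*} [∀ n, MeasurableSpace (Ω n)] (P : ∀ n, Measure (Ω n))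
    (Z : ∀ n, Ω n → ℝ) (a : ℕ → ℝ) : Prop :=
  ∀ ε : ℝ, 0 < ε → ∃ M : ℝ, 0 < M ∧
    ∀ᶠ n in atTop, P n {ω | M * a n < |Z n ω|} ≤ ENNReal.ofReal ε

/-- The event `E n` has probability tending to one. -/
def WithProbTendingToOne {Ω : ℕ → Type*} [∀ n, MeasurableSpace (Ω n)] (P : ∀ n, Measure (Ω n))
    (E : ∀ n, Ω n → Prop) : Prop :=
  Tendsto (fun n => P n {ω | ¬ E n ω}) atTop (𝓝 0)

/-- `A` is a finite partition of the sample space into events of the σ-algebra `m`. -/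
structure IsFinPartition {Ω : Type*} (m : MeasurableSpace Ω) {L : ℕ} (A : Fin L → Set Ω) :
    Prop where
  measurable : ∀ j, MeasurableSet[m] (A j)
  disjoint : Pairwise fun j j' => Disjoint (A j) (A j')
  cover : ⋃ j, A j = Set.univ

/-- The σ-algebra generated by `Z_1, …, Z_l`; the time `t : Fin T` stands for `t + 1`. -/
@[reducible] def pastSigma {Ω E : Type*} [MeasurableSpace E] {T : ℕ} (Z : Fin T → Ω → E) (l : ℕ) :
    MeasurableSpace Ω :=
  ⨆ t : {t : Fin T // (t : ℕ) + 1 ≤ l}, MeasurableSpace.comap (Z t) inferInstance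

/-- The σ-algebra generated by `Z_s, Z_{s+1}, …, Z_T`. -/
@[reducible] def futureSigma {Ω E : Type*} [MeasurableSpace E] {T : ℕ} (Z : Fin T → Ω → E) (s : ℕ) :
    MeasurableSpace Ω :=
  ⨆ t : {t : Fin T // s ≤ (t : ℕ) + 1}, MeasurableSpace.comap (Z t) inferInstance

/-- The β-mixing coefficient at lag `k` of `Z_1, …, Z_T`: half the supremum, over `l ≥ 1` and
over finite partitions `A` in `σ(Z_1, …, Z_l)` and `B` in `σ(Z_{l+k}, …, Z_T)`, of
`∑ |ℙ(A_j ∩ B_j') - ℙ(A_j) ℙ(B_j')|`. -/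
def betaMixing {Ω E : Type*} [MeasurableSpace Ω] [MeasurableSpace E] (P : Measure Ω) {T : ℕ}
    (Z : Fin T → Ω → E) (k : ℕ) : ℝ≥0∞ :=
  ⨆ (l : ℕ) (_ : 1 ≤ l) (L : ℕ) (L' : ℕ) (A : Fin L → Set Ω) (B : Fin L' → Set Ω)
    (_ : IsFinPartition (pastSigma Z l) A) (_ : IsFinPartition (futureSigma Z (l + k)) B),
    ENNReal.ofReal (1 / 2 * ∑ j, ∑ j', |P.real (A j ∩ B j') - P.real (A j) * P.real (B j')|)

/-- The `τ`-quantile `F⁻¹(τ) = inf {y : τ ≤ F(y)}` of a probability measure on `ℝ`. -/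
def quantile (ν : Measure ℝ) (τ : ℝ) : ℝ := sInf {y | τ ≤ cdf ν y}

/-- `g` is a differentiable Lebesgue density of `ν` with `g ≤ b` and `|g'| ≤ b'`. -/
structure IsSmoothDensity (ν : Measure ℝ) (g : ℝ → ℝ) (b b' : ℝ) : Prop where
  nonneg : ∀ y, 0 ≤ g y
  density : ν = volume.withDensity fun y => ENNReal.ofReal (g y)
  differentiable : Differentiable ℝ g
  le_bound : ∀ y, g y ≤ b
  deriv_le_bound : ∀ y, |deriv g y| ≤ b'

/-! ### The model and the assumptions

Everything is a triangular array indexed by the number `n` of subjects, with `T n` periods and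
`p n` covariates; `X n i t` and `Y n i t` are random, `θ n` and `Π n` are parameters. -/

section Assumptions

variable {Ω : ℕ → Type*} [∀ n, MeasurableSpace (Ω n)]

/-- The latent panel quantile regression model: conditionally on `X_{it} = x`, the `τ`-quantile of
`Y_{it}` is `x' θ + Π_{it}`. -/
structure QuantileModel (P : ∀ n, Measure (Ω n)) [∀ n, IsProbabilityMeasure (P n)] (T p : ℕ → ℕ)
    (X : ∀ n, Fin n → Fin (T n) → Ω n → Fin (p n) → ℝ) (Y : ∀ n, Fin n → Fin (T n) → Ω n → ℝ)
    (τ : ℝ) (θ : ∀ n, Fin (p n) → ℝ) (Pi : ∀ n, Matrix (Fin n) (Fin (T n)) ℝ) : Prop where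
  measurable_X : ∀ n i t, Measurable (X n i t)
  measurable_Y : ∀ n i t, Measurable (Y n i t)
  quantile_eq : ∀ n i t, ∀ᵐ x ∂((P n).map (X n i t)),
    quantile (condDistrib (Y n i t) (X n i t) (P n) x) τ = (∑ j, x j * θ n j) + Pi n i t

/-- Independence across subjects and β-mixing across time with polynomial rate. -/
structure WeakDependence (P : ∀ n, Measure (Ω n)) (T p : ℕ → ℕ)
    (X : ∀ n, Fin n → Fin (T n) → Ω n → Fin (p n) → ℝ) (Y : ∀ n, Fin n → Fin (T n) → Ω n → ℝ)
    (μ μ' : ℝ) : Prop where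
  two_lt : 2 < μ
  pos : 0 < μ'
  lt : μ' < μ
  indep : ∀ n, iIndepFun (fun (i : Fin n) (ω : Ω n) (t : Fin (T n)) => (Y n i t ω, X n i t ω)) (P n)
  mixing : ∃ B : ℝ, ∀ n (i : Fin n) (k : ℕ), 1 ≤ k →
    betaMixing (P n) (fun t ω => (Y n i t ω, X n i t ω)) k ≤ ENNReal.ofReal (B * (k : ℝ) ^ (-μ))
  growth : Tendsto (fun n : ℕ => (n : ℝ) * p n * T n *
    ((⌊(T n : ℝ) ^ (1 / (1 + μ'))⌋₊ : ℕ) : ℝ) ^ (-μ)) atTop (𝓝 0)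

/-- The conditional law of `Y_{it}` given `X_{it} = x` has a differentiable density that is at
least `fLow n` at the conditional quantile, at most `fUp n` everywhere, and has derivative at most
`fUp' n` in absolute value everywhere; `fLow n` is bounded away from zero. -/
structure DensityBounds (P : ∀ n, Measure (Ω n)) [∀ n, IsProbabilityMeasure (P n)] (T p : ℕ → ℕ)
    (X : ∀ n, Fin n → Fin (T n) → Ω n → Fin (p n) → ℝ) (Y : ∀ n, Fin n → Fin (T n) → Ω n → ℝ)
    (θ : ∀ n, Fin (p n) → ℝ) (Pi : ∀ n, Matrix (Fin n) (Fin (T n)) ℝ)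
    (fLow fUp fUp' : ℕ → ℝ) : Prop where
  low_pos : ∃ f₀ : ℝ, 0 < f₀ ∧ ∀ n, f₀ ≤ fLow n
  density : ∀ n i t, ∀ᵐ x ∂((P n).map (X n i t)), ∃ g : ℝ → ℝ,
    IsSmoothDensity (condDistrib (Y n i t) (X n i t) (P n) x) g (fUp n) (fUp' n) ∧
      fLow n ≤ g ((∑ j, x j * θ n j) + Pi n i t)

/-- Unit second moments of the covariates, well approximated by the empirical ones. -/
structure CovariateMoments (P : ∀ n, Measure (Ω n)) (T p : ℕ → ℕ)
    (X : ∀ n, Fin n → Fin (T n) → Ω n → Fin (p n) → ℝ) : Prop where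
  second_moment : ∀ n i t j, ∫ ω, X n i t ω j ^ 2 ∂(P n) = 1
  empirical : WithProbTendingToOne P fun n ω =>
    ∀ j, |sigmaHatSq (fun i t => X n i t ω) j - 1| ≤ 1 / 4

/-- `Xθ` is, up to an error `ξ` of small nuclear norm, a matrix of rank `O(r)` with
`r = rank Π`, and `‖Xθ + Π‖_∞ = O_ℙ(1)`. -/
structure ApproxLowRank (P : ∀ n, Measure (Ω n)) (T p : ℕ → ℕ)
    (X : ∀ n, Fin n → Fin (T n) → Ω n → Fin (p n) → ℝ)
    (θ : ∀ n, Fin (p n) → ℝ) (Pi : ∀ n, Matrix (Fin n) (Fin (T n)) ℝ)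
    (ξ : ∀ n, Ω n → Matrix (Fin n) (Fin (T n)) ℝ) (fLow φ : ℕ → ℝ) (μ' : ℝ) : Prop where
  rank_le : ∃ K : ℕ, WithProbTendingToOne P fun n ω =>
    (tensorMul (fun i t => X n i t ω) (θ n) + ξ n ω).rank ≤ K * (Pi n).rank
  error : IsBigOP P (fun n ω => nuclearNorm (ξ n ω) / √((n : ℝ) * T n)) fun n =>
    (blockLength μ' (T n) : ℝ) * φ n * √((Pi n).rank : ℝ) *
      (√(n : ℝ) + √(numBlocks μ' (T n) : ℝ)) / (√((n : ℝ) * T n) * fLow n)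
  bounded : IsBigOP P
    (fun n ω => maxNorm (tensorMul (fun i t => X n i t ω) (θ n) + Pi n)) fun _ => 1

end Assumptions

end

end PanelQR

/-! The ℓ₁ penalty is heavy enough to remove the regression coefficients outright. The check loss is
1-Lipschitz, so replacing `θ` by zero raises the empirical risk by at most `avgSupNorm x` times
`‖θ‖₁`, while the penalty drops by at least `(3/4) ν₁ ‖θ‖₁`, which is more once `ν₁` is twice the
average (`IsEstimate.coef_eq_zero`). What remains is a nuclear norm penalized quantile estimator of
`M = Xθ + Π`, a matrix that up to `ξ` has rank at most `(K + 1) r`.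

The increment of the loss is linear in the score `τ - 1{U ≤ 0}` plus a nonnegative remainder
`bregman`. Three facts control it. The score has operator norm at most `w = c (√n + √d)`, half of
the penalty level `n T ν₂` (`PanelLaw.measure_not_opBound_le`); with decomposability
(`nuclearNorm_cone`) this confines descent directions to a nuclear norm ball (`descent_bounds`). The
expected remainder dominates a multiple of the squared Frobenius norm, since the density at the
quantile is bounded below and varies at a bounded rate (`ResidualBounds.bregman_ge`). Uniformly over
the ball of radius `R`, the remainder falls short of its expectation by at most the order of `c R
(√n + √d)` (`PanelLaw.measure_process_le`). If the error exceeded a radius `H`, convexity would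
supply a descent direction of Frobenius norm exactly `H`, where curvature beats penalty and noise
(`noise_lt_curvature`).

Dependence over time is removed by splitting the columns into residue classes modulo `c`. Within a
class the entries of a row are at least `c` apart, so β-mixing allows the joint law to be replaced
by the product of its marginals at a cost `2δ` per entry, and `n T · 2δ` tends to zero
(`lintegral_le_lmarginal`). Under the product law the operator norm is handled by a net and
Hoeffding's inequality. The process is reduced, by symmetrization, contraction and trace duality, to
the operator norm of a matrix of random signs.

The constraint level `C` is fixed while `‖M‖_∞` is only bounded in probability, so `M` itself may be
infeasible with non-vanishing probability. But all rows of `M` obey the bound with probability at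
least 1/2, and the rows are independent; hence the expected number of offending rows is at most one
(`measure_card_fail_le`). Setting these rows to zero gives a feasible comparison matrix and costs
only order `1 / n` in the mean squared error, which is within the rate. -/

namespace PanelQR

/-! ### Duality for the nuclear norm -/

section LinearAlgebra

open Matrix

/-- The trace inner product of two matrices. -/
noncomputable def frobInner {α β : Type*} [Fintype α] [Fintype β] (A B : Matrix α β ℝ) : ℝ :=
  ∑ i, ∑ t, A i t * B i t

/-- `b` bounds the bilinear form of `W` on the product of the Euclidean unit balls. -/
def OpBound {α β : Type*} [Fintype α] [Fintype β] (W : Matrix α β ℝ) (b : ℝ) : Prop :=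
  ∀ (u : α → ℝ) (v : β → ℝ), u ⬝ᵥ (W *ᵥ v) ≤ b * (√(u ⬝ᵥ u) * √(v ⬝ᵥ v))

/-! ### Trace inner product, contractions and orthogonal projections. -/

section Basics

variable {α β : Type*} [Fintype α] [Fintype β]

theorem dotProduct_self_nonneg' (u : α → ℝ) : 0 ≤ u ⬝ᵥ u :=
  Finset.sum_nonneg fun i _ => mul_self_nonneg (u i)

theorem dotProduct_le_sqrt (u v : α → ℝ) : u ⬝ᵥ v ≤ √(u ⬝ᵥ u) * √(v ⬝ᵥ v) := by
  have h := Real.sum_mul_le_sqrt_mul_sqrt Finset.univ u v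
  simpa [dotProduct, pow_two] using h

theorem frobInner_eq_trace (A B : Matrix α β ℝ) : frobInner A B = (Aᵀ * B).trace := by
  simp only [frobInner, trace, diag, mul_apply, transpose_apply]
  exact Finset.sum_comm

theorem frobInner_comm (A B : Matrix α β ℝ) : frobInner A B = frobInner B A := by
  simp only [frobInner, mul_comm]

theorem frobInner_add_right (A B C : Matrix α β ℝ) :
    frobInner A (B + C) = frobInner A B + frobInner A C := by
  simp [frobInner, mul_add, Finset.sum_add_distrib]

theorem frobInner_add_left (A B C : Matrix α β ℝ) :
    frobInner (A + B) C = frobInner A C + frobInner B C := by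
  simp [frobInner, add_mul, Finset.sum_add_distrib]

theorem frobInner_smul_right (c : ℝ) (A B : Matrix α β ℝ) :
    frobInner A (c • B) = c * frobInner A B := by
  simp only [frobInner, Matrix.smul_apply, smul_eq_mul, Finset.mul_sum]
  exact Finset.sum_congr rfl fun i _ => Finset.sum_congr rfl fun j _ => by ring

theorem frobInner_mul_left (P : Matrix α α ℝ) (A B : Matrix α β ℝ) :
    frobInner A (P * B) = frobInner (Pᵀ * A) B := by
  simp only [frobInner_eq_trace, transpose_mul, transpose_transpose, Matrix.mul_assoc]

theorem frobInner_mul_right (P : Matrix β β ℝ) (A B : Matrix α β ℝ) :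
    frobInner A (B * P) = frobInner (A * Pᵀ) B := by
  simp only [frobInner_eq_trace, transpose_mul, transpose_transpose]
  rw [← Matrix.mul_assoc, Matrix.trace_mul_comm, ← Matrix.mul_assoc]

theorem frobInner_le_sqrt (A B : Matrix α β ℝ) :
    frobInner A B ≤ √(frobInner A A) * √(frobInner B B) := by
  have h := Real.sum_mul_le_sqrt_mul_sqrt (Finset.univ : Finset (α × β))
    (fun x => A x.1 x.2) (fun x => B x.1 x.2)
  simpa [frobInner, Fintype.sum_prod_type, pow_two] using h

theorem frobInner_self_nonneg (A : Matrix α β ℝ) : 0 ≤ frobInner A A :=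
  Finset.sum_nonneg fun _ _ => Finset.sum_nonneg fun _ _ => mul_self_nonneg _

theorem opBound_of_mulVec {W : Matrix α β ℝ}
    (h : ∀ v, (W *ᵥ v) ⬝ᵥ (W *ᵥ v) ≤ v ⬝ᵥ v) : OpBound W 1 := by
  intro u v
  rw [one_mul]
  exact (dotProduct_le_sqrt _ _).trans
    (mul_le_mul_of_nonneg_left (Real.sqrt_le_sqrt (h v)) (Real.sqrt_nonneg _))

theorem OpBound.transpose {W : Matrix α β ℝ} {b : ℝ} (h : OpBound W b) : OpBound Wᵀ b := by
  intro u v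
  have := h v u
  rw [mul_comm (√(v ⬝ᵥ v))] at this
  rwa [Matrix.mulVec_transpose, dotProduct_comm, ← dotProduct_mulVec]

theorem OpBound.mulVec_self_le {W : Matrix α β ℝ} (h : OpBound W 1) (v : β → ℝ) :
    (W *ᵥ v) ⬝ᵥ (W *ᵥ v) ≤ v ⬝ᵥ v := by
  have h1 := h (W *ᵥ v) v
  set a := (W *ᵥ v) ⬝ᵥ (W *ᵥ v) with ha
  have ha0 : 0 ≤ a := dotProduct_self_nonneg' _
  have hb0 : 0 ≤ v ⬝ᵥ v := dotProduct_self_nonneg' _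
  rw [one_mul] at h1
  rcases ha0.eq_or_lt with h0 | h0
  · rw [← h0]; exact hb0
  · have h2 : √a ≤ √(v ⬝ᵥ v) := by
      have : √a * √a ≤ √a * √(v ⬝ᵥ v) := by rwa [Real.mul_self_sqrt ha0]
      exact le_of_mul_le_mul_left this (Real.sqrt_pos.2 h0)
    exact (Real.sqrt_le_sqrt_iff hb0).1 h2

theorem OpBound.nonneg_mono {W : Matrix α β ℝ} {b b' : ℝ} (h : OpBound W b) (hb : b ≤ b') :
    OpBound W b' := fun u v =>
  (h u v).trans (mul_le_mul_of_nonneg_right hb (by positivity))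

theorem proj_pythagoras [DecidableEq α] {R : Matrix α α ℝ} (hR : Rᵀ = R) (hRR : R * R = R)
    (x : α → ℝ) :
    (R *ᵥ x) ⬝ᵥ (R *ᵥ x) + ((1 - R) *ᵥ x) ⬝ᵥ ((1 - R) *ᵥ x) = x ⬝ᵥ x := by
  have e : (R *ᵥ x) ⬝ᵥ (R *ᵥ x) = x ⬝ᵥ (R *ᵥ x) := by
    rw [dotProduct_mulVec, ← mulVec_transpose, hR, mulVec_mulVec, hRR, dotProduct_comm]
  rw [sub_mulVec, one_mulVec, sub_dotProduct, dotProduct_sub, dotProduct_sub, e,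
    dotProduct_comm (R *ᵥ x) x]
  ring

/-- The block diagonal combination of two contractions is a contraction. -/
theorem OpBound.blockDiag {W₁ W₂ : Matrix α β ℝ} (h₁ : OpBound W₁ 1) (h₂ : OpBound W₂ 1)
    [DecidableEq α] [DecidableEq β] {P : Matrix α α ℝ} {Q : Matrix β β ℝ}
    (hP : Pᵀ = P) (hPP : P * P = P) (hQ : Qᵀ = Q) (hQQ : Q * Q = Q) :
    OpBound (P * W₁ * Q + (1 - P) * W₂ * (1 - Q)) 1 := by
  intro u v
  have e1 : u ⬝ᵥ ((P * W₁ * Q + (1 - P) * W₂ * (1 - Q)) *ᵥ v) =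
      (P *ᵥ u) ⬝ᵥ (W₁ *ᵥ (Q *ᵥ v)) + ((1 - P) *ᵥ u) ⬝ᵥ (W₂ *ᵥ ((1 - Q) *ᵥ v)) := by
    have hP' : (1 - P)ᵀ = 1 - P := by rw [transpose_sub, transpose_one, hP]
    rw [add_mulVec, dotProduct_add, Matrix.mul_assoc, Matrix.mul_assoc, ← mulVec_mulVec,
      ← mulVec_mulVec, ← mulVec_mulVec, ← mulVec_mulVec, dotProduct_mulVec, ← mulVec_transpose, hP,
      dotProduct_mulVec u (1 - P), ← mulVec_transpose, hP']
  rw [e1, one_mul]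
  have a1 := h₁ (P *ᵥ u) (Q *ᵥ v)
  have a2 := h₂ ((1 - P) *ᵥ u) ((1 - Q) *ᵥ v)
  have p1 := proj_pythagoras hP hPP u
  have p2 := proj_pythagoras hQ hQQ v
  set a := (P *ᵥ u) ⬝ᵥ (P *ᵥ u)
  set b := ((1 - P) *ᵥ u) ⬝ᵥ ((1 - P) *ᵥ u)
  set c := (Q *ᵥ v) ⬝ᵥ (Q *ᵥ v)
  set d := ((1 - Q) *ᵥ v) ⬝ᵥ ((1 - Q) *ᵥ v)
  have ha : 0 ≤ a := dotProduct_self_nonneg' _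
  have hb : 0 ≤ b := dotProduct_self_nonneg' _
  have hc : 0 ≤ c := dotProduct_self_nonneg' _
  have hd : 0 ≤ d := dotProduct_self_nonneg' _
  -- Cauchy–Schwarz in the plane; by Pythagoras the squared lengths of the two blocks add up to
  -- those of `u` and `v`.
  have key : √a * √c + √b * √d ≤ √(a + b) * √(c + d) := by
    rw [← Real.sqrt_mul (add_nonneg ha hb)]
    apply Real.le_sqrt_of_sq_le
    have s1 := Real.sq_sqrt ha
    have s2 := Real.sq_sqrt hb
    have s3 := Real.sq_sqrt hc
    have s4 := Real.sq_sqrt hd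
    nlinarith [sq_nonneg (√a * √d - √b * √c)]
  rw [← p1, ← p2]
  linarith

end Basics

/-! ### Singular values and trace duality. -/

variable {n T : ℕ}

/-- The spectral theorem for `√(AᵀA)`: `V` holds the right singular vectors and `s` the singular
values. Left singular vectors are not needed; it is enough that the columns of `A * V` are
orthogonal with lengths `s j`. -/
theorem exists_svd (A : Matrix (Fin n) (Fin T) ℝ) :
    ∃ (V : Matrix (Fin T) (Fin T) ℝ) (s : Fin T → ℝ), Vᵀ * V = 1 ∧ V * Vᵀ = 1 ∧ (∀ j, 0 ≤ s j) ∧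
      (A * V)ᵀ * (A * V) = diagonal (fun j => s j ^ 2) ∧ nuclearNorm A = ∑ j, s j := by
  set S := CFC.sqrt (Aᵀ * A) with hS
  have hpos : (0 : Matrix (Fin T) (Fin T) ℝ) ≤ Aᵀ * A := by
    rw [Matrix.nonneg_iff_posSemidef]
    simpa using Matrix.posSemidef_conjTranspose_mul_self A
  have hSpsd : S.PosSemidef := Matrix.nonneg_iff_posSemidef.1 (CFC.sqrt_nonneg _)
  have hSS : S * S = Aᵀ * A := CFC.sqrt_mul_sqrt_self _ hpos
  have hH : S.IsHermitian := hSpsd.1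
  set V : Matrix (Fin T) (Fin T) ℝ := hH.eigenvectorUnitary.1 with hV
  have h1 : Vᵀ * V = 1 := by
    have := (Matrix.mem_unitaryGroup_iff'.1 hH.eigenvectorUnitary.2)
    simpa [star_eq_conjTranspose] using this
  have h2 : V * Vᵀ = 1 := by
    have := (Matrix.mem_unitaryGroup_iff.1 hH.eigenvectorUnitary.2)
    simpa [star_eq_conjTranspose] using this
  have hspec : S = V * diagonal hH.eigenvalues * Vᵀ := by
    have := hH.spectral_theorem
    rw [Unitary.conjStarAlgAut_apply] at this
    simpa [star_eq_conjTranspose, hV, Function.comp_def] using this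
  have hSS' : Aᵀ * A = V * diagonal hH.eigenvalues * Vᵀ * (V * diagonal hH.eigenvalues * Vᵀ) := by
    rw [← hspec, hSS]
  refine ⟨V, hH.eigenvalues, h1, h2, hSpsd.eigenvalues_nonneg, ?_, ?_⟩
  · rw [transpose_mul, Matrix.mul_assoc, ← Matrix.mul_assoc Aᵀ, hSS']
    have : Vᵀ * (V * diagonal hH.eigenvalues * Vᵀ * (V * diagonal hH.eigenvalues * Vᵀ) * V) =
      (Vᵀ * V) * diagonal hH.eigenvalues * (Vᵀ * V) * diagonal hH.eigenvalues * (Vᵀ * V) := by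
        simp only [Matrix.mul_assoc]
    rw [this, h1]
    simp [diagonal_mul_diagonal, pow_two]
  · rw [nuclearNorm, ← hS, hH.trace_eq_sum_eigenvalues]
    simp

theorem nuclearNorm_nonneg (A : Matrix (Fin n) (Fin T) ℝ) : 0 ≤ nuclearNorm A := by
  obtain ⟨V, s, -, -, hs, -, h⟩ := exists_svd A
  rw [h]
  exact Finset.sum_nonneg fun j _ => hs j

/-- The trace is computed in the basis of right singular vectors, where the `j`-th term pairs a
vector of length `s j` with the image under `W` of a unit vector. -/
theorem OpBound.frobInner_le {W A : Matrix (Fin n) (Fin T) ℝ} {b : ℝ} (h : OpBound W b) :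
    frobInner W A ≤ b * nuclearNorm A := by
  obtain ⟨V, s, h1, h2, hs, hC, hn⟩ := exists_svd A
  have e : frobInner W A = ∑ j, (A * V).col j ⬝ᵥ (W *ᵥ V.col j) := by
    have : frobInner W A = ((A * V)ᵀ * (W * V)).trace := by
      rw [frobInner_comm, frobInner_eq_trace, transpose_mul, Matrix.mul_assoc,
        Matrix.trace_mul_comm Vᵀ, Matrix.mul_assoc, Matrix.mul_assoc, h2, Matrix.mul_one]
    rw [this]
    rfl
  rw [e, hn, Finset.mul_sum]
  refine Finset.sum_le_sum fun j _ => (h _ _).trans_eq ?_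
  have c1 : (A * V).col j ⬝ᵥ (A * V).col j = s j ^ 2 := by
    have := congrFun (congrFun hC j) j
    rw [diagonal_apply_eq] at this
    rw [← this]; rfl
  have c2 : V.col j ⬝ᵥ V.col j = 1 := by
    have := congrFun (congrFun h1 j) j
    rw [one_apply_eq] at this
    rw [← this]; rfl
  rw [c1, c2, Real.sqrt_one, Real.sqrt_sq (hs j), mul_one]

/-- The witness is the polar factor `A V diag(1/s) Vᵀ`. The convention `0⁻¹ = 0` makes it vanish on
the kernel of `A`, so it stays a contraction when singular values are zero. The triangle inequality
and the other norm properties follow from this duality. -/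
theorem exists_dual (A : Matrix (Fin n) (Fin T) ℝ) :
    ∃ W : Matrix (Fin n) (Fin T) ℝ, OpBound W 1 ∧ frobInner W A = nuclearNorm A := by
  obtain ⟨V, s, h1, h2, hs, hC, hn⟩ := exists_svd A
  set D : Matrix (Fin T) (Fin T) ℝ := diagonal fun j => (s j)⁻¹ with hD
  have hDt : Dᵀ = D := by simp [hD]
  refine ⟨A * V * D * Vᵀ, ?_, ?_⟩
  · apply opBound_of_mulVec
    intro v
    set x := Vᵀ *ᵥ v with hx
    have e1 : (A * V * D * Vᵀ) *ᵥ v = (A * V * D) *ᵥ x := by rw [hx, mulVec_mulVec]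
    have e2 : v ⬝ᵥ v = x ⬝ᵥ x := by
      rw [hx, dotProduct_mulVec, ← mulVec_transpose, transpose_transpose, mulVec_mulVec, h2,
        one_mulVec]
    have e3 : ((A * V * D) *ᵥ x) ⬝ᵥ ((A * V * D) *ᵥ x) =
        x ⬝ᵥ (((A * V * D)ᵀ * (A * V * D)) *ᵥ x) := by
      rw [dotProduct_mulVec, ← mulVec_transpose, mulVec_mulVec, dotProduct_comm]
    have e4 : (A * V * D)ᵀ * (A * V * D) = diagonal fun j => (s j)⁻¹ * s j ^ 2 * (s j)⁻¹ := by
      rw [transpose_mul, hDt, Matrix.mul_assoc, ← Matrix.mul_assoc (A * V)ᵀ, hC, hD,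
        diagonal_mul_diagonal, diagonal_mul_diagonal]
      simp [mul_assoc]
    rw [e1, e2, e3, e4]
    simp only [dotProduct, mulVec_diagonal]
    refine Finset.sum_le_sum fun j _ => ?_
    rcases eq_or_ne (s j) 0 with h0 | h0
    · simp [h0, mul_self_nonneg]
    · have : (s j)⁻¹ * s j ^ 2 * (s j)⁻¹ = 1 := by field_simp
      rw [this, one_mul]
  · rw [frobInner_eq_trace, transpose_mul, transpose_mul, transpose_transpose, hDt,
      Matrix.mul_assoc, Matrix.trace_mul_comm, Matrix.mul_assoc, Matrix.mul_assoc, hC, hD,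
      diagonal_mul_diagonal, trace_diagonal, hn]
    refine Finset.sum_congr rfl fun j _ => ?_
    rcases eq_or_ne (s j) 0 with h0 | h0
    · simp [h0]
    · field_simp

theorem nuclearNorm_add_le (A B : Matrix (Fin n) (Fin T) ℝ) :
    nuclearNorm (A + B) ≤ nuclearNorm A + nuclearNorm B := by
  obtain ⟨W, hW, h⟩ := exists_dual (A + B)
  rw [← h, frobInner_add_right]
  have h1 := hW.frobInner_le (A := A)
  have h2 := hW.frobInner_le (A := B)
  linarith

theorem nuclearNorm_smul_le {c : ℝ} (hc : 0 ≤ c) (A : Matrix (Fin n) (Fin T) ℝ) :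
    nuclearNorm (c • A) ≤ c * nuclearNorm A := by
  obtain ⟨W, hW, h⟩ := exists_dual (c • A)
  rw [← h, frobInner_smul_right]
  have h1 := hW.frobInner_le (A := A)
  exact mul_le_mul_of_nonneg_left (by linarith) hc

theorem nuclearNorm_neg_le (A : Matrix (Fin n) (Fin T) ℝ) : nuclearNorm (-A) ≤ nuclearNorm A := by
  obtain ⟨W, hW, h⟩ := exists_dual (-A)
  have h2 : OpBound (-W) 1 := fun u v => by
    have := hW (-u) v
    simpa [neg_mulVec] using this
  have h3 : frobInner W (-A) = frobInner (-W) A := by simp [frobInner]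
  rw [← h, h3]
  simpa using h2.frobInner_le (A := A)

theorem nuclearNorm_neg (A : Matrix (Fin n) (Fin T) ℝ) : nuclearNorm (-A) = nuclearNorm A :=
  le_antisymm (nuclearNorm_neg_le A) (by simpa using nuclearNorm_neg_le (-A))

theorem nuclearNorm_zero : nuclearNorm (0 : Matrix (Fin n) (Fin T) ℝ) = 0 := by
  obtain ⟨W, hW, h⟩ := exists_dual (0 : Matrix (Fin n) (Fin T) ℝ)
  rw [← h]; simp [frobInner]

theorem eq_zero_of_nuclearNorm_le {A : Matrix (Fin n) (Fin T) ℝ} (h : nuclearNorm A ≤ 0) :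
    A = 0 := by
  obtain ⟨V, s, h1, h2, hs, hC, hn⟩ := exists_svd A
  have hs0 : ∀ j, s j = 0 := by
    have : ∑ j, s j = 0 := le_antisymm (hn ▸ h) (Finset.sum_nonneg fun j _ => hs j)
    intro j
    exact (Finset.sum_eq_zero_iff_of_nonneg fun j _ => hs j).1 this j (Finset.mem_univ j)
  have : (A * V)ᵀ * (A * V) = 0 := by rw [hC]; simp [hs0]
  have hAV : A * V = 0 := by
    have h' : (A * V)ᴴ * (A * V) = 0 := by simpa using this
    exact Matrix.conjTranspose_mul_self_eq_zero.1 h'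
  calc A = A * V * Vᵀ := by rw [Matrix.mul_assoc, h2, Matrix.mul_one]
    _ = 0 := by rw [hAV, Matrix.zero_mul]

/-- Zeroing rows does not increase the nuclear norm. -/
theorem nuclearNorm_mask_le (G : Finset (Fin n)) (A : Matrix (Fin n) (Fin T) ℝ) :
    nuclearNorm (diagonal (fun i => if i ∈ G then (1 : ℝ) else 0) * A) ≤ nuclearNorm A := by
  set P : Matrix (Fin n) (Fin n) ℝ := diagonal (fun i => if i ∈ G then (1 : ℝ) else 0)
  obtain ⟨W, hW, h⟩ := exists_dual (P * A)
  have hP : Pᵀ = P := by simp [P]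
  have hPP : P * P = P := by
    simp only [P, diagonal_mul_diagonal]; congr 1; funext i; split_ifs <;> simp
  have h0 : OpBound (0 : Matrix (Fin n) (Fin T) ℝ) 1 := fun u v => by
    simp; positivity
  have h2 : OpBound (P * W) 1 := by
    have := hW.blockDiag h0 hP hPP (Q := 1) (by simp) (by simp)
    simpa using this
  rw [← h, frobInner_mul_left, hP]
  simpa using h2.frobInner_le (A := A)

/-! ### Projections onto column spaces and the cone inequality -/

/-- The spectral projection of `B * Bᵀ` to its nonzero eigenvalues projects onto the column space of
`B`; its trace counts those eigenvalues. -/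
theorem exists_proj {m k : ℕ} (B : Matrix (Fin m) (Fin k) ℝ) :
    ∃ P : Matrix (Fin m) (Fin m) ℝ, Pᵀ = P ∧ P * P = P ∧ P * B = B ∧ P.trace = B.rank := by
  have hH : (B * Bᵀ).IsHermitian := by
    simpa using Matrix.isHermitian_mul_conjTranspose_self B
  set V : Matrix (Fin m) (Fin m) ℝ := hH.eigenvectorUnitary.1 with hV
  have h1 : Vᵀ * V = 1 := by
    have := (Matrix.mem_unitaryGroup_iff'.1 hH.eigenvectorUnitary.2)
    simpa [star_eq_conjTranspose] using this
  have h2 : V * Vᵀ = 1 := by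
    have := (Matrix.mem_unitaryGroup_iff.1 hH.eigenvectorUnitary.2)
    simpa [star_eq_conjTranspose] using this
  have hspec : B * Bᵀ = V * diagonal hH.eigenvalues * Vᵀ := by
    have := hH.spectral_theorem
    rw [Unitary.conjStarAlgAut_apply] at this
    simpa [star_eq_conjTranspose, hV, Function.comp_def] using this
  set e : Fin m → ℝ := fun j => if hH.eigenvalues j ≠ 0 then 1 else 0 with he
  have hP : (V * diagonal e * Vᵀ)ᵀ = V * diagonal e * Vᵀ := by
    simp [transpose_mul, Matrix.mul_assoc]
  refine ⟨V * diagonal e * Vᵀ, hP, ?_, ?_, ?_⟩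
  · calc V * diagonal e * Vᵀ * (V * diagonal e * Vᵀ)
        = V * diagonal e * (Vᵀ * V) * diagonal e * Vᵀ := by simp only [Matrix.mul_assoc]
      _ = V * (diagonal e * diagonal e) * Vᵀ := by
        rw [h1, Matrix.mul_one, Matrix.mul_assoc V]
      _ = V * diagonal e * Vᵀ := by
        rw [diagonal_mul_diagonal]; congr; funext j; simp only [he]; split_ifs <;> simp
  · set P := V * diagonal e * Vᵀ with hPdef
    have hz : (1 - P) * (B * Bᵀ) = 0 := by
      have : P * (B * Bᵀ) = B * Bᵀ := by
        rw [hspec, hPdef]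
        calc V * diagonal e * Vᵀ * (V * diagonal hH.eigenvalues * Vᵀ)
            = V * diagonal e * (Vᵀ * V) * diagonal hH.eigenvalues * Vᵀ := by
              simp only [Matrix.mul_assoc]
          _ = V * (diagonal e * diagonal hH.eigenvalues) * Vᵀ := by
              rw [h1, Matrix.mul_one, Matrix.mul_assoc V]
          _ = V * diagonal hH.eigenvalues * Vᵀ := by
              rw [diagonal_mul_diagonal]; congr; funext j; simp only [he]
              split_ifs with h
              · simp
              · push Not at h; simp [h]
      rw [Matrix.sub_mul, Matrix.one_mul, this, sub_self]
    have hz2 : ((1 - P) * B) * ((1 - P) * B)ᴴ = 0 := by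
      rw [conjTranspose_eq_transpose_of_trivial, transpose_mul, Matrix.mul_assoc,
        ← Matrix.mul_assoc B, ← Matrix.mul_assoc, hz, Matrix.zero_mul]
    have := Matrix.self_mul_conjTranspose_eq_zero.1 hz2
    rw [Matrix.sub_mul, Matrix.one_mul, sub_eq_zero] at this
    exact this.symm
  · rw [Matrix.trace_mul_comm, ← Matrix.mul_assoc, h1, Matrix.one_mul, trace_diagonal]
    have hr : B.rank = Fintype.card {i // hH.eigenvalues i ≠ 0} := by
      rw [← hH.rank_eq_card_non_zero_eigs, Matrix.rank_self_mul_transpose]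
    rw [hr, Fintype.card_subtype]
    simp [he, Finset.sum_ite]

theorem frobInner_proj_le {P : Matrix (Fin n) (Fin n) ℝ} (hP : Pᵀ = P) (hPP : P * P = P)
    (A : Matrix (Fin n) (Fin T) ℝ) : frobInner (P * A) (P * A) ≤ frobInner A A := by
  have h : frobInner (P * A) (P * A) = frobInner A (P * A) := by
    rw [frobInner_mul_left P A A, frobInner_mul_left, ← Matrix.mul_assoc, hP, hPP]
  have h2 := frobInner_le_sqrt A (P * A)
  rw [← h] at h2
  have h3 := frobInner_self_nonneg (P * A)
  have h4 := frobInner_self_nonneg A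
  have s1 := Real.sq_sqrt h3
  have s2 := Real.sq_sqrt h4
  have t1 := Real.sqrt_nonneg (frobInner (P * A) (P * A))
  have t2 := Real.sqrt_nonneg (frobInner A A)
  nlinarith [sq_nonneg (√(frobInner (P * A) (P * A)) - √(frobInner A A))]

theorem frobInner_transpose (A B : Matrix (Fin n) (Fin T) ℝ) :
    frobInner Aᵀ Bᵀ = frobInner A B := by
  simp only [frobInner, transpose_apply]
  exact Finset.sum_comm

/-- Each row of `P * W` is `Wᵀ` applied to the same row of `P`, hence no longer than it, and the
squared row lengths of a projection sum to its trace. Through duality this gives the comparison of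
nuclear and Frobenius norms with the factor `√rank`. -/
theorem OpBound.frobInner_proj_le_trace {P : Matrix (Fin n) (Fin n) ℝ} (hP : Pᵀ = P)
    (hPP : P * P = P) {W : Matrix (Fin n) (Fin T) ℝ} (hW : OpBound W 1) :
    frobInner (P * W) (P * W) ≤ P.trace := by
  have h1 : ∀ i, ∑ t, (P * W) i t * (P * W) i t ≤ ∑ j, P i j * P i j := by
    intro i
    have := hW.transpose.mulVec_self_le (P i)
    simpa [dotProduct, mulVec, mul_apply, transpose_apply, mul_comm] using this
  calc frobInner (P * W) (P * W) ≤ ∑ i, ∑ j, P i j * P i j := Finset.sum_le_sum fun i _ => h1 i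
    _ = frobInner P P := rfl
    _ = P.trace := by rw [frobInner_eq_trace, hP, hPP]

theorem nuclearNorm_proj_le {P : Matrix (Fin n) (Fin n) ℝ} (hP : Pᵀ = P) (hPP : P * P = P)
    (A : Matrix (Fin n) (Fin T) ℝ) :
    nuclearNorm (P * A) ≤ √P.trace * √(frobInner A A) := by
  obtain ⟨W, hW, h⟩ := exists_dual (P * A)
  rw [← h, frobInner_mul_left, hP]
  exact (frobInner_le_sqrt _ _).trans (mul_le_mul_of_nonneg_right
    (Real.sqrt_le_sqrt (hW.frobInner_proj_le_trace hP hPP)) (Real.sqrt_nonneg _))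

theorem nuclearNorm_proj_right_le {P : Matrix (Fin T) (Fin T) ℝ} (hP : Pᵀ = P) (hPP : P * P = P)
    (A : Matrix (Fin n) (Fin T) ℝ) :
    nuclearNorm (A * P) ≤ √P.trace * √(frobInner A A) := by
  obtain ⟨W, hW, h⟩ := exists_dual (A * P)
  rw [← h, frobInner_mul_right, hP]
  have := hW.transpose.frobInner_proj_le_trace hP hPP
  have e : frobInner (W * P) (W * P) = frobInner (P * Wᵀ) (P * Wᵀ) := by
    rw [← frobInner_transpose, transpose_mul, hP]
  exact (frobInner_le_sqrt _ _).trans (mul_le_mul_of_nonneg_right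
    (Real.sqrt_le_sqrt (e ▸ this)) (Real.sqrt_nonneg _))

/-- Decomposability of the nuclear norm around an approximately low rank matrix. -/
theorem nuclearNorm_cone (B E D : Matrix (Fin n) (Fin T) ℝ) :
    ∃ N₁ N₂ : ℝ, 0 ≤ N₁ ∧ 0 ≤ N₂ ∧ nuclearNorm D ≤ N₁ + N₂ ∧
      nuclearNorm (B - E) - nuclearNorm (B - E + D) ≤ N₁ - N₂ + 2 * nuclearNorm E ∧
      N₁ ≤ 2 * √(B.rank : ℝ) * √(frobInner D D) := by
  obtain ⟨P, hP, hPP, hPB, hPt⟩ := exists_proj B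
  obtain ⟨Q, hQ, hQQ, hQB, hQt⟩ := exists_proj Bᵀ
  rw [Matrix.rank_transpose] at hQt
  have hBQ : B * Q = B := by
    have := congrArg transpose hQB
    simpa [transpose_mul, hQ] using this
  have hP1 : (1 - P)ᵀ = 1 - P := by rw [transpose_sub, transpose_one, hP]
  have hP2 : (1 - P) * (1 - P) = 1 - P := by
    simp [Matrix.sub_mul, Matrix.mul_sub, hPP]
  have hQ1 : (1 - Q)ᵀ = 1 - Q := by rw [transpose_sub, transpose_one, hQ]
  -- `D₂` has row and column spaces orthogonal to those of `B`, so the nuclear norms of `B` and `D₂`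
  -- add; the rest `D₁` has rank at most twice that of `B`.
  set D₂ := (1 - P) * D * (1 - Q) with hD₂
  set D₁ := P * D + (1 - P) * D * Q with hD₁
  have hD : D = D₁ + D₂ := by
    simp only [hD₁, hD₂, Matrix.mul_sub, Matrix.sub_mul, Matrix.mul_one, Matrix.one_mul]
    abel
  refine ⟨nuclearNorm D₁, nuclearNorm D₂, nuclearNorm_nonneg _, nuclearNorm_nonneg _, ?_, ?_, ?_⟩
  · conv_lhs => rw [hD]
    exact nuclearNorm_add_le _ _
  · obtain ⟨W₁, hW₁, e₁⟩ := exists_dual B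
    obtain ⟨W₂, hW₂, e₂⟩ := exists_dual D₂
    -- A single contraction, dual to `B` on one block and to `D₂` on the complementary one,
    -- certifies the additivity.
    have hW := hW₁.blockDiag hW₂ hP hPP hQ hQQ
    have k1 : nuclearNorm B + nuclearNorm D₂ ≤ nuclearNorm (B + D₂) := by
      have a := hW.frobInner_le (A := B + D₂)
      have hPD : P * D₂ = 0 := by
        rw [hD₂, ← Matrix.mul_assoc, ← Matrix.mul_assoc, Matrix.mul_sub P 1 P, Matrix.mul_one, hPP,
          sub_self, Matrix.zero_mul, Matrix.zero_mul]
      have b1 : frobInner (P * W₁ * Q) (B + D₂) = frobInner W₁ B := by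
        have : frobInner (P * W₁ * Q) (B + D₂) = frobInner W₁ (P * (B + D₂) * Q) := by
          rw [frobInner_mul_right, frobInner_mul_left, hP, hQ, Matrix.mul_assoc]
        rw [this, Matrix.mul_add, hPB, hPD, add_zero, hBQ]
      have b2 : frobInner ((1 - P) * W₂ * (1 - Q)) (B + D₂) = frobInner W₂ D₂ := by
        have : frobInner ((1 - P) * W₂ * (1 - Q)) (B + D₂) =
            frobInner W₂ ((1 - P) * (B + D₂) * (1 - Q)) := by
          rw [frobInner_mul_right, frobInner_mul_left, hP1, hQ1, Matrix.mul_assoc]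
        rw [this, Matrix.mul_add, Matrix.sub_mul 1 P B, Matrix.one_mul, hPB, sub_self, zero_add,
          Matrix.sub_mul 1 P D₂, hPD, sub_zero, Matrix.one_mul, hD₂, Matrix.mul_assoc,
          Matrix.mul_sub, Matrix.mul_one]
        have : (1 - Q) * Q = 0 := by rw [Matrix.sub_mul, hQQ, Matrix.one_mul, sub_self]
        rw [this, sub_zero]
      rw [frobInner_add_left, b1, b2, e₁, e₂, one_mul] at a
      exact a
    have k2 : nuclearNorm (B + D₂) ≤ nuclearNorm (B - E + D) + (nuclearNorm E + nuclearNorm D₁) := by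
      have : B + D₂ = (B - E + D) + (E + -D₁) := by rw [hD]; abel
      rw [this]
      refine (nuclearNorm_add_le _ _).trans (add_le_add le_rfl ((nuclearNorm_add_le _ _).trans ?_))
      rw [nuclearNorm_neg]
    have k3 : nuclearNorm (B - E) ≤ nuclearNorm B + nuclearNorm E := by
      rw [sub_eq_add_neg]
      refine (nuclearNorm_add_le _ _).trans ?_
      rw [nuclearNorm_neg]
    linarith
  · have a1 := nuclearNorm_proj_le hP hPP D
    have a2 := nuclearNorm_proj_right_le hQ hQQ ((1 - P) * D)
    have a3 := Real.sqrt_le_sqrt (frobInner_proj_le hP1 hP2 D)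
    rw [hPt] at a1
    rw [hQt] at a2
    have a4 := nuclearNorm_add_le (P * D) ((1 - P) * D * Q)
    have a5 := mul_le_mul_of_nonneg_left a3 (Real.sqrt_nonneg (B.rank : ℝ))
    linarith

theorem frobeniusNorm_sq (A : Matrix (Fin n) (Fin T) ℝ) :
    frobeniusNorm A ^ 2 = frobInner A A := by
  have h : ∑ i, ∑ t, A i t ^ 2 = frobInner A A := by simp only [frobInner, pow_two]
  rw [frobeniusNorm, h, Real.sq_sqrt (frobInner_self_nonneg A)]

end LinearAlgebra

/-! ### A lattice net of the Euclidean ball -/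

section Net

open Matrix

variable {α β : Type*} [Fintype α] [Fintype β]

/-- The one-coordinate factor of the generating function that counts lattice vectors by ℓ₁ length.
-/
theorem sum_Icc_half_pow (B : ℕ) :
    ∑ k ∈ Finset.Icc (-(B : ℤ)) B, (1 / 2 : ℝ) ^ k.natAbs = 3 - 2 * (1 / 2) ^ B := by
  induction B with
  | zero => norm_num
  | succ B ih =>
    have h : Finset.Icc (-((B + 1 : ℕ) : ℤ)) ((B + 1 : ℕ) : ℤ) =
        insert (-((B : ℤ) + 1)) (insert ((B : ℤ) + 1) (Finset.Icc (-(B : ℤ)) B)) := by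
      ext k; simp only [Finset.mem_Icc, Finset.mem_insert]; push_cast; omega
    have e1 : (-((B : ℤ) + 1)).natAbs = B + 1 := by omega
    have e2 : ((B : ℤ) + 1).natAbs = B + 1 := by omega
    rw [h, Finset.sum_insert, Finset.sum_insert, ih, e1, e2]
    · ring
    · simp
    · simp only [Finset.mem_Icc, Finset.mem_insert]; omega

variable (α) in
/-- Lattice vectors of moderate length. -/
noncomputable def latticeNet [DecidableEq α] : Finset (α → ℤ) :=
  {k ∈ Fintype.piFinset fun _ => Finset.Icc (-((5 * Fintype.card α : ℕ) : ℤ))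
      ((5 * Fintype.card α : ℕ) : ℤ) |
    ∑ j, (k j).natAbs ≤ 5 * Fintype.card α ∧ ∑ j, (k j : ℝ) ^ 2 ≤ 25 * Fintype.card α}

/-- Each lattice vector of ℓ₁ length at most `5N` has weight `2^(5N) 2^(-ℓ₁)` at least one, and the
total weight over the cube factorizes into `N` sums of at most 3; `32 · 3 = 96`. -/
theorem card_latticeNet_le [DecidableEq α] :
    ((latticeNet α).card : ℝ) ≤ 96 ^ Fintype.card α := by
  set N := Fintype.card α with hN
  have h1 : ((latticeNet α).card : ℝ) ≤ ∑ k ∈ latticeNet α,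
      (2 : ℝ) ^ (5 * N) * ∏ j, (1 / 2 : ℝ) ^ (k j).natAbs := by
    rw [Finset.card_eq_sum_ones, Nat.cast_sum]
    refine Finset.sum_le_sum fun k hk => ?_
    have hk' := (Finset.mem_filter.1 hk).2.1
    rw [Finset.prod_pow_eq_pow_sum, Nat.cast_one, one_div, inv_pow]
    rw [← div_eq_mul_inv, one_le_div (by positivity)]
    exact pow_le_pow_right₀ (by norm_num) hk'
  have h2 : ∑ k ∈ latticeNet α, (2 : ℝ) ^ (5 * N) * ∏ j, (1 / 2 : ℝ) ^ (k j).natAbs ≤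
      ∑ k ∈ Fintype.piFinset fun _ : α => Finset.Icc (-((5 * N : ℕ) : ℤ)) ((5 * N : ℕ) : ℤ),
        (2 : ℝ) ^ (5 * N) * ∏ j, (1 / 2 : ℝ) ^ (k j).natAbs :=
    Finset.sum_le_sum_of_subset_of_nonneg (Finset.filter_subset _ _)
      fun k _ _ => by positivity
  have h3 : ∑ k ∈ Fintype.piFinset fun _ : α => Finset.Icc (-((5 * N : ℕ) : ℤ)) ((5 * N : ℕ) : ℤ),
        (2 : ℝ) ^ (5 * N) * ∏ j, (1 / 2 : ℝ) ^ (k j).natAbs =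
      2 ^ (5 * N) * (3 - 2 * (1 / 2) ^ (5 * N)) ^ N := by
    rw [← Finset.mul_sum, Finset.sum_prod_piFinset
      (g := fun (_ : α) (k : ℤ) => (1 / 2 : ℝ) ^ k.natAbs)]
    simp only [sum_Icc_half_pow]
    simp [hN]
  have hp : (0 : ℝ) ≤ 3 - 2 * (1 / 2) ^ (5 * N) := by
    have : (1 / 2 : ℝ) ^ (5 * N) ≤ 1 := pow_le_one₀ (by norm_num) (by norm_num)
    linarith
  have h4 : (3 - 2 * (1 / 2) ^ (5 * N) : ℝ) ^ N ≤ 3 ^ N := by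
    refine pow_le_pow_left₀ hp ?_ N
    have : (0 : ℝ) ≤ (1 / 2) ^ (5 * N) := by positivity
    linarith
  calc ((latticeNet α).card : ℝ) ≤ 2 ^ (5 * N) * (3 - 2 * (1 / 2) ^ (5 * N)) ^ N :=
        (h1.trans h2).trans_eq h3
    _ ≤ 2 ^ (5 * N) * 3 ^ N := mul_le_mul_of_nonneg_left h4 (by positivity)
    _ = 96 ^ N := by rw [pow_mul, ← mul_pow]; norm_num

open Classical in
variable (α) in
/-- A finite net of the Euclidean unit ball. -/
noncomputable def ballNet : Finset (α → ℝ) :=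
  (latticeNet α).image fun k j => (k j : ℝ) / (4 * √(Fintype.card α : ℝ))

theorem card_ballNet_le : ((ballNet α).card : ℝ) ≤ 96 ^ Fintype.card α := by
  classical
  refine le_trans ?_ (card_latticeNet_le (α := α))
  refine Nat.cast_le.2 ?_
  rw [ballNet]
  convert Finset.card_image_le

theorem ballNet_norm_le {x : α → ℝ} (hx : x ∈ ballNet α) : x ⬝ᵥ x ≤ 25 / 16 := by
  classical
  rw [ballNet, Finset.mem_image] at hx
  obtain ⟨k, hk, rfl⟩ := hx
  have h2 := (Finset.mem_filter.1 hk).2.2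
  have e : (fun j => (k j : ℝ) / (4 * √(Fintype.card α : ℝ))) ⬝ᵥ
      (fun j => (k j : ℝ) / (4 * √(Fintype.card α : ℝ))) =
      (∑ j, (k j : ℝ) ^ 2) / (16 * Fintype.card α) := by
    rw [dotProduct, Finset.sum_div]
    refine Finset.sum_congr rfl fun j _ => ?_
    rw [div_mul_div_comm, ← pow_two, mul_mul_mul_comm, Real.mul_self_sqrt (Nat.cast_nonneg _)]
    norm_num
  rw [e]
  rcases Nat.eq_zero_or_pos (Fintype.card α) with h0 | h0
  · norm_num [h0]
  · have : (0 : ℝ) < Fintype.card α := by exact_mod_cast h0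
    rw [div_le_iff₀ (by positivity)]
    linarith

/-- Rounding `4√N u` down moves each coordinate by at most one, which after rescaling is a distance
of at most `1/4`. By Cauchy–Schwarz the ℓ₁ length of `4√N u` is at most `4N`, so the rounded vector
obeys the two constraints of `latticeNet`: `4N + N = 5N` and `16N + 8N + N = 25N`. -/
theorem exists_ballNet_near {u : α → ℝ} (hu : u ⬝ᵥ u ≤ 1) :
    ∃ x ∈ ballNet α, (u - x) ⬝ᵥ (u - x) ≤ 1 / 16 := by
  classical
  set N := Fintype.card α with hN
  set a : ℝ := 4 * √(N : ℝ) with ha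
  have ha0 : 0 ≤ a := by positivity
  have haa : a ^ 2 = 16 * N := by rw [ha, mul_pow, Real.sq_sqrt (Nat.cast_nonneg _)]; norm_num
  set k : α → ℤ := fun j => ⌊a * u j⌋ with hk
  have hk1 : ∀ j, (k j : ℝ) ≤ a * u j := fun j => Int.floor_le _
  have hk2 : ∀ j, a * u j < k j + 1 := fun j => Int.lt_floor_add_one _
  have hl2 : ∑ j, (a * |u j|) ^ 2 ≤ 16 * N := by
    have : ∑ j, (a * |u j|) ^ 2 = a ^ 2 * (u ⬝ᵥ u) := by
      rw [dotProduct, Finset.mul_sum]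
      exact Finset.sum_congr rfl fun j _ => by rw [mul_pow, sq_abs]; ring
    rw [this, haa]
    have : (0 : ℝ) ≤ 16 * N := by positivity
    nlinarith
  have hl1 : ∑ j, a * |u j| ≤ 4 * N := by
    have := Real.sum_mul_le_sqrt_mul_sqrt Finset.univ (fun j => a * |u j|) (fun _ : α => (1 : ℝ))
    simp only [mul_one, one_pow, Finset.sum_const, nsmul_eq_mul, Finset.card_univ, ← hN] at this
    refine this.trans ?_
    have h4 : √(∑ j, (a * |u j|) ^ 2) ≤ √(16 * N) := Real.sqrt_le_sqrt hl2
    have h5 : √(16 * N : ℝ) * √(N : ℝ) = 4 * N := by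
      rw [← Real.sqrt_mul (by positivity), show (16 * N * N : ℝ) = (4 * N) ^ 2 by ring,
        Real.sqrt_sq (by positivity)]
    rw [← h5]
    exact mul_le_mul_of_nonneg_right h4 (Real.sqrt_nonneg _)
  have habs : ∀ j, |(k j : ℝ)| ≤ a * |u j| + 1 := by
    intro j
    have e : |a * u j| = a * |u j| := by rw [abs_mul, abs_of_nonneg ha0]
    rw [← e]
    have := hk1 j
    have := hk2 j
    rcases abs_cases (a * u j) with h | h <;> rcases abs_cases (k j : ℝ) with h' | h' <;> linarith
  have hs1 : ∑ j, (k j).natAbs ≤ 5 * N := by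
    have : ((∑ j, (k j).natAbs : ℕ) : ℝ) ≤ ((5 * N : ℕ) : ℝ) := by
      push_cast
      calc ∑ j, ((k j).natAbs : ℝ) = ∑ j, |(k j : ℝ)| := by
            refine Finset.sum_congr rfl fun j _ => ?_
            rw [Nat.cast_natAbs, Int.cast_abs]
        _ ≤ ∑ j, (a * |u j| + 1) := Finset.sum_le_sum fun j _ => habs j
        _ = ∑ j, a * |u j| + N := by rw [Finset.sum_add_distrib]; simp [hN]
        _ ≤ 5 * N := by linarith
    exact_mod_cast this
  have hs2 : ∑ j, (k j : ℝ) ^ 2 ≤ 25 * N := by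
    calc ∑ j, (k j : ℝ) ^ 2 ≤ ∑ j, (a * |u j| + 1) ^ 2 := Finset.sum_le_sum fun j _ =>
          sq_le_sq' (by have := neg_abs_le (k j : ℝ); linarith [habs j])
            ((le_abs_self _).trans (habs j))
      _ = ∑ j, (a * |u j|) ^ 2 + 2 * ∑ j, a * |u j| + N := by
          simp only [add_sq, Finset.sum_add_distrib, Finset.mul_sum]
          simp [hN]
      _ ≤ 25 * N := by linarith
  refine ⟨fun j => (k j : ℝ) / a, ?_, ?_⟩
  · rw [ballNet, Finset.mem_image]
    refine ⟨k, Finset.mem_filter.2 ⟨?_, hs1, hs2⟩, rfl⟩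
    rw [Fintype.mem_piFinset]
    intro j
    have : (k j).natAbs ≤ 5 * N :=
      (Finset.single_le_sum (f := fun j => (k j).natAbs) (fun _ _ => Nat.zero_le _)
        (Finset.mem_univ j)).trans hs1
    rw [Finset.mem_Icc]
    omega
  · have : ∀ j, (u j - k j / a) * (u j - k j / a) ≤ 1 / (16 * N) := by
      intro j
      have hN0 : (0 : ℝ) < N := by
        have : 0 < N := Fintype.card_pos_iff.2 ⟨j⟩
        exact_mod_cast this
      have ha1 : 0 < a := by positivity
      have e : u j - k j / a = (a * u j - k j) / a := by field_simp
      rw [e, div_mul_div_comm, ← pow_two a, haa]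
      refine div_le_div_of_nonneg_right ?_ (by positivity)
      have := hk1 j
      have := hk2 j
      nlinarith
    calc (u - fun j => (k j : ℝ) / a) ⬝ᵥ (u - fun j => (k j : ℝ) / a)
        ≤ ∑ _j : α, 1 / (16 * N : ℝ) := Finset.sum_le_sum fun j _ => this j
      _ ≤ 1 / 16 := by
        rw [Finset.sum_const, nsmul_eq_mul, Finset.card_univ, ← hN]
        rcases Nat.eq_zero_or_pos N with h0 | h0
        · simp [h0]
        · have : (0 : ℝ) < N := by exact_mod_cast h0
          apply le_of_eq; field_simp

theorem zero_mem_ballNet : (0 : α → ℝ) ∈ ballNet α := by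
  classical
  rw [ballNet, Finset.mem_image]
  refine ⟨0, Finset.mem_filter.2 ⟨?_, ?_, ?_⟩, ?_⟩
  · rw [Fintype.mem_piFinset]; intro j; simp
  · simp
  · simp
  · funext j; simp

/-! ### From the net to the operator norm. -/

theorem opBound_of_unit {W : Matrix α β ℝ} {b : ℝ}
    (h : ∀ u v, u ⬝ᵥ u ≤ 1 → v ⬝ᵥ v ≤ 1 → u ⬝ᵥ (W *ᵥ v) ≤ b) : OpBound W b := by
  intro u v
  set p := √(u ⬝ᵥ u) with hp
  set q := √(v ⬝ᵥ v) with hq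
  have hp2 : p * p = u ⬝ᵥ u := Real.mul_self_sqrt (dotProduct_self_nonneg' u)
  have hq2 : q * q = v ⬝ᵥ v := Real.mul_self_sqrt (dotProduct_self_nonneg' v)
  rcases (Real.sqrt_nonneg (u ⬝ᵥ u)).eq_or_lt with h0 | h0
  · have : u = 0 := by
      rw [← hp] at h0
      rw [← h0, mul_zero] at hp2
      exact dotProduct_self_eq_zero.1 hp2.symm
    rw [hp, ← h0, this]; simp
  rcases (Real.sqrt_nonneg (v ⬝ᵥ v)).eq_or_lt with h1 | h1
  · have : v = 0 := by
      rw [← hq] at h1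
      rw [← h1, mul_zero] at hq2
      exact dotProduct_self_eq_zero.1 hq2.symm
    rw [hq, ← h1, this]; simp
  have hp0 : p ≠ 0 := h0.ne'
  have hq0 : q ≠ 0 := h1.ne'
  have := h (p⁻¹ • u) (q⁻¹ • v)
    (by rw [smul_dotProduct, dotProduct_smul, ← hp2]; simp only [smul_eq_mul]
        apply le_of_eq; field_simp)
    (by rw [smul_dotProduct, dotProduct_smul, ← hq2]; simp only [smul_eq_mul]
        apply le_of_eq; field_simp)
  rw [mulVec_smul, smul_dotProduct, dotProduct_smul, smul_eq_mul, smul_eq_mul] at this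
  have e : u ⬝ᵥ (W *ᵥ v) = (p * q) * (p⁻¹ * (q⁻¹ * (u ⬝ᵥ (W *ᵥ v)))) := by field_simp
  rw [e, mul_comm b]
  exact mul_le_mul_of_nonneg_left this (by positivity)

theorem opBound_frob (W : Matrix α β ℝ) : OpBound W (√(frobInner W W)) := by
  intro u v
  have e : u ⬝ᵥ (W *ᵥ v) = frobInner W (Matrix.of fun i j => u i * v j) := by
    simp only [dotProduct, mulVec, frobInner, of_apply, Finset.mul_sum]
    exact Finset.sum_congr rfl fun i _ => Finset.sum_congr rfl fun j _ => by ring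
  have e2 : frobInner (Matrix.of fun i j => u i * v j) (Matrix.of fun i j => u i * v j) =
      (u ⬝ᵥ u) * (v ⬝ᵥ v) := by
    simp only [dotProduct, frobInner, of_apply, Finset.sum_mul_sum]
    exact Finset.sum_congr rfl fun i _ => Finset.sum_congr rfl fun j _ => by ring
  rw [e]
  refine (frobInner_le_sqrt _ _).trans_eq ?_
  rw [e2, Real.sqrt_mul (dotProduct_self_nonneg' u)]

/-- Three times the maximum of the bilinear form of `A` over the net. -/
noncomputable def netNorm (A : Matrix α β ℝ) : ℝ :=
  3 * (ballNet α ×ˢ ballNet β).sup' ⟨(0, 0), Finset.mem_product.2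
    ⟨zero_mem_ballNet, zero_mem_ballNet⟩⟩ fun x => x.1 ⬝ᵥ (A *ᵥ x.2)

theorem le_netNorm (A : Matrix α β ℝ) {x : α → ℝ} {y : β → ℝ} (hx : x ∈ ballNet α)
    (hy : y ∈ ballNet β) : 3 * (x ⬝ᵥ (A *ᵥ y)) ≤ netNorm A := by
  refine mul_le_mul_of_nonneg_left ?_ (by norm_num)
  exact Finset.le_sup' (fun x : (α → ℝ) × (β → ℝ) => x.1 ⬝ᵥ (A *ᵥ x.2))
    (Finset.mem_product.2 (⟨hx, hy⟩ : (x, y).1 ∈ _ ∧ (x, y).2 ∈ _))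

theorem netNorm_nonneg (A : Matrix α β ℝ) : 0 ≤ netNorm A := by
  have := le_netNorm A zero_mem_ballNet zero_mem_ballNet
  simpa using this

/-- Approximating both unit vectors in the net bounds the best constant `b` by the maximum over the
net plus `b/4 + (5/4)(b/4) = 9b/16`. So `b` is at most `16/7` times that maximum, which the factor 3
in `netNorm` covers. The admissible constants form a closed set, so the best one is admissible. -/
theorem opBound_netNorm (A : Matrix α β ℝ) : OpBound A (netNorm A) := by
  set S : Set ℝ := {b | 0 ≤ b ∧ OpBound A b} with hS
  have hne : S.Nonempty := ⟨_, Real.sqrt_nonneg _, opBound_frob A⟩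
  have hbd : BddBelow S := ⟨0, fun b hb => hb.1⟩
  have hcl : IsClosed S := by
    have : S = Set.Ici 0 ∩ ⋂ (u : α → ℝ), ⋂ (v : β → ℝ),
        {b | u ⬝ᵥ (A *ᵥ v) ≤ b * (√(u ⬝ᵥ u) * √(v ⬝ᵥ v))} := by
      ext b; simp [hS, OpBound]
    rw [this]
    refine isClosed_Ici.inter (isClosed_iInter fun u => isClosed_iInter fun v => ?_)
    exact isClosed_le continuous_const (by fun_prop)
  have hmem := hcl.csInf_mem hne hbd
  set b := sInf S
  have hstep : OpBound A (netNorm A / 3 + 9 / 16 * b) := by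
    refine opBound_of_unit fun u v hu hv => ?_
    obtain ⟨x, hx, hxu⟩ := exists_ballNet_near hu
    obtain ⟨y, hy, hyv⟩ := exists_ballNet_near hv
    have e : u ⬝ᵥ (A *ᵥ v) = x ⬝ᵥ (A *ᵥ y) + (u - x) ⬝ᵥ (A *ᵥ v) + x ⬝ᵥ (A *ᵥ (v - y)) := by
      rw [mulVec_sub, dotProduct_sub, sub_dotProduct]; ring
    have h1 := le_netNorm A hx hy
    have h2 := hmem.2 (u - x) v
    have h3 := hmem.2 x (v - y)
    have s1 : √((u - x) ⬝ᵥ (u - x)) ≤ 1 / 4 := Real.sqrt_le_iff.2 ⟨by norm_num, by linarith⟩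
    have s2 : √(v ⬝ᵥ v) ≤ 1 := Real.sqrt_le_iff.2 ⟨by norm_num, by linarith⟩
    have s3 : √(x ⬝ᵥ x) ≤ 5 / 4 :=
      Real.sqrt_le_iff.2 ⟨by norm_num, by linarith [ballNet_norm_le hx]⟩
    have s4 : √((v - y) ⬝ᵥ (v - y)) ≤ 1 / 4 := Real.sqrt_le_iff.2 ⟨by norm_num, by linarith⟩
    have m1 : √((u - x) ⬝ᵥ (u - x)) * √(v ⬝ᵥ v) ≤ 1 / 4 * 1 :=
      mul_le_mul s1 s2 (Real.sqrt_nonneg _) (by norm_num)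
    have m2 : √(x ⬝ᵥ x) * √((v - y) ⬝ᵥ (v - y)) ≤ 5 / 4 * (1 / 4) :=
      mul_le_mul s3 s4 (Real.sqrt_nonneg _) (by norm_num)
    have m1' := mul_le_mul_of_nonneg_left m1 hmem.1
    have m2' := mul_le_mul_of_nonneg_left m2 hmem.1
    rw [e]
    linarith
  have hb0 := hmem.1
  have hn0 := netNorm_nonneg A
  have : b ≤ netNorm A / 3 + 9 / 16 * b := csInf_le hbd ⟨by positivity, hstep⟩
  exact hmem.2.nonneg_mono (by linarith)

/-- A crude bound for use on an exceptional event of exponentially small probability. -/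
theorem netNorm_sq_le (A : Matrix α β ℝ) (hA : ∀ i j, |A i j| ≤ 1) :
    netNorm A ^ 2 ≤ 36 * (Fintype.card α * Fintype.card β) := by
  have hF : frobInner A A ≤ Fintype.card α * Fintype.card β := by
    calc frobInner A A ≤ ∑ _i : α, ∑ _j : β, (1 : ℝ) :=
          Finset.sum_le_sum fun i _ => Finset.sum_le_sum fun j _ => by
            have := hA i j
            rw [← pow_two, ← sq_abs]
            exact pow_le_one₀ (abs_nonneg _) this
      _ = _ := by simp
  have h : netNorm A ≤ 3 * (√(frobInner A A) * 2) := by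
    refine mul_le_mul_of_nonneg_left (Finset.sup'_le _ _ fun x hx => ?_) (by norm_num)
    have hx' := Finset.mem_product.1 hx
    refine (opBound_frob A _ _).trans (mul_le_mul_of_nonneg_left ?_ (Real.sqrt_nonneg _))
    have s1 : √(x.1 ⬝ᵥ x.1) ≤ 5 / 4 :=
      Real.sqrt_le_iff.2 ⟨by norm_num, by linarith [ballNet_norm_le hx'.1]⟩
    have s2 : √(x.2 ⬝ᵥ x.2) ≤ 5 / 4 :=
      Real.sqrt_le_iff.2 ⟨by norm_num, by linarith [ballNet_norm_le hx'.2]⟩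
    have := mul_le_mul s1 s2 (Real.sqrt_nonneg _) (by norm_num)
    linarith
  calc netNorm A ^ 2 ≤ (3 * (√(frobInner A A) * 2)) ^ 2 :=
        pow_le_pow_left₀ (netNorm_nonneg A) h 2
    _ = 36 * frobInner A A := by
        rw [mul_pow, mul_pow, Real.sq_sqrt (frobInner_self_nonneg A)]; ring
    _ ≤ _ := by linarith

theorem measurable_netNorm {Ω : Type*} [MeasurableSpace Ω] {A : Ω → Matrix α β ℝ}
    (hA : ∀ i j, Measurable fun ω => A ω i j) : Measurable fun ω => netNorm (A ω) := by
  unfold netNorm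
  refine Measurable.const_mul ?_ _
  have hne : (ballNet α ×ˢ ballNet β).Nonempty :=
    ⟨(0, 0), Finset.mem_product.2 ⟨zero_mem_ballNet, zero_mem_ballNet⟩⟩
  have : (fun ω => (ballNet α ×ˢ ballNet β).sup' hne fun x => x.1 ⬝ᵥ (A ω *ᵥ x.2)) =
      (ballNet α ×ˢ ballNet β).sup' hne fun x ω => x.1 ⬝ᵥ (A ω *ᵥ x.2) := by
    funext ω; rw [Finset.sup'_apply]
  rw [this]
  refine Finset.measurable_sup' _ fun x _ => ?_
  simp only [dotProduct, mulVec]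
  fun_prop

/-! ### Random matrices with independent bounded centred entries -/

/-- Hoeffding: the form is a sum of independent centred terms with total variance proxy at most
`(25/16)² ≤ 3`, and `t = 2√N` gives the Chernoff exponent `-12N + 6N`. -/
theorem measure_bilinear_ge_le {Ω : Type*} [MeasurableSpace Ω] {Q : Measure Ω}
    [IsProbabilityMeasure Q] {Z : α × β → Ω → ℝ} (hm : ∀ x, Measurable (Z x))
    (hind : iIndepFun Z Q) (hb : ∀ x ω, |Z x ω| ≤ 1) (hc : ∀ x, ∫ ω, Z x ω ∂Q = 0)
    {u : α → ℝ} {v : β → ℝ} (hu : u ∈ ballNet α) (hv : v ∈ ballNet β) {N : ℝ} (hN : 0 ≤ N) :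
    Q.real {ω | 6 * √N ≤ u ⬝ᵥ ((Matrix.of fun i j => Z (i, j) ω) *ᵥ v)} ≤ Real.exp (-6 * N) := by
  have hsub : ∀ x, HasSubgaussianMGF (Z x) 1 Q := by
    intro x
    have := hasSubgaussianMGF_of_mem_Icc_of_integral_eq_zero (a := -1) (b := 1)
      (hm x).aemeasurable (ae_of_all Q fun ω => abs_le.1 (hb x ω)) (hc x)
    convert this
    simp only [sub_neg_eq_add]
    rw [← NNReal.coe_inj]
    norm_num
  have hind2 : iIndepFun (fun x : α × β => fun ω => (u x.1 * v x.2) * Z x ω) Q :=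
    hind.comp (fun x z => (u x.1 * v x.2) * z) fun x => measurable_const_mul _
  have hsum := HasSubgaussianMGF.sum_of_iIndepFun (s := Finset.univ) hind2
    (fun x _ => (hsub x).const_mul (u x.1 * v x.2))
  have e : ∀ ω, u ⬝ᵥ ((Matrix.of fun i j => Z (i, j) ω) *ᵥ v) =
      ∑ x : α × β, (u x.1 * v x.2) * Z x ω := by
    intro ω
    simp only [dotProduct, mulVec, of_apply, Finset.mul_sum, Fintype.sum_prod_type]
    exact Finset.sum_congr rfl fun i _ => Finset.sum_congr rfl fun j _ => by ring
  simp_rw [e]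
  have ch := measure_ge_le_exp_mul_mgf (μ := Q) (6 * √N) (t := 2 * √N) (by positivity)
    (hsum.integrable_exp_mul _)
  refine ch.trans ((mul_le_mul_of_nonneg_left (hsum.mgf_le _) (Real.exp_nonneg _)).trans ?_)
  rw [← Real.exp_add, Real.exp_le_exp]
  have hc3 : ∑ x : α × β, (u x.1 * v x.2) ^ 2 * (1 : ℝ) ≤ 3 := by
    have : ∑ x : α × β, (u x.1 * v x.2) ^ 2 * (1 : ℝ) = (u ⬝ᵥ u) * (v ⬝ᵥ v) := by
      simp only [dotProduct, Finset.sum_mul_sum, Fintype.sum_prod_type]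
      exact Finset.sum_congr rfl fun i _ => Finset.sum_congr rfl fun j _ => by ring
    rw [this]
    have := mul_le_mul (ballNet_norm_le hu) (ballNet_norm_le hv) (dotProduct_self_nonneg' _)
      (by norm_num)
    linarith
  have hc4 : ((∑ x : α × β, (⟨(u x.1 * v x.2) ^ 2, sq_nonneg _⟩ * 1 : NNReal) : NNReal) : ℝ) ≤ 3 := by
    rw [NNReal.coe_sum]; exact hc3
  have hNN : √N * √N = N := Real.mul_self_sqrt hN
  have hpos : 0 ≤ √N := Real.sqrt_nonneg _
  have : (2 * √N) ^ 2 = 4 * N := by rw [mul_pow, Real.sq_sqrt hN]; norm_num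
  rw [this]
  nlinarith

/-- There are at most `96^N ≤ e^(5N)` pairs of net points, so the exceptional event has probability
at most `e^(-N)`. Off it the square is at most `324 N`; on it the crude bound contributes at most
`36 N² e^(-N) ≤ 36 N`. A second moment is wanted because moments can be added over column classes.
-/
theorem lintegral_netNorm_sq_le {Ω : Type*} [MeasurableSpace Ω] {Q : Measure Ω}
    [IsProbabilityMeasure Q] {Z : α × β → Ω → ℝ} (hm : ∀ x, Measurable (Z x))
    (hind : iIndepFun Z Q) (hb : ∀ x ω, |Z x ω| ≤ 1) (hc : ∀ x, ∫ ω, Z x ω ∂Q = 0) :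
    ∫⁻ ω, ENNReal.ofReal (netNorm (Matrix.of fun i j => Z (i, j) ω) ^ 2) ∂Q ≤
      ENNReal.ofReal (400 * (Fintype.card α + Fintype.card β)) := by
  set n := Fintype.card α with hn
  set m := Fintype.card β with hmm
  set N : ℝ := n + m with hN
  have hN0 : 0 ≤ N := by positivity
  set E : Set Ω := ⋃ x ∈ ballNet α ×ˢ ballNet β,
    {ω | 6 * √N ≤ x.1 ⬝ᵥ ((Matrix.of fun i j => Z (i, j) ω) *ᵥ x.2)} with hE
  have hEm : MeasurableSet E := by
    refine Finset.measurableSet_biUnion _ fun x _ => measurableSet_le measurable_const ?_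
    simp only [dotProduct, mulVec, of_apply]
    fun_prop
  have hPE : Q.real E ≤ Real.exp (-N) := by
    have h1 : Q.real E ≤ ∑ x ∈ ballNet α ×ˢ ballNet β, Real.exp (-6 * N) := by
      refine (measureReal_biUnion_finset_le _ _).trans (Finset.sum_le_sum fun x hx => ?_)
      have hx' := Finset.mem_product.1 hx
      exact measure_bilinear_ge_le hm hind hb hc hx'.1 hx'.2 hN0
    rw [Finset.sum_const, nsmul_eq_mul, Finset.card_product, Nat.cast_mul] at h1
    have h2 : ((ballNet α).card : ℝ) * (ballNet β).card ≤ Real.exp (5 * N) := by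
      have h96 : (96 : ℝ) ≤ Real.exp 5 := by
        have h := Real.exp_one_gt_d9
        have : Real.exp 5 = Real.exp 1 ^ 5 := by rw [← Real.exp_nat_mul]; norm_num
        rw [this]
        calc (96 : ℝ) ≤ 2.7 ^ 5 := by norm_num
          _ ≤ _ := pow_le_pow_left₀ (by norm_num) (by linarith) 5
      calc ((ballNet α).card : ℝ) * (ballNet β).card ≤ 96 ^ n * 96 ^ m :=
            mul_le_mul card_ballNet_le card_ballNet_le (Nat.cast_nonneg _) (by positivity)
        _ = 96 ^ (n + m) := by rw [pow_add]
        _ ≤ Real.exp 5 ^ (n + m) := pow_le_pow_left₀ (by norm_num) h96 _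
        _ = Real.exp (5 * N) := by rw [← Real.exp_nat_mul, hN]; push_cast; ring_nf
    calc Q.real E ≤ Real.exp (5 * N) * Real.exp (-6 * N) :=
          h1.trans (mul_le_mul_of_nonneg_right h2 (Real.exp_nonneg _))
      _ = Real.exp (-N) := by rw [← Real.exp_add]; ring_nf
  have hpt : ∀ ω, ENNReal.ofReal (netNorm (Matrix.of fun i j => Z (i, j) ω) ^ 2) ≤
      ENNReal.ofReal (324 * N) + E.indicator (fun _ => ENNReal.ofReal (36 * (n * m))) ω := by
    intro ω
    by_cases hω : ω ∈ E
    · rw [Set.indicator_of_mem hω]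
      refine le_add_left (ENNReal.ofReal_le_ofReal ?_)
      exact netNorm_sq_le _ fun i j => hb _ _
    · rw [Set.indicator_of_notMem hω, add_zero]
      refine ENNReal.ofReal_le_ofReal ?_
      have h1 : netNorm (Matrix.of fun i j => Z (i, j) ω) ≤ 3 * (6 * √N) := by
        refine mul_le_mul_of_nonneg_left (Finset.sup'_le _ _ fun x hx => ?_) (by norm_num)
        by_contra hcon
        exact hω (Set.mem_biUnion hx (not_le.1 hcon).le)
      calc _ ≤ (3 * (6 * √N)) ^ 2 := pow_le_pow_left₀ (netNorm_nonneg _) h1 2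
        _ = 324 * N := by rw [mul_pow, mul_pow, Real.sq_sqrt hN0]; ring
  calc _ ≤ ∫⁻ ω, (ENNReal.ofReal (324 * N) +
        E.indicator (fun _ => ENNReal.ofReal (36 * (n * m))) ω) ∂Q := lintegral_mono hpt
    _ = ENNReal.ofReal (324 * N) + ENNReal.ofReal (36 * (n * m)) * Q E := by
      rw [lintegral_add_left measurable_const, lintegral_indicator hEm]
      simp
    _ ≤ ENNReal.ofReal (324 * N) + ENNReal.ofReal (36 * (n * m)) *
        ENNReal.ofReal (Real.exp (-N)) := by
      gcongr
      rw [← ENNReal.ofReal_toReal (measure_ne_top Q E)]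
      exact ENNReal.ofReal_le_ofReal hPE
    _ ≤ ENNReal.ofReal (400 * N) := by
      rw [← ENNReal.ofReal_mul (by positivity), ← ENNReal.ofReal_add (by positivity)
        (by positivity)]
      refine ENNReal.ofReal_le_ofReal ?_
      have h1 : (n : ℝ) * m ≤ N * N := by
        rw [hN]; nlinarith [Nat.cast_nonneg (α := ℝ) n, Nat.cast_nonneg (α := ℝ) m]
      have h2 : N * Real.exp (-N) ≤ 1 := by
        rw [Real.exp_neg, ← div_eq_mul_inv, div_le_one (Real.exp_pos _)]
        linarith [Real.add_one_le_exp N]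
      have h3 : (n : ℝ) * m * Real.exp (-N) ≤ N * (N * Real.exp (-N)) := by
        rw [← mul_assoc]; exact mul_le_mul_of_nonneg_right h1 (Real.exp_nonneg _)
      nlinarith

end Net

/-! ### Symmetrization and contraction, one coordinate at a time -/

section Contraction

variable {κ : Type*} {F : Finset κ}

/-- Contraction in one coordinate: with maximizers `k` and `l` on the left, the sign of `w k - w l`
decides which of them is tested with the plus sign on the right. -/
theorem sup'_add_sup'_le (hF : F.Nonempty) {a g w : κ → ℝ}
    (h : ∀ k l, |g k - g l| ≤ |w k - w l|) :
    F.sup' hF (fun k => a k + g k) + F.sup' hF (fun k => a k - g k) ≤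
      F.sup' hF (fun k => a k + w k) + F.sup' hF (fun k => a k - w k) := by
  obtain ⟨k, hk, ek⟩ := Finset.exists_mem_eq_sup' hF fun k => a k + g k
  obtain ⟨l, hl, el⟩ := Finset.exists_mem_eq_sup' hF fun k => a k - g k
  rw [ek, el]
  have b1 := Finset.le_sup' (fun k => a k + w k) hk
  have b2 := Finset.le_sup' (fun k => a k - w k) hl
  have b3 := Finset.le_sup' (fun k => a k + w k) hl
  have b4 := Finset.le_sup' (fun k => a k - w k) hk
  have h1 := h k l
  have h2 := le_abs_self (g k - g l)
  rcases abs_cases (w k - w l) with h' | h' <;> linarith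

theorem abs_sup'_le (hF : F.Nonempty) {a : κ → ℝ} {C : ℝ} (h : ∀ k ∈ F, |a k| ≤ C) :
    |F.sup' hF a| ≤ C := by
  obtain ⟨k, hk, ek⟩ := Finset.exists_mem_eq_sup' hF a
  rw [ek]; exact h k hk

theorem measurable_sup'_fun {Ω : Type*} [MeasurableSpace Ω] (hF : F.Nonempty) {a : κ → Ω → ℝ}
    (h : ∀ k, Measurable (a k)) : Measurable fun ω => F.sup' hF fun k => a k ω := by
  have : (fun ω => F.sup' hF fun k => a k ω) = F.sup' hF a := by
    funext ω; rw [Finset.sup'_apply]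
  rw [this]
  exact Finset.measurable_sup' _ fun k _ => h k

/-- The mean is replaced by an independent copy (Jensen), and exchanging the copies produces both
signs. The difference of two copies is Lipschitz in `v` with constant 2, which explains `2 * v k`.
-/
theorem integral_sup'_le {E : Type*} [MeasurableSpace E] (hF : F.Nonempty) (μ : Measure E)
    [IsProbabilityMeasure μ] {h : κ → E → ℝ} {v a : κ → ℝ} (hm : ∀ k, Measurable (h k))
    (hL : ∀ x k l, |h k x - h l x| ≤ |v k - v l|) (hb : ∀ x k, |h k x| ≤ |v k|) :
    ∫ x, F.sup' hF (fun k => a k + ((∫ y, h k y ∂μ) - h k x)) ∂μ ≤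
      (F.sup' hF (fun k => a k + 2 * v k) + F.sup' hF (fun k => a k - 2 * v k)) / 2 := by
  set C : ℝ := F.sup' hF fun k => |a k| + 2 * |v k| with hC
  have hCk : ∀ k ∈ F, |a k| + 2 * |v k| ≤ C := fun k hk =>
    Finset.le_sup' (fun k => |a k| + 2 * |v k|) hk
  have hint : ∀ k, Integrable (h k) μ := fun k =>
    Integrable.of_bound (hm k).aestronglyMeasurable |v k| (ae_of_all _ fun x => hb x k)
  have hbI : ∀ k, |∫ y, h k y ∂μ| ≤ |v k| := fun k => by
    have := norm_integral_le_of_norm_le_const (μ := μ) (f := h k) (C := |v k|)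
      (ae_of_all _ fun x => hb x k)
    simpa using this
  set φ : E × E → ℝ := fun z => F.sup' hF fun k => a k + (h k z.2 - h k z.1) with hφ
  have hφm : Measurable φ := measurable_sup'_fun hF fun k =>
    measurable_const.add (((hm k).comp measurable_snd).sub ((hm k).comp measurable_fst))
  have hφb : ∀ z, |φ z| ≤ C := fun z => abs_sup'_le hF fun k hk => by
    have h1 := hb z.1 k
    have h2 := hb z.2 k
    have h3 := hCk k hk
    have := abs_add_le (a k) (h k z.2 - h k z.1)
    have := abs_sub (h k z.2) (h k z.1)
    linarith
  have hφi : Integrable φ (μ.prod μ) :=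
    Integrable.of_bound hφm.aestronglyMeasurable C (ae_of_all _ hφb)
  have hφs : Integrable (fun z => φ z.swap) (μ.prod μ) := hφi.swap
  have step1 : ∀ x, F.sup' hF (fun k => a k + ((∫ y, h k y ∂μ) - h k x)) ≤
      ∫ y, φ (x, y) ∂μ := by
    intro x
    refine Finset.sup'_le _ _ fun k hk => ?_
    have e : a k + ((∫ y, h k y ∂μ) - h k x) = ∫ y, (a k + (h k y - h k x)) ∂μ := by
      rw [integral_add (f := fun _ => a k) (g := fun y => h k y - h k x) (integrable_const _)
        ((hint k).sub (integrable_const _)),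
        integral_sub (f := h k) (g := fun _ => h k x) (hint k) (integrable_const _)]
      simp
    rw [e]
    refine integral_mono ((integrable_const _).add ((hint k).sub (integrable_const _))) ?_ ?_
    · exact Integrable.of_bound (hφm.comp measurable_prodMk_left).aestronglyMeasurable C
        (ae_of_all _ fun y => hφb _)
    · intro y
      exact Finset.le_sup' (fun k => a k + (h k y - h k x)) hk
  have step2 : ∫ x, F.sup' hF (fun k => a k + ((∫ y, h k y ∂μ) - h k x)) ∂μ ≤
      ∫ z, φ z ∂(μ.prod μ) := by
    rw [integral_prod _ hφi]
    refine integral_mono ?_ hφi.integral_prod_left step1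
    refine Integrable.of_bound (measurable_sup'_fun hF fun k =>
      measurable_const.add (measurable_const.sub (hm k))).aestronglyMeasurable C
      (ae_of_all _ fun x => abs_sup'_le hF fun k hk => ?_)
    have h1 := hb x k
    have h2 := hbI k
    have h3 := hCk k hk
    have := abs_add_le (a k) ((∫ y, h k y ∂μ) - h k x)
    have := abs_sub (∫ y, h k y ∂μ) (h k x)
    linarith
  have step3 : ∫ z, φ z ∂(μ.prod μ) = (∫ z, (φ z + φ z.swap) ∂(μ.prod μ)) / 2 := by
    rw [integral_add hφi hφs, integral_prod_swap]
    ring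
  have step4 : ∫ z, (φ z + φ z.swap) ∂(μ.prod μ) ≤
      F.sup' hF (fun k => a k + 2 * v k) + F.sup' hF (fun k => a k - 2 * v k) := by
    have : ∀ z, φ z + φ z.swap ≤
        F.sup' hF (fun k => a k + 2 * v k) + F.sup' hF (fun k => a k - 2 * v k) := by
      intro z
      have e : φ z.swap = F.sup' hF fun k => a k - (h k z.2 - h k z.1) := by
        simp only [hφ, Prod.fst_swap, Prod.snd_swap]
        congr 1; funext k; ring
      rw [e]
      refine sup'_add_sup'_le hF (g := fun k => h k z.2 - h k z.1) (w := fun k => 2 * v k)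
        fun k l => ?_
      have h1 := hL z.1 k l
      have h2 := hL z.2 k l
      have : |2 * v k - 2 * v l| = 2 * |v k - v l| := by
        rw [← mul_sub, abs_mul, abs_of_pos (by norm_num : (0 : ℝ) < 2)]
      rw [this]
      have e : h k z.2 - h k z.1 - (h l z.2 - h l z.1) =
        (h k z.2 - h l z.2) - (h k z.1 - h l z.1) := by ring
      rw [e]
      have := abs_sub (h k z.2 - h l z.2) (h k z.1 - h l z.1)
      linarith
    calc _ ≤ ∫ _z, (F.sup' hF (fun k => a k + 2 * v k) + F.sup' hF (fun k => a k - 2 * v k))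
          ∂(μ.prod μ) := integral_mono (hφi.add hφs) (integrable_const _) this
      _ = _ := by simp
  linarith

/-- The law of a fair random sign. -/
noncomputable def coin : Measure ℝ :=
  (2⁻¹ : ℝ≥0∞) • (Measure.dirac 1 + Measure.dirac (-1))

instance : IsProbabilityMeasure coin := by
  constructor
  simp only [coin, Measure.smul_apply, Measure.add_apply, measure_univ, smul_eq_mul]
  rw [one_add_one_eq_two, ENNReal.inv_mul_cancel (by simp) (by simp)]

theorem lintegral_coin (f : ℝ → ℝ≥0∞) : ∫⁻ x, f x ∂coin = (f 1 + f (-1)) / 2 := by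
  rw [coin, lintegral_smul_measure, lintegral_add_measure, lintegral_dirac, lintegral_dirac,
    smul_eq_mul, div_eq_mul_inv, mul_comm]

/-- The index `k₀`, where every term vanishes, keeps the suprema nonnegative, so `ENNReal.ofReal`
loses nothing and Tonelli is available for the iteration. -/
theorem lintegral_sup'_le {E : Type*} [MeasurableSpace E] (hF : F.Nonempty) (μ : Measure E)
    [IsProbabilityMeasure μ] {h : κ → E → ℝ} {v a : κ → ℝ} (hm : ∀ k, Measurable (h k))
    (hL : ∀ x k l, |h k x - h l x| ≤ |v k - v l|) (hb : ∀ x k, |h k x| ≤ |v k|)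
    {k₀ : κ} (hk₀ : k₀ ∈ F) (hv₀ : v k₀ = 0) (ha₀ : a k₀ = 0) :
    ∫⁻ x, ENNReal.ofReal (F.sup' hF (fun k => a k + ((∫ y, h k y ∂μ) - h k x))) ∂μ ≤
      ∫⁻ e, ENNReal.ofReal (F.sup' hF (fun k => a k + 2 * (e * v k))) ∂coin := by
  have hh : ∀ x, h k₀ x = 0 := fun x => by
    have := hb x k₀
    rw [hv₀, abs_zero] at this
    exact abs_nonpos_iff.1 this
  have hpos : ∀ x, 0 ≤ F.sup' hF (fun k => a k + ((∫ y, h k y ∂μ) - h k x)) := fun x => by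
    refine le_trans ?_ (Finset.le_sup' (fun k => a k + ((∫ y, h k y ∂μ) - h k x)) hk₀)
    simp [ha₀, hh]
  have hbI : ∀ k, |∫ y, h k y ∂μ| ≤ |v k| := fun k => by
    have := norm_integral_le_of_norm_le_const (μ := μ) (f := h k) (C := |v k|)
      (ae_of_all _ fun x => hb x k)
    simpa using this
  have hi : Integrable (fun x => F.sup' hF (fun k => a k + ((∫ y, h k y ∂μ) - h k x))) μ := by
    refine Integrable.of_bound (measurable_sup'_fun hF fun k =>
      measurable_const.add (measurable_const.sub (hm k))).aestronglyMeasurable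
      (F.sup' hF fun k => |a k| + 2 * |v k|)
      (ae_of_all _ fun x => abs_sup'_le hF fun k hk => ?_)
    refine le_trans ?_ (Finset.le_sup' (fun k => |a k| + 2 * |v k|) hk)
    have h1 := hb x k
    have h2 := hbI k
    have := abs_add_le (a k) ((∫ y, h k y ∂μ) - h k x)
    have := abs_sub (∫ y, h k y ∂μ) (h k x)
    linarith
  rw [← ofReal_integral_eq_lintegral_ofReal hi (ae_of_all _ hpos), lintegral_coin]
  refine (ENNReal.ofReal_le_ofReal (integral_sup'_le hF μ hm hL hb)).trans_eq ?_
  have p1 : 0 ≤ F.sup' hF (fun k => a k + 2 * v k) := by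
    refine le_trans ?_ (Finset.le_sup' (fun k => a k + 2 * v k) hk₀)
    simp [ha₀, hv₀]
  have p2 : 0 ≤ F.sup' hF (fun k => a k - 2 * v k) := by
    refine le_trans ?_ (Finset.le_sup' (fun k => a k - 2 * v k) hk₀)
    simp [ha₀, hv₀]
  rw [ENNReal.ofReal_div_of_pos (by norm_num), ENNReal.ofReal_add p1 p2]
  simp [sub_eq_add_neg]

/-! ### Exchange of all coordinates for random signs. -/

variable {ι : Type*} [DecidableEq ι]

/-- Coordinates are exchanged one at a time. The offset `a` is arbitrary because it has to absorb
the contribution of whichever coordinate is held fixed. The base points do not matter, as the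
integrands depend on the coordinates in `s` alone. -/
theorem lmarginal_sup'_le (hF : F.Nonempty) (μ : ι → Measure ℝ)
    [∀ j, IsProbabilityMeasure (μ j)] {h : ι → κ → ℝ → ℝ} {v : κ → ι → ℝ}
    (hm : ∀ j k, Measurable (h j k))
    (hL : ∀ j x k l, |h j k x - h j l x| ≤ |v k j - v l j|) (hb : ∀ j x k, |h j k x| ≤ |v k j|)
    {k₀ : κ} (hk₀ : k₀ ∈ F) (hv₀ : v k₀ = 0) (s : Finset ι) (x₀ y₀ : ι → ℝ) :
    ∀ a : κ → ℝ, a k₀ = 0 →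
    (∫⋯∫⁻_s, (fun x => ENNReal.ofReal (F.sup' hF fun k =>
      a k + ∑ j ∈ s, ((∫ y, h j k y ∂(μ j)) - h j k (x j)))) ∂μ) x₀ ≤
    (∫⋯∫⁻_s, (fun y => ENNReal.ofReal (F.sup' hF fun k =>
      a k + ∑ j ∈ s, 2 * (y j * v k j))) ∂(fun _ => coin)) y₀ := by
  have hh : ∀ j x, h j k₀ x = 0 := fun j x => by
    have := hb j x k₀
    rw [hv₀, Pi.zero_apply, abs_zero] at this
    exact abs_nonpos_iff.1 this
  induction s using Finset.induction_on generalizing x₀ y₀ with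
  | empty => intro a _; simp
  | insert i s his ih =>
    intro a ha
    have hmf : ∀ s : Finset ι, ∀ a : κ → ℝ, Measurable fun x : ι → ℝ => ENNReal.ofReal
        (F.sup' hF fun k => a k + ∑ j ∈ s, ((∫ y, h j k y ∂(μ j)) - h j k (x j))) := fun s a =>
      (measurable_sup'_fun hF fun k => measurable_const.add (Finset.measurable_sum _ fun j _ =>
        measurable_const.sub ((hm j k).comp (measurable_pi_apply j)))).ennreal_ofReal
    have hmy : ∀ s : Finset ι, ∀ a : κ → ℝ, Measurable fun y : ι → ℝ => ENNReal.ofReal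
        (F.sup' hF fun k => a k + ∑ j ∈ s, 2 * (y j * v k j)) := fun s a =>
      (measurable_sup'_fun hF fun k => measurable_const.add (Finset.measurable_sum _ fun j _ =>
        ((measurable_pi_apply j).mul_const _).const_mul _)).ennreal_ofReal
    rw [lmarginal_insert _ (hmf _ _) his, lmarginal_insert' _ (hmy _ _) his]
    have e1 : ∀ z, (∫⋯∫⁻_s, (fun x => ENNReal.ofReal (F.sup' hF fun k =>
        a k + ∑ j ∈ insert i s, ((∫ y, h j k y ∂(μ j)) - h j k (x j)))) ∂μ)
          (Function.update x₀ i z) =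
        (∫⋯∫⁻_s, (fun x => ENNReal.ofReal (F.sup' hF fun k =>
        (a k + ((∫ y, h i k y ∂(μ i)) - h i k z)) +
          ∑ j ∈ s, ((∫ y, h j k y ∂(μ j)) - h j k (x j)))) ∂μ) (Function.update x₀ i z) := by
      intro z
      simp only [lmarginal]
      refine lintegral_congr fun y => ?_
      simp only [Finset.sum_insert his, add_assoc]
      simp [Function.updateFinset, his]
    simp_rw [e1]
    have ha' : ∀ z, a k₀ + ((∫ y, h i k₀ y ∂(μ i)) - h i k₀ z) = 0 := fun z => by
      simp [hh, ha]
    calc _ ≤ ∫⁻ z, (∫⋯∫⁻_s, (fun y => ENNReal.ofReal (F.sup' hF fun k =>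
        (a k + ((∫ y, h i k y ∂(μ i)) - h i k z)) + ∑ j ∈ s, 2 * (y j * v k j)))
          ∂(fun _ => coin)) y₀ ∂(μ i) := lintegral_mono fun z => ih _ y₀ _ (ha' z)
      _ = (∫⋯∫⁻_s, (fun y => ∫⁻ z, ENNReal.ofReal (F.sup' hF fun k =>
        (a k + ((∫ y, h i k y ∂(μ i)) - h i k z)) + ∑ j ∈ s, 2 * (y j * v k j)) ∂(μ i))
          ∂(fun _ => coin)) y₀ := by
        simp only [lmarginal]
        rw [lintegral_lintegral_swap]
        refine Measurable.aemeasurable (Measurable.ennreal_ofReal ?_)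
        refine measurable_sup'_fun hF fun k => Measurable.add ?_ ?_
        · exact measurable_const.add (measurable_const.sub ((hm i k).comp measurable_fst))
        · refine Finset.measurable_sum _ fun j _ => ((Measurable.mul_const ?_ _).const_mul _)
          exact (measurable_pi_apply j).comp
            ((measurable_updateFinset (X := fun _ : ι => ℝ)).comp measurable_snd)
      _ ≤ _ := by
        -- The signs on `s` are now frozen and become part of the offset, which leaves a
        -- one-coordinate problem in `i`.
        refine lmarginal_mono (fun y => ?_) y₀
        have := lintegral_sup'_le hF (μ i) (h := h i) (v := fun k => v k i)
          (a := fun k => a k + ∑ j ∈ s, 2 * (y j * v k j)) (hm i) (hL i) (hb i) hk₀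
          (by rw [hv₀]; rfl) (by simp [ha, hv₀])
        refine (le_of_eq ?_).trans (this.trans (le_of_eq ?_))
        · refine lintegral_congr fun z => ?_
          congr 2; funext k; ring
        · refine lintegral_congr fun z => ?_
          congr 2; funext k
          rw [Finset.sum_insert his]
          have : ∑ j ∈ s, 2 * (Function.update y i z j * v k j) = ∑ j ∈ s, 2 * (y j * v k j) := by
            refine Finset.sum_congr rfl fun j hj => ?_
            rw [Function.update_of_ne (fun hji : j = i => his (hji ▸ hj))]
          rw [this, Function.update_self]
          ring

end Contraction

/-! ### Expected suprema over a column class -/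

section ColumnClass

open Matrix

variable {n T : ℕ}

/-- The submatrix on a set of columns. -/
def colSub (J : Finset (Fin T)) (x : Fin n × Fin T → ℝ) : Matrix (Fin n) J ℝ :=
  Matrix.of fun i j => x (i, j)

/-- Padding with zero columns preserves the bound on the bilinear form, so trace duality applies to
the padded matrix. -/
theorem sum_colSub_le {J : Finset (Fin T)} (x : Fin n × Fin T → ℝ)
    (D : Matrix (Fin n) (Fin T) ℝ) {b : ℝ} (hb : OpBound (colSub J x) b) (hb0 : 0 ≤ b) :
    ∑ z ∈ Finset.univ ×ˢ J, x z * D z.1 z.2 ≤ b * nuclearNorm D := by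
  classical
  set W : Matrix (Fin n) (Fin T) ℝ := Matrix.of fun i t => if t ∈ J then x (i, t) else 0 with hW
  have e : ∑ z ∈ Finset.univ ×ˢ J, x z * D z.1 z.2 = frobInner W D := by
    rw [Finset.sum_product, frobInner]
    refine Finset.sum_congr rfl fun i _ => ?_
    simp [hW, Finset.sum_ite_mem]
  rw [e]
  refine OpBound.frobInner_le fun u v => ?_
  have e2 : u ⬝ᵥ (W *ᵥ v) = u ⬝ᵥ (colSub J x *ᵥ fun j => v j) := by
    simp only [dotProduct, mulVec, hW, colSub, of_apply]
    refine Finset.sum_congr rfl fun i _ => ?_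
    congr 1
    simp only [ite_mul, zero_mul]
    rw [Finset.sum_ite_mem, Finset.univ_inter, ← Finset.sum_coe_sort]
  rw [e2]
  refine (hb _ _).trans (mul_le_mul_of_nonneg_left (mul_le_mul_of_nonneg_left
    (Real.sqrt_le_sqrt ?_) (Real.sqrt_nonneg _)) hb0)
  simp only [dotProduct]
  rw [Finset.sum_coe_sort J (fun t => v t * v t)]
  exact Finset.sum_le_univ_sum_of_nonneg fun t => mul_self_nonneg (v t)

theorem lmarginal_netNorm_sq_le (μ : Fin n × Fin T → Measure ℝ)
    [∀ z, IsProbabilityMeasure (μ z)] {w : Fin n × Fin T → ℝ → ℝ} (hm : ∀ z, Measurable (w z))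
    (hb : ∀ z x, |w z x| ≤ 1) (hc : ∀ z, ∫ x, w z x ∂(μ z) = 0) (J : Finset (Fin T))
    (x₀ : Fin n × Fin T → ℝ) :
    (∫⋯∫⁻_(Finset.univ ×ˢ J), (fun x => ENNReal.ofReal
      (netNorm (colSub J fun z => w z (x z)) ^ 2)) ∂μ) x₀ ≤
      ENNReal.ofReal (400 * (n + J.card)) := by
  simp only [lmarginal]
  set s : Finset (Fin n × Fin T) := Finset.univ ×ˢ J with hs
  set e : Fin n × J → s := fun z => ⟨(z.1, z.2), by simp [hs]⟩ with he
  have heinj : Function.Injective e := by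
    intro a b hab
    simp only [he, Subtype.mk.injEq, Prod.mk.injEq] at hab
    exact Prod.ext hab.1 (Subtype.ext hab.2)
  set Q : Measure (s → ℝ) := Measure.pi fun i : s => μ i with hQ
  have hind : iIndepFun (fun (z : s) (y : s → ℝ) => w z (y z)) Q :=
    iIndepFun_pi fun z => (hm z).aemeasurable
  have key := lintegral_netNorm_sq_le (Q := Q) (α := Fin n) (β := J)
    (Z := fun z y => w (e z) (y (e z)))
    (fun z => (hm _).comp (measurable_pi_apply _)) (hind.precomp heinj)
    (fun z y => hb _ _) (fun z => by
      have : ∫ y, w (e z) (y (e z)) ∂Q = ∫ x, w (e z) x ∂(μ (e z)) := by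
        have hmp := measurePreserving_eval (fun i : s => μ i) (e z)
        rw [← hmp.map_eq, integral_map hmp.measurable.aemeasurable
          (hm _).aestronglyMeasurable]
      rw [this, hc])
  rw [Fintype.card_fin, Fintype.card_coe] at key
  refine (le_of_eq (lintegral_congr fun y => ?_)).trans key
  congr 3
  ext i j
  have hmem : (i, (j : Fin T)) ∈ s := by simp [hs]
  simp only [colSub, Matrix.of_apply, he]
  rw [Function.updateFinset, dif_pos hmem]

/-- The truncation makes the sign bounded everywhere, as `lmarginal_netNorm_sq_le` demands; under
`coin` it is almost surely the identity. -/
theorem integral_id_coin : ∫ x, max (-1) (min 1 x) ∂coin = 0 := by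
  rw [coin, integral_smul_measure, integral_add_measure]
  · simp
  · exact integrable_dirac (by simp)
  · exact integrable_dirac (by simp)

theorem ae_pi_coin_le {ι : Type*} [Fintype ι] :
    ∀ᵐ y ∂(Measure.pi fun _ : ι => coin), ∀ i, max (-1) (min 1 (y i)) = y i := by
  rw [ae_all_iff]
  intro i
  have hmp := measurePreserving_eval (fun _ : ι => coin) i
  have h : ∀ᵐ x ∂coin, max (-1) (min 1 x) = x := by
    rw [ae_iff, coin]
    have hms : MeasurableSet {a : ℝ | ¬max (-1) (min 1 a) = a} :=
      (measurableSet_eq_fun (by fun_prop) measurable_id).compl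
    simp only [Measure.smul_apply, Measure.add_apply, Measure.dirac_apply' _ hms]
    simp
  exact hmp.quasiMeasurePreserving.ae h

/-- The expected supremum of a centred Lipschitz process indexed by matrices in a nuclear
norm ball, over a class of columns. -/
theorem lmarginal_process_le (μ : Fin n × Fin T → Measure ℝ)
    [∀ z, IsProbabilityMeasure (μ z)] {F : Finset (Matrix (Fin n) (Fin T) ℝ)}
    (h0 : 0 ∈ F) {R : ℝ} (hR : ∀ D ∈ F, nuclearNorm D ≤ R) {k : ℝ → ℝ → ℝ}
    (hm : ∀ v, Measurable fun u => k u v) (hL : ∀ u v v', |k u v - k u v'| ≤ |v - v'|)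
    (hk0 : ∀ u, k u 0 = 0) (J : Finset (Fin T)) (x₀ : Fin n × Fin T → ℝ) :
    (∫⋯∫⁻_(Finset.univ ×ˢ J), (fun x => ENNReal.ofReal (F.sup' ⟨0, h0⟩ fun D =>
      ∑ z ∈ Finset.univ ×ˢ J, ((∫ u, k u (D z.1 z.2) ∂(μ z)) - k (x z) (D z.1 z.2)))) ∂μ) x₀ ≤
      ENNReal.ofReal (40 * R * √(n + J.card)) := by
  have hR0 : 0 ≤ R := (nuclearNorm_nonneg _).trans (hR 0 h0)
  have h1 := lmarginal_sup'_le ⟨0, h0⟩ μ (h := fun z D u => k u (D z.1 z.2))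
    (v := fun D z => D z.1 z.2) (fun z D => hm _) (fun z x D D' => hL x _ _)
    (fun z x D => by simpa [hk0] using hL x (D z.1 z.2) 0) h0 (by funext z; rfl)
    (Finset.univ ×ˢ J) x₀ x₀ (fun _ => 0) rfl
  simp only [zero_add] at h1
  refine h1.trans ?_
  set A : ℝ := n + J.card with hA
  have hA0 : 0 ≤ A := by positivity
  have h2 := lmarginal_netNorm_sq_le (fun _ => coin) (w := fun _ x => max (-1) (min 1 x))
    (fun z => by fun_prop) (fun z x => abs_le.2 ⟨le_max_left _ _, max_le (by norm_num)
      (min_le_left _ _)⟩) (fun _ => integral_id_coin) J x₀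
  rcases hA0.eq_or_lt with hA1 | hA1
  · have hn : n = 0 := by
      have := Nat.cast_nonneg (α := ℝ) n
      have := Nat.cast_nonneg (α := ℝ) J.card
      have : (n : ℝ) = 0 := by linarith
      exact_mod_cast this
    subst hn
    have : (fun y : Fin 0 × Fin T → ℝ => ENNReal.ofReal (F.sup' ⟨0, h0⟩ fun D =>
      ∑ z ∈ Finset.univ ×ˢ J, 2 * (y z * D z.1 z.2))) = fun _ => 0 := by
      funext y
      refine ENNReal.ofReal_eq_zero.2 (Finset.sup'_le _ _ fun D _ => le_of_eq ?_)
      exact Finset.sum_eq_zero fun z _ => z.1.elim0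
    rw [this]
    simp [lmarginal]
  set B := √A with hB
  have hB0 : 0 < B := Real.sqrt_pos.2 hA1
  have hBB : B * B = A := Real.mul_self_sqrt hA0
  have hpt : ∀ y : Fin n × Fin T → ℝ, (∀ z ∈ Finset.univ ×ˢ J, max (-1) (min 1 (y z)) = y z) →
      F.sup' ⟨0, h0⟩ (fun D => ∑ z ∈ Finset.univ ×ˢ J, 2 * (y z * D z.1 z.2)) ≤
      R / (20 * B) * netNorm (colSub J fun z => max (-1) (min 1 (y z))) ^ 2 + 20 * R * B := by
    intro y hy
    refine Finset.sup'_le _ _ fun D hD => ?_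
    set X := netNorm (colSub J fun z => max (-1) (min 1 (y z))) with hX
    have hX0 : 0 ≤ X := netNorm_nonneg _
    have e : ∑ z ∈ Finset.univ ×ˢ J, 2 * (y z * D z.1 z.2) =
        2 * ∑ z ∈ Finset.univ ×ˢ J, max (-1) (min 1 (y z)) * D z.1 z.2 := by
      rw [Finset.mul_sum]
      exact Finset.sum_congr rfl fun z hz => by rw [hy z hz]
    have hle := sum_colSub_le (fun z => max (-1) (min 1 (y z))) D (opBound_netNorm _) hX0
    rw [e]
    have h3 : X * nuclearNorm D ≤ X * R := mul_le_mul_of_nonneg_left (hR D hD) hX0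
    -- The arithmetic–geometric mean inequality linearizes `X` in terms of its second moment. As
    -- that moment is at most `400 B²`, the weight `20 B` balances the two terms and yields `40 B`.
    have h4 : 2 * X ≤ X ^ 2 / (20 * B) + 20 * B := by
      have : X ^ 2 / (20 * B) + 20 * B - 2 * X = (X - 20 * B) ^ 2 / (20 * B) := by
        field_simp; ring
      have h5 : 0 ≤ (X - 20 * B) ^ 2 / (20 * B) := by positivity
      linarith
    have h5 := mul_le_mul_of_nonneg_left h4 hR0
    have e6 : R / (20 * B) * X ^ 2 + 20 * R * B = R * (X ^ 2 / (20 * B) + 20 * B) := by ring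
    rw [e6]
    linarith
  have hnet : Measurable fun x : Fin n × Fin T → ℝ =>
      netNorm (colSub J fun z => max (-1) (min 1 (x z))) :=
    measurable_netNorm fun i j => by simp only [colSub, Matrix.of_apply]; fun_prop
  calc _ ≤ (∫⋯∫⁻_(Finset.univ ×ˢ J), (fun y => ENNReal.ofReal (R / (20 * B)) * ENNReal.ofReal
          (netNorm (colSub J fun z => max (-1) (min 1 (y z))) ^ 2) + ENNReal.ofReal (20 * R * B))
          ∂(fun _ => coin)) x₀ := by
        simp only [lmarginal]
        refine lintegral_mono_ae ?_
        filter_upwards [ae_pi_coin_le] with y hy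
        rw [← ENNReal.ofReal_mul (by positivity), ← ENNReal.ofReal_add (by positivity)
          (by positivity)]
        refine ENNReal.ofReal_le_ofReal (hpt _ fun z hz => ?_)
        rw [Function.updateFinset, dif_pos hz]
        exact hy _
    _ = ENNReal.ofReal (R / (20 * B)) * (∫⋯∫⁻_(Finset.univ ×ˢ J), (fun y => ENNReal.ofReal
          (netNorm (colSub J fun z => max (-1) (min 1 (y z))) ^ 2)) ∂(fun _ => coin)) x₀ +
          ENNReal.ofReal (20 * R * B) := by
        simp only [lmarginal]
        rw [lintegral_add_right _ measurable_const, lintegral_const_mul]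
        · simp
        · exact ((hnet.comp measurable_updateFinset).pow_const 2).ennreal_ofReal
    _ ≤ ENNReal.ofReal (R / (20 * B)) * ENNReal.ofReal (400 * A) + ENNReal.ofReal (20 * R * B) := by
        gcongr
    _ = ENNReal.ofReal (40 * R * B) := by
        rw [← ENNReal.ofReal_mul (by positivity), ← ENNReal.ofReal_add (by positivity)
          (by positivity)]
        congr 1
        rw [← hBB]; field_simp; ring

end ColumnClass

/-! ### Decoupling under β-mixing -/

section Decoupling

/-- Layer cake: only levels between 0 and 1 count, so the error `δ` is integrated over an interval
of length one. -/
theorem lintegral_le_add_of_measure_le {E : Type*} [MeasurableSpace E] {μ ν : Measure E}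
    {δ : ℝ≥0∞} (h : ∀ s, MeasurableSet s → μ s ≤ ν s + δ) {f : E → ℝ≥0∞} (hf : Measurable f)
    (hf1 : ∀ x, f x ≤ 1) : ∫⁻ x, f x ∂μ ≤ ∫⁻ x, f x ∂ν + δ := by
  have e : ∀ x, f x = ENNReal.ofReal (f x).toReal := fun x =>
    (ENNReal.ofReal_toReal ((hf1 x).trans_lt ENNReal.one_lt_top).ne).symm
  have hm : Measurable fun x => (f x).toReal := hf.ennreal_toReal
  have hle : ∀ x, (f x).toReal ≤ 1 := fun x => by
    simpa using ENNReal.toReal_mono ENNReal.one_ne_top (hf1 x)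
  rw [lintegral_congr e, lintegral_congr (μ := ν) e]
  rw [lintegral_eq_lintegral_meas_lt μ (ae_of_all _ fun _ => ENNReal.toReal_nonneg)
    hm.aemeasurable, lintegral_eq_lintegral_meas_lt ν (ae_of_all _ fun _ => ENNReal.toReal_nonneg)
    hm.aemeasurable]
  have hpt : ∀ t : ℝ, μ {x | t < (f x).toReal} ≤
      ν {x | t < (f x).toReal} + (Set.Iio (1 : ℝ)).indicator (fun _ => δ) t := by
    intro t
    by_cases ht : t < 1
    · rw [Set.indicator_of_mem (Set.mem_Iio.2 ht)]
      exact h _ (measurableSet_lt measurable_const hm)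
    · have : {x | t < (f x).toReal} = ∅ := by
        ext x; simp only [Set.mem_ofPred_eq, Set.mem_empty_iff_false, iff_false, not_lt]
        exact (hle x).trans (not_lt.1 ht)
      rw [this]; simp
  calc _ ≤ ∫⁻ t in Set.Ioi 0, (ν {x | t < (f x).toReal} +
        (Set.Iio (1 : ℝ)).indicator (fun _ => δ) t) := lintegral_mono hpt
    _ = (∫⁻ t in Set.Ioi 0, ν {x | t < (f x).toReal}) +
        ∫⁻ t in Set.Ioi 0, (Set.Iio (1 : ℝ)).indicator (fun _ => δ) t :=
      lintegral_add_right _ (measurable_const.indicator measurableSet_Iio)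
    _ = _ := by
      rw [lintegral_indicator measurableSet_Iio, Measure.restrict_restrict measurableSet_Iio,
        Set.Iio_inter_Ioi]
      simp

/-- Subsets of a product described by finitely many measurable rectangles. -/
def gridSets (E₁ E₂ : Type*) [MeasurableSpace E₁] [MeasurableSpace E₂] : Set (Set (E₁ × E₂)) :=
  {S | ∃ (L L' : ℕ) (a : E₁ → Fin L) (b : E₂ → Fin L') (c : Set (Fin L × Fin L')),
    Measurable a ∧ Measurable b ∧ S = {z | (a z.1, b z.2) ∈ c}}

variable {E₁ E₂ : Type*} [MeasurableSpace E₁] [MeasurableSpace E₂]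

/-- A union is described on the common refinement of two grids, obtained by pairing labels. -/
theorem isSetAlgebra_gridSets : IsSetAlgebra (gridSets E₁ E₂) where
  empty_mem := ⟨1, 1, fun _ => 0, fun _ => 0, ∅, measurable_const, measurable_const, by simp⟩
  compl_mem := by
    rintro _ ⟨L, L', a, b, c, ha, hb, rfl⟩
    exact ⟨L, L', a, b, cᶜ, ha, hb, rfl⟩
  union_mem := by
    rintro _ _ ⟨L₁, L₁', a₁, b₁, c₁, ha₁, hb₁, rfl⟩ ⟨L₂, L₂', a₂, b₂, c₂, ha₂, hb₂, rfl⟩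
    refine ⟨L₁ * L₂, L₁' * L₂', fun x => finProdFinEquiv (a₁ x, a₂ x),
      fun y => finProdFinEquiv (b₁ y, b₂ y),
      {p | ((finProdFinEquiv.symm p.1).1, (finProdFinEquiv.symm p.2).1) ∈ c₁ ∨
        ((finProdFinEquiv.symm p.1).2, (finProdFinEquiv.symm p.2).2) ∈ c₂}, ?_, ?_, ?_⟩
    · exact (Measurable.of_discrete (f := finProdFinEquiv)).comp (ha₁.prodMk ha₂)
    · exact (Measurable.of_discrete (f := finProdFinEquiv)).comp (hb₁.prodMk hb₂)
    · ext z
      simp only [Set.mem_union, Set.mem_ofPred_eq, Equiv.symm_apply_apply]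

theorem generateFrom_gridSets :
    (Prod.instMeasurableSpace : MeasurableSpace (E₁ × E₂)) =
      MeasurableSpace.generateFrom (gridSets E₁ E₂) := by
  classical
  apply le_antisymm
  · rw [← generateFrom_prod]
    refine MeasurableSpace.generateFrom_mono ?_
    rintro _ ⟨s, hs, t, ht, rfl⟩
    refine ⟨2, 2, fun x => if x ∈ s then 1 else 0, fun y => if y ∈ t then 1 else 0, {(1, 1)},
      Measurable.ite hs measurable_const measurable_const,
      Measurable.ite ht measurable_const measurable_const, ?_⟩
    ext z
    by_cases h1 : z.1 ∈ s <;> by_cases h2 : z.2 ∈ t <;> simp [h1, h2]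
  · refine MeasurableSpace.generateFrom_le ?_
    rintro _ ⟨L, L', a, b, c, ha, hb, rfl⟩
    exact ((ha.comp measurable_fst).prodMk (hb.comp measurable_snd)) (MeasurableSet.of_discrete)

theorem isFinPartition_preimage {Ω : Type*} {m : MeasurableSpace Ω} {A : Ω → E₁} (hA : Measurable[m] A) {L : ℕ}
    {a : E₁ → Fin L} (ha : Measurable a) : IsFinPartition m fun j => {ω | a (A ω) = j} where
  measurable j := (ha.comp hA) (measurableSet_singleton j)
  disjoint := fun i j hij => Set.disjoint_left.2 fun ω h1 h2 => hij (h1.symm.trans h2)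
  cover := by ext ω; simp

/-- Two sub-σ-algebras are within `δ` of independence, in the sense of finite partitions. -/
def PartitionClose {Ω : Type*} [MeasurableSpace Ω] (P : Measure Ω) (m₁ m₂ : MeasurableSpace Ω) (δ : ℝ) : Prop :=
  ∀ (L L' : ℕ) (A : Fin L → Set Ω) (B : Fin L' → Set Ω), IsFinPartition m₁ A →
    IsFinPartition m₂ B → ∑ j, ∑ j', |P.real (A j ∩ B j') - P.real (A j) * P.real (B j')| ≤ δ

variable {Ω : Type*} {m₁ m₂ : MeasurableSpace Ω} [mΩ : MeasurableSpace Ω] {P : Measure Ω}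

theorem PartitionClose.mono {δ δ' : ℝ} (h : PartitionClose P m₁ m₂ δ)
    (hδ : δ ≤ δ') : PartitionClose P m₁ m₂ δ' :=
  fun L L' A B hA hB => (h L L' A B hA hB).trans hδ

theorem partitionClose_of_betaMixing {E : Type*} [MeasurableSpace E] {T : ℕ} {Z : Fin T → Ω → E}
    {k l : ℕ} (hl : 1 ≤ l) {δ : ℝ} (hδ : 0 ≤ δ) (h : betaMixing P Z k ≤ ENNReal.ofReal δ) :
    PartitionClose P (pastSigma Z l) (futureSigma Z (l + k)) (2 * δ) := by
  intro L L' A B hA hB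
  have h1 : ENNReal.ofReal (1 / 2 * ∑ j, ∑ j', |P.real (A j ∩ B j') -
      P.real (A j) * P.real (B j')|) ≤ ENNReal.ofReal δ := by
    refine le_trans ?_ h
    unfold betaMixing
    exact le_iSup₂_of_le l hl <| le_iSup₂_of_le L L' <| le_iSup₂_of_le A B <|
      le_iSup₂_of_le hA hB le_rfl
  have := (ENNReal.ofReal_le_ofReal_iff hδ).1 h1
  linarith

variable [IsProbabilityMeasure P]

/-- On a grid set the difference of the two laws is part of the sum that `PartitionClose` bounds.
Grid sets form an algebra that generates the product σ-algebra, so they approximate every measurable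
set in the sum of both laws. -/
theorem PartitionClose.measure_le {δ : ℝ}
    (h : PartitionClose P m₁ m₂ δ) (h₁ : m₁ ≤ mΩ) (h₂ : m₂ ≤ mΩ) {A : Ω → E₁} {B : Ω → E₂}
    (hA : Measurable[m₁] A) (hB : Measurable[m₂] B) (S : Set (E₁ × E₂)) (hS : MeasurableSet S) :
    P.map (fun ω => (A ω, B ω)) S ≤ (P.map A).prod (P.map B) S + ENNReal.ofReal δ := by
  classical
  have hA' : Measurable A := hA.mono h₁ le_rfl
  have hB' : Measurable B := hB.mono h₂ le_rfl
  have hAB : Measurable fun ω => (A ω, B ω) := hA'.prodMk hB'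
  set μ := P.map (fun ω => (A ω, B ω)) with hμ
  set ν := (P.map A).prod (P.map B) with hν
  have : IsProbabilityMeasure μ := Measure.isProbabilityMeasure_map hAB.aemeasurable
  have : IsProbabilityMeasure (P.map A) := Measure.isProbabilityMeasure_map hA'.aemeasurable
  have : IsProbabilityMeasure (P.map B) := Measure.isProbabilityMeasure_map hB'.aemeasurable
  have hgrid : ∀ S ∈ gridSets E₁ E₂, μ.real S ≤ ν.real S + δ := by
    rintro _ ⟨L, L', a, b, c, ha, hb, rfl⟩
    have hp := h L L' _ _ (isFinPartition_preimage hA ha) (isFinPartition_preimage hB hb)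
    have hdec : {z : E₁ × E₂ | (a z.1, b z.2) ∈ c} =
        ⋃ p ∈ Finset.univ.filter (· ∈ c), (a ⁻¹' {p.1}) ×ˢ (b ⁻¹' {p.2}) := by
      ext z
      simp only [Set.mem_ofPred_eq, Set.mem_iUnion, Finset.mem_filter, Finset.mem_univ, true_and,
        Set.mem_prod, Set.mem_preimage, Set.mem_singleton_iff, exists_prop, Prod.exists]
      constructor
      · intro hz; exact ⟨_, _, hz, rfl, rfl⟩
      · rintro ⟨i, j, hc, h1, h2⟩; rw [h1, h2]; exact hc
    have hms : ∀ p : Fin L × Fin L', MeasurableSet ((a ⁻¹' {p.1}) ×ˢ (b ⁻¹' {p.2})) := fun p =>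
      (ha (measurableSet_singleton _)).prod (hb (measurableSet_singleton _))
    have hdj : ∀ t : Finset (Fin L × Fin L'),
        (t : Set (Fin L × Fin L')).PairwiseDisjoint
          fun p => ((a ⁻¹' {p.1}) ×ˢ (b ⁻¹' {p.2}) : Set (E₁ × E₂)) := by
      intro t p _ q _ hpq
      refine Set.disjoint_left.2 fun z h1 h2 => hpq ?_
      exact Prod.ext (h1.1.symm.trans h2.1) (h1.2.symm.trans h2.2)
    rw [hdec, measureReal_biUnion_finset (hdj _) (fun p _ => hms p),
      measureReal_biUnion_finset (hdj _) (fun p _ => hms p)]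
    have e1 : ∀ p : Fin L × Fin L', μ.real ((a ⁻¹' {p.1}) ×ˢ (b ⁻¹' {p.2})) =
        P.real ({ω | a (A ω) = p.1} ∩ {ω | b (B ω) = p.2}) := by
      intro p
      rw [hμ, map_measureReal_apply hAB (hms p)]; rfl
    have e2 : ∀ p : Fin L × Fin L', ν.real ((a ⁻¹' {p.1}) ×ˢ (b ⁻¹' {p.2})) =
        P.real {ω | a (A ω) = p.1} * P.real {ω | b (B ω) = p.2} := by
      intro p
      rw [hν, measureReal_prod_prod, map_measureReal_apply hA' (ha (measurableSet_singleton _)),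
        map_measureReal_apply hB' (hb (measurableSet_singleton _))]; rfl
    simp_rw [e1, e2]
    rw [← sub_le_iff_le_add', ← Finset.sum_sub_distrib]
    refine le_trans ?_ hp
    rw [← Fintype.sum_prod_type' (f := fun j j' =>
      |P.real ({ω | a (A ω) = j} ∩ {ω | b (B ω) = j'}) -
        P.real {ω | a (A ω) = j} * P.real {ω | b (B ω) = j'}|)]
    exact (Finset.sum_le_sum fun p _ => le_abs_self _).trans
      (Finset.sum_le_sum_of_subset_of_nonneg (Finset.filter_subset _ _)
        fun p _ _ => abs_nonneg _)
  have hdense := Measure.MeasureDense.of_generateFrom_isSetAlgebra_finite (μ + ν)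
    (isSetAlgebra_gridSets (E₁ := E₁) (E₂ := E₂)) generateFrom_gridSets
  have hreal : μ.real S ≤ ν.real S + δ := by
    refine le_of_forall_pos_le_add fun ε hε => ?_
    obtain ⟨S', hS', hlt⟩ := hdense.approx S hS (measure_ne_top _ _) (ε / 2) (by positivity)
    have hS'm := hdense.measurable S' hS'
    have hm : (μ + ν).real (symmDiff S S') ≤ ε / 2 := by
      rw [Measure.real]
      exact ENNReal.toReal_le_of_le_ofReal (by positivity) hlt.le
    rw [measureReal_add_apply] at hm
    have hnn := measureReal_nonneg (μ := ν) (s := symmDiff S S')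
    have hnn' := measureReal_nonneg (μ := μ) (s := symmDiff S S')
    have h1 : μ.real S ≤ μ.real S' + μ.real (symmDiff S S') := by
      refine (measureReal_mono ?_).trans (measureReal_union_le _ _)
      intro x hx
      by_cases hx' : x ∈ S'
      · exact Or.inl hx'
      · exact Or.inr (Or.inl ⟨hx, hx'⟩)
    have h2 : ν.real S' ≤ ν.real S + ν.real (symmDiff S S') := by
      refine (measureReal_mono ?_).trans (measureReal_union_le _ _)
      intro x hx
      by_cases hx' : x ∈ S
      · exact Or.inl hx'
      · exact Or.inr (Or.inr ⟨hx, hx'⟩)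
    have := hgrid S' hS'
    linarith
  rw [← ENNReal.ofReal_toReal (measure_ne_top μ S)]
  refine (ENNReal.ofReal_le_ofReal hreal).trans (ENNReal.ofReal_add_le.trans_eq ?_)
  rw [Measure.real, ENNReal.ofReal_toReal (measure_ne_top ν S)]

theorem PartitionClose.lintegral_le {δ : ℝ}
    (h : PartitionClose P m₁ m₂ δ) (h₁ : m₁ ≤ mΩ) (h₂ : m₂ ≤ mΩ) {A : Ω → E₁} {B : Ω → E₂}
    (hA : Measurable[m₁] A) (hB : Measurable[m₂] B) {f : E₁ × E₂ → ℝ≥0∞} (hf : Measurable f)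
    (hf1 : ∀ x, f x ≤ 1) :
    ∫⁻ ω, f (A ω, B ω) ∂P ≤
      ∫⁻ ω, ∫⁻ b, f (A ω, b) ∂(P.map B) ∂P + ENNReal.ofReal δ := by
  have hA' : Measurable A := hA.mono h₁ le_rfl
  have hB' : Measurable B := hB.mono h₂ le_rfl
  have : IsProbabilityMeasure (P.map B) := Measure.isProbabilityMeasure_map hB'.aemeasurable
  have := lintegral_le_add_of_measure_le (h.measure_le h₁ h₂ hA hB) hf hf1
  rwa [lintegral_map hf (hA'.prodMk hB'), lintegral_prod _ hf.aemeasurable,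
    lintegral_map hf.lintegral_prod_right' hA'] at this

/-- By independence `R` can be frozen as a parameter, and the bound for frozen `R` is uniform in its
value. -/
theorem PartitionClose.lintegral_le_of_indep {E₃ : Type*} [MeasurableSpace E₃]
    {δ : ℝ}
    (h : PartitionClose P m₁ m₂ δ) (h₁ : m₁ ≤ mΩ) (h₂ : m₂ ≤ mΩ) {A : Ω → E₁} {B : Ω → E₂}
    (hA : Measurable[m₁] A) (hB : Measurable[m₂] B) {R : Ω → E₃} (hR : Measurable R)
    (hind : IndepFun R (fun ω => (A ω, B ω)) P)
    {f : E₃ × E₁ × E₂ → ℝ≥0∞} (hf : Measurable f) (hf1 : ∀ x, f x ≤ 1) :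
    ∫⁻ ω, f (R ω, A ω, B ω) ∂P ≤
      ∫⁻ ω, ∫⁻ b, f (R ω, A ω, b) ∂(P.map B) ∂P + ENNReal.ofReal δ := by
  have hA' : Measurable A := hA.mono h₁ le_rfl
  have hB' : Measurable B := hB.mono h₂ le_rfl
  have hAB : Measurable fun ω => (A ω, B ω) := hA'.prodMk hB'
  have : IsProbabilityMeasure (P.map B) := Measure.isProbabilityMeasure_map hB'.aemeasurable
  have : IsProbabilityMeasure (P.map R) := Measure.isProbabilityMeasure_map hR.aemeasurable
  have : IsProbabilityMeasure (P.map fun ω => (A ω, B ω)) :=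
    Measure.isProbabilityMeasure_map hAB.aemeasurable
  have hsplit : ∀ g : E₃ × E₁ × E₂ → ℝ≥0∞, Measurable g →
      ∫⁻ ω, g (R ω, A ω, B ω) ∂P = ∫⁻ r, ∫⁻ ω, g (r, A ω, B ω) ∂P ∂(P.map R) := by
    intro g hg
    have hmap := (indepFun_iff_map_prod_eq_prod_map_map hR.aemeasurable hAB.aemeasurable).1 hind
    rw [← lintegral_map (f := g) (g := fun ω => (R ω, A ω, B ω)) hg (hR.prodMk hAB), hmap,
      lintegral_prod _ hg.aemeasurable]
    refine lintegral_congr fun r => ?_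
    rw [lintegral_map (f := fun y => g (r, y)) (hg.comp measurable_prodMk_left) hAB]
  rw [hsplit f hf]
  have hg : Measurable fun z : E₃ × E₁ × E₂ => ∫⁻ b, f (z.1, z.2.1, b) ∂(P.map B) := by
    have : Measurable fun z : (E₃ × E₁ × E₂) × E₂ => f (z.1.1, z.1.2.1, z.2) := by
      exact hf.comp (by fun_prop)
    exact this.lintegral_prod_right'
  rw [hsplit _ hg]
  calc _ ≤ ∫⁻ r, (∫⁻ ω, ∫⁻ b, f (r, A ω, b) ∂(P.map B) ∂P + ENNReal.ofReal δ) ∂(P.map R) :=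
        lintegral_mono fun r => h.lintegral_le h₁ h₂ hA hB (f := fun z => f (r, z))
          (hf.comp measurable_prodMk_left) fun _ => hf1 _
    _ = _ := by
      rw [lintegral_add_right _ measurable_const]
      simp

/-- Serves the entries with nothing at least `c` before them: the past is then trivial, whereas
`betaMixing` only ranges over `l ≥ 1`. -/
theorem partitionClose_bot : PartitionClose P ⊥ m₂ 0 := by
  intro L L' A B hA hB
  refine le_of_eq (Finset.sum_eq_zero fun j _ => Finset.sum_eq_zero fun j' _ => ?_)
  rcases MeasurableSpace.measurableSet_bot_iff.1 (hA.measurable j) with h | h <;> simp [h]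

/-- The joint law of the entries on a set of well separated positions is close to the product of
the marginal laws. -/
theorem lintegral_le_lmarginal {E : Type*} [MeasurableSpace E] {n T : ℕ}
    {Z : Fin n → Fin T → Ω → E} (hZ : ∀ i t, Measurable (Z i t))
    (hind : iIndepFun (fun i ω t => Z i t ω) P) {c : ℕ} {δ : ℝ} (hδ : 0 ≤ δ)
    (hmix : ∀ i, betaMixing P (Z i) c ≤ ENNReal.ofReal δ)
    {φ : Fin n × Fin T → E → ℝ} (hφ : ∀ z, Measurable (φ z)) (s : Finset (Fin n × Fin T))
    (hs : ∀ z ∈ s, ∀ z' ∈ s, z.1 = z'.1 → z.2 < z'.2 → (z.2 : ℕ) + c ≤ z'.2)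
    (x₀ : Fin n × Fin T → ℝ) :
    ∀ f : (Fin n × Fin T → ℝ) → ℝ≥0∞, Measurable f → (∀ x, f x ≤ 1) →
    ∫⁻ ω, f (Function.updateFinset x₀ s fun z => φ z (Z z.1.1 z.1.2 ω)) ∂P ≤
      (∫⋯∫⁻_s, f ∂(fun z => P.map fun ω => φ z (Z z.1 z.2 ω))) x₀ +
        s.card * ENNReal.ofReal (2 * δ) := by
  have hU : ∀ z : Fin n × Fin T, Measurable fun ω => φ z (Z z.1 z.2 ω) := fun z =>
    (hφ z).comp (hZ _ _)
  have : ∀ z : Fin n × Fin T, IsProbabilityMeasure (P.map fun ω => φ z (Z z.1 z.2 ω)) :=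
    fun z => Measure.isProbabilityMeasure_map (hU z).aemeasurable
  -- The lexicographically greatest position `a` is split off: it comes last in its row, so the
  -- separation hypothesis puts the other entries of that row at least `c` before it.
  induction s using Finset.induction_on_max_value
    (fun z : Fin n × Fin T => (toLex z : Fin n ×ₗ Fin T)) with
  | empty => intro f _ _; simp
  | insert a s has hmax ih =>
    intro f hf hf1
    have ih' := ih fun z hz z' hz' => hs z (Finset.mem_insert_of_mem hz) z'
      (Finset.mem_insert_of_mem hz')
    set U : Fin n × Fin T → Ω → ℝ := fun z ω => φ z (Z z.1 z.2 ω) with hUdef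
    -- `R` carries the other rows and `A` the earlier entries of the row of `a`. Both are extended
    -- by zero, so on `s` their sum restores all values.
    set R : Ω → Fin n × Fin T → ℝ := fun ω z => if z ∈ s ∧ z.1 ≠ a.1 then U z ω else 0 with hR
    set A : Ω → Fin n × Fin T → ℝ := fun ω z => if z ∈ s ∧ z.1 = a.1 then U z ω else 0 with hA
    have hRm : Measurable R := measurable_pi_iff.2 fun z => by
      by_cases h : z ∈ s ∧ z.1 ≠ a.1
      · simpa only [hR, if_pos h] using hU z
      · simpa only [hR, if_neg h] using measurable_const
    set g : (Fin n × Fin T → ℝ) × (Fin n × Fin T → ℝ) × ℝ → ℝ≥0∞ := fun w =>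
      f fun z => if z = a then w.2.2 else if z ∈ s then w.1 z + w.2.1 z else x₀ z with hg
    have hgm : Measurable g := by
      refine hf.comp (measurable_pi_iff.2 fun z => ?_)
      by_cases h1 : z = a
      · simp only [h1, if_true]; fun_prop
      · by_cases h2 : z ∈ s
        · simp only [h1, h2, if_true, if_false]; fun_prop
        · simp only [h1, h2, if_false]; fun_prop
    have hsep : ∀ z ∈ s, z.1 = a.1 → (z.2 : ℕ) + c ≤ a.2 := by
      intro z hz hza
      refine hs z (Finset.mem_insert_of_mem hz) a (Finset.mem_insert_self _ _) hza ?_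
      have := hmax z hz
      rw [Prod.Lex.toLex_le_toLex] at this
      rcases this with h | ⟨-, h⟩
      · exact absurd hza h.ne
      · refine lt_of_le_of_ne h fun h' => has ?_
        rwa [← (Prod.ext hza h' : z = a)]
    have hcomp : ∀ (i : Fin n) (t : Fin T) (m : MeasurableSpace Ω),
        MeasurableSpace.comap (Z i t) inferInstance ≤ m → Measurable[m] (U (i, t)) := by
      intro i t m hm
      exact (hφ (i, t)).comp ((comap_measurable (Z i t)).mono hm le_rfl)
    have hfut : Measurable[futureSigma (Z a.1) (a.2 + 1)] (U a) :=
      hcomp a.1 a.2 _ (le_iSup_of_le (⟨a.2, le_rfl⟩ : {t : Fin T // (a.2 : ℕ) + 1 ≤ t + 1}) le_rfl)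
    have hfle : ∀ k, futureSigma (Z a.1) k ≤ mΩ := fun k => iSup_le fun t => (hZ _ _).comap_le
    have hindep : IndepFun R (fun ω => (A ω, U a ω)) P := by
      have h1 := hind.indepFun_finset (Finset.univ.erase a.1) {a.1} (by simp)
        (fun i => measurable_pi_iff.2 fun t => hZ i t)
      set φ' : ((Finset.univ.erase a.1 : Finset (Fin n)) → Fin T → E) → Fin n × Fin T → ℝ :=
        fun w z => if h : z ∈ s ∧ z.1 ≠ a.1 then φ z (w ⟨z.1, by simpa using h.2⟩ z.2) else 0
        with hφ'
      set ψ' : (({a.1} : Finset (Fin n)) → Fin T → E) → (Fin n × Fin T → ℝ) × ℝ :=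
        fun w => ((fun z : Fin n × Fin T => if z ∈ s ∧ z.1 = a.1 then
            φ z (w ⟨a.1, by simp⟩ z.2) else 0), φ a (w ⟨a.1, by simp⟩ a.2)) with hψ'
      have hφm : Measurable φ' := by
        refine measurable_pi_iff.2 fun z => ?_
        by_cases h : z ∈ s ∧ z.1 ≠ a.1
        · simp only [hφ', dif_pos h]
          exact (hφ z).comp (by fun_prop)
        · simp only [hφ', dif_neg h]; exact measurable_const
      have hψm : Measurable ψ' := by
        refine Measurable.prodMk (measurable_pi_iff.2 fun z => ?_) ((hφ a).comp (by fun_prop))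
        by_cases h : z ∈ s ∧ z.1 = a.1
        · simp only [if_pos h]
          exact (hφ z).comp (by fun_prop)
        · simp only [if_neg h]; exact measurable_const
      have h2 := h1.comp hφm hψm
      convert h2 using 1
      · funext ω z
        simp only [hR, hφ', Function.comp]
        split_ifs with h
        · rfl
        · rfl
      · funext ω
        simp only [hA, hψ', Function.comp, Prod.mk.injEq]
        refine ⟨?_, rfl⟩
        funext z
        split_ifs with h
        · rw [hUdef]; simp only; rw [h.2]
        · rfl
    -- Replacing `U a` by an independent copy costs `2δ` once; the induction hypothesis then applies
    -- to the function with coordinate `a` integrated out.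
    have key : ∫⁻ ω, g (R ω, A ω, U a ω) ∂P ≤
        ∫⁻ ω, ∫⁻ b, g (R ω, A ω, b) ∂(P.map (U a)) ∂P + ENNReal.ofReal (2 * δ) := by
      by_cases hc : c ≤ a.2
      · have hclose := partitionClose_of_betaMixing (l := a.2 + 1 - c) (by omega) hδ (hmix a.1)
        rw [show (a.2 : ℕ) + 1 - c + c = a.2 + 1 by omega] at hclose
        refine hclose.lintegral_le_of_indep (iSup_le fun t => (hZ _ _).comap_le) (hfle _) ?_ hfut
          hRm hindep hgm fun _ => hf1 _
        refine (@measurable_pi_iff _ _ _ (pastSigma (Z a.1) (a.2 + 1 - c)) _ _).2 fun z => ?_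
        by_cases h : z ∈ s ∧ z.1 = a.1
        · simp only [hA, if_pos h]
          have hz := hsep z h.1 h.2
          have hz' : (z.2 : ℕ) + 1 ≤ a.2 + 1 - c := by omega
          have e : z = (a.1, z.2) := Prod.ext h.2 rfl
          rw [e]
          exact hcomp a.1 z.2 _
            (le_iSup_of_le (⟨z.2, hz'⟩ : {t : Fin T // (t : ℕ) + 1 ≤ a.2 + 1 - c}) le_rfl)
        · simp only [hA, if_neg h]
          exact @measurable_const _ _ _ (pastSigma (Z a.1) (a.2 + 1 - c)) _
      · have hA0 : A = fun _ _ => 0 := by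
          funext ω z
          simp only [hA]
          rw [if_neg]
          rintro ⟨h1, h2⟩
          have := hsep z h1 h2
          omega
        refine (partitionClose_bot.mono (by positivity)).lintegral_le_of_indep bot_le (hfle _) ?_
          hfut hRm hindep hgm fun _ => hf1 _
        rw [hA0]
        exact @measurable_const _ _ _ ⊥ _
    have e1 : ∀ ω b, g (R ω, A ω, b) = f (Function.update (Function.updateFinset x₀ s
        fun z => U z.1 ω) a b) := by
      intro ω b
      simp only [hg]
      congr 1
      funext z
      by_cases h1 : z = a
      · subst h1; simp
      · rw [if_neg h1, Function.update_of_ne h1]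
        by_cases h2 : z ∈ s
        · rw [if_pos h2, Function.updateFinset, dif_pos h2]
          by_cases h3 : z.1 = a.1 <;> simp [hR, hA, h2, h3]
        · rw [if_neg h2, Function.updateFinset, dif_neg h2]
    have e2 : ∀ ω, f (Function.updateFinset x₀ (insert a s) fun z => U z.1 ω) =
        g (R ω, A ω, U a ω) := by
      intro ω
      rw [e1]
      congr 1
      funext z
      by_cases h1 : z = a
      · subst h1; simp [Function.updateFinset]
      · rw [Function.update_of_ne h1]
        simp [Function.updateFinset, h1]
    have hfm : Measurable fun x : Fin n × Fin T → ℝ =>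
        ∫⁻ b, f (Function.update x a b) ∂(P.map (U a)) := by
      have : Measurable fun w : (Fin n × Fin T → ℝ) × ℝ => f (Function.update w.1 a w.2) :=
        hf.comp measurable_update'
      exact this.lintegral_prod_right'
    have hf1' : ∀ x : Fin n × Fin T → ℝ,
        ∫⁻ b, f (Function.update x a b) ∂(P.map (U a)) ≤ 1 := fun x => by
      have : IsProbabilityMeasure (P.map (U a)) := this a
      calc _ ≤ ∫⁻ _b, 1 ∂(P.map (U a)) := lintegral_mono fun b => hf1 _
        _ = 1 := by simp
    have key2 := ih' _ hfm hf1'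
    rw [lmarginal_insert' _ hf has, Finset.card_insert_of_notMem has]
    have e3 : ∫⁻ ω, f (Function.updateFinset x₀ (insert a s) fun z => φ z (Z z.1.1 z.1.2 ω)) ∂P =
        ∫⁻ ω, g (R ω, A ω, U a ω) ∂P := lintegral_congr e2
    rw [e3]
    refine key.trans ?_
    simp_rw [e1]
    refine (add_le_add key2 le_rfl).trans_eq ?_
    push_cast
    ring

end Decoupling

/-! ### Consequences of the density bounds -/

section Density

variable {ν : Measure ℝ} {g : ℝ → ℝ} {b b' : ℝ}

theorem IsSmoothDensity.sub_le (h : IsSmoothDensity ν g b b') (m y : ℝ) :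
    g m - b' * |y - m| ≤ g y := by
  have := Convex.norm_image_sub_le_of_norm_deriv_le (f := g) (C := b') (s := Set.univ)
    (x := m) (y := y) (fun x _ => h.differentiable x) (fun x _ => h.deriv_le_bound x)
    convex_univ (Set.mem_univ _) (Set.mem_univ _)
  rw [Real.norm_eq_abs, Real.norm_eq_abs] at this
  have := neg_abs_le (g y - g m)
  linarith

theorem IsSmoothDensity.bound_nonneg (h : IsSmoothDensity ν g b b') : 0 ≤ b' :=
  (abs_nonneg _).trans (h.deriv_le_bound 0)

theorem IsSmoothDensity.measure_ge (h : IsSmoothDensity ν g b b') {m f r : ℝ} (hf : f ≤ g m)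
    {S : Set ℝ} (hS : MeasurableSet S) (hr : ∀ y ∈ S, |y - m| ≤ r) :
    ENNReal.ofReal (f - b' * r) * volume S ≤ ν S := by
  rw [h.density, withDensity_apply _ hS]
  calc _ = ∫⁻ _y in S, ENNReal.ofReal (f - b' * r) := by simp
    _ ≤ _ := by
      refine setLIntegral_mono' hS fun y hy => ENNReal.ofReal_le_ofReal ?_
      have := h.sub_le m y
      have := mul_le_mul_of_nonneg_left (hr y hy) h.bound_nonneg
      linarith

theorem IsSmoothDensity.measure_Ioc_right (h : IsSmoothDensity ν g b b') {m f r : ℝ}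
    (hf : f ≤ g m) (hr : 0 ≤ r) :
    ENNReal.ofReal (r * (f - b' * r)) ≤ ν (Set.Ioc m (m + r)) := by
  have := h.measure_ge hf (S := Set.Ioc m (m + r)) measurableSet_Ioc (r := r) fun y hy => by
    rw [abs_le]; constructor <;> linarith [hy.1, hy.2]
  rw [Real.volume_Ioc, add_sub_cancel_left, mul_comm, ← ENNReal.ofReal_mul hr] at this
  exact this

theorem IsSmoothDensity.measure_Ioc_left (h : IsSmoothDensity ν g b b') {m f r : ℝ}
    (hf : f ≤ g m) (hr : 0 ≤ r) :
    ENNReal.ofReal (r * (f - b' * r)) ≤ ν (Set.Ioc (m - r) m) := by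
  have := h.measure_ge hf (S := Set.Ioc (m - r) m) measurableSet_Ioc (r := r) fun y hy => by
    rw [abs_le]; constructor <;> linarith [hy.1, hy.2]
  rw [Real.volume_Ioc, sub_sub_cancel, mul_comm, ← ENNReal.ofReal_mul hr] at this
  exact this

/-- The interval of radius `1 / f` around `m` has mass at least `(2 / f)(f - b' / f) = 2 - 2 b' /
f²`, which cannot exceed one. This keeps the factor `b' / f²` of the rate away from zero. -/
theorem IsSmoothDensity.sq_le [IsProbabilityMeasure ν] (h : IsSmoothDensity ν g b b') {m f : ℝ}
    (hf : f ≤ g m) (hf0 : 0 < f) : f ^ 2 / 2 ≤ b' := by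
  have := h.measure_ge hf (S := Set.Icc (m - 1 / f) (m + 1 / f)) measurableSet_Icc (r := 1 / f)
    fun y hy => by rw [abs_le]; constructor <;> linarith [hy.1, hy.2]
  rw [Real.volume_Icc, mul_comm, ← ENNReal.ofReal_mul
    (by have : 0 < 1 / f := by positivity
        linarith)] at this
  have h2 := this.trans (prob_le_one (μ := ν))
  rw [← ENNReal.ofReal_one, ENNReal.ofReal_le_ofReal_iff zero_le_one] at h2
  have e : (m + 1 / f - (m - 1 / f)) * (f - b' * (1 / f)) = 2 - 2 * b' / f ^ 2 := by
    field_simp; ring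
  rw [e] at h2
  have h3 : 1 ≤ 2 * b' / f ^ 2 := by linarith
  rw [le_div_iff₀ (by positivity)] at h3
  linarith

/-- A law with a density has no atoms, so its distribution function is continuous and attains the
level `τ` exactly at the quantile. -/
theorem IsSmoothDensity.measure_Iic_quantile [IsProbabilityMeasure ν]
    (h : IsSmoothDensity ν g b b') {τ : ℝ} (hτ0 : 0 < τ) (hτ1 : τ < 1) :
    ν (Set.Iic (quantile ν τ)) = ENNReal.ofReal τ := by
  have hna : ∀ x, ν {x} = 0 := fun x => by
    rw [h.density]
    exact (withDensity_absolutelyContinuous _ _) (by simp)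
  have hcont : Continuous (cdf ν) := by
    rw [continuous_iff_continuousAt]
    intro x
    have h1 := (cdf ν).measure_singleton x
    rw [measure_cdf, hna x] at h1
    have h2 : cdf ν x - Function.leftLim (cdf ν) x ≤ 0 := ENNReal.ofReal_eq_zero.1 h1.symm
    rw [(monotone_cdf ν).continuousAt_iff_leftLim_eq_rightLim, StieltjesFunction.rightLim_eq]
    exact le_antisymm ((monotone_cdf ν).leftLim_le le_rfl) (by linarith)
  set S : Set ℝ := {y | τ ≤ cdf ν y} with hS
  have hcl : IsClosed S := isClosed_le continuous_const hcont
  have hne : S.Nonempty := by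
    have := (tendsto_cdf_atTop ν).eventually (lt_mem_nhds hτ1)
    obtain ⟨y, hy⟩ := this.exists
    exact ⟨y, hy.le⟩
  have hbd : BddBelow S := by
    have := (tendsto_cdf_atBot ν).eventually (gt_mem_nhds hτ0)
    obtain ⟨y, hy⟩ := this.exists
    refine ⟨y, fun z hz => ?_⟩
    by_contra hcon
    have := monotone_cdf ν (not_le.1 hcon).le
    exact absurd (lt_of_le_of_lt this hy) (not_lt.2 hz)
  have hq : quantile ν τ = sInf S := rfl
  have h1 : τ ≤ cdf ν (sInf S) := hcl.csInf_mem hne hbd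
  have h2 : cdf ν (sInf S) ≤ τ := by
    refine le_of_tendsto (hcont.continuousAt.tendsto.mono_left
      (nhdsWithin_le_nhds (s := Set.Iio (sInf S)))) ?_
    filter_upwards [self_mem_nhdsWithin] with y hy
    exact (not_le.1 fun hy' => not_lt.2 (csInf_le hbd hy') hy).le
  rw [hq, ← ofReal_cdf, le_antisymm h2 h1]

end Density

/-! ### The centred check loss -/

/-- The Bregman remainder of the check loss at `u` in direction `v`; it does not depend on the
quantile level. -/
noncomputable def bregman (u v : ℝ) : ℝ := if u ≤ 0 then max (u - v) 0 else max (v - u) 0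

/-- Knight's identity: a linear term in the score, and a remainder that is positive only when `v`
passes beyond `u`. -/
theorem checkLoss_sub (τ u v : ℝ) :
    checkLoss τ (u - v) - checkLoss τ u =
      bregman u v - (τ - if u ≤ 0 then 1 else 0) * v := by
  unfold checkLoss bregman
  by_cases h1 : u ≤ 0 <;> by_cases h2 : u - v ≤ 0
  · rw [if_pos h1, if_pos h2, if_pos h1, max_eq_right h2]; ring
  · rw [if_pos h1, if_neg h2, if_pos h1, max_eq_left (not_le.1 h2).le]; ring
  · rw [if_neg h1, if_pos h2, if_neg h1, max_eq_left (by linarith)]; ring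
  · rw [if_neg h1, if_neg h2, if_neg h1, max_eq_right (by linarith)]; ring

theorem bregman_nonneg (u v : ℝ) : 0 ≤ bregman u v := by
  unfold bregman; split_ifs <;> exact le_max_right _ _

theorem bregman_zero (u : ℝ) : bregman u 0 = 0 := by
  unfold bregman
  split_ifs with h
  · rw [sub_zero, max_eq_right h]
  · rw [zero_sub, max_eq_right]; linarith

theorem bregman_lipschitz (u v v' : ℝ) : |bregman u v - bregman u v'| ≤ |v - v'| := by
  unfold bregman
  split_ifs
  · refine (abs_max_sub_max_le_abs _ _ _).trans_eq ?_
    rw [sub_sub_sub_cancel_left, abs_sub_comm]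
  · refine (abs_max_sub_max_le_abs _ _ _).trans_eq ?_
    rw [sub_sub_sub_cancel_right]

theorem bregman_le (u v : ℝ) : bregman u v ≤ |v| := by
  have := bregman_lipschitz u v 0
  rw [bregman_zero, sub_zero, sub_zero] at this
  exact (le_abs_self _).trans this

theorem measurable_bregman (v : ℝ) : Measurable fun u => bregman u v :=
  Measurable.ite measurableSet_Iic (by fun_prop) (by fun_prop)

theorem checkLoss_lipschitz {τ : ℝ} (h0 : 0 < τ) (h1 : τ < 1) (u v : ℝ) :
    |checkLoss τ u - checkLoss τ v| ≤ |u - v| := by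
  unfold checkLoss
  by_cases hu : u ≤ 0 <;> by_cases hv : v ≤ 0
  · simp only [if_pos hu, if_pos hv]
    rw [← mul_sub, abs_mul]
    exact mul_le_of_le_one_left (abs_nonneg _) (abs_le.2 ⟨by linarith, by linarith⟩)
  · simp only [if_pos hu, if_neg hv]
    rw [abs_of_neg (by linarith : u - v < 0), abs_le]
    constructor <;> nlinarith
  · simp only [if_neg hu, if_pos hv]
    rw [abs_of_pos (by linarith : 0 < u - v), abs_le]
    constructor <;> nlinarith
  · simp only [if_neg hu, if_neg hv]
    rw [← mul_sub, abs_mul]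
    exact mul_le_of_le_one_left (abs_nonneg _) (abs_le.2 ⟨by linarith, by linarith⟩)

theorem checkLoss_eq_max {τ : ℝ} (u : ℝ) :
    checkLoss τ u = max (τ * u) ((τ - 1) * u) := by
  unfold checkLoss
  split_ifs with h
  · rw [max_eq_right (by nlinarith)]
  · rw [max_eq_left (by nlinarith), sub_zero]

theorem checkLoss_convex (τ : ℝ) {l : ℝ} (h0 : 0 ≤ l) (h1 : l ≤ 1) (u v : ℝ) :
    checkLoss τ ((1 - l) * u + l * v) ≤ (1 - l) * checkLoss τ u + l * checkLoss τ v := by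
  simp only [checkLoss_eq_max]
  have a1 := le_max_left (τ * u) ((τ - 1) * u)
  have a2 := le_max_right (τ * u) ((τ - 1) * u)
  have b1 := le_max_left (τ * v) ((τ - 1) * v)
  have b2 := le_max_right (τ * v) ((τ - 1) * v)
  have h2 : 0 ≤ 1 - l := by linarith
  refine max_le ?_ ?_
  · nlinarith [mul_le_mul_of_nonneg_left a1 h2, mul_le_mul_of_nonneg_left b1 h0]
  · nlinarith [mul_le_mul_of_nonneg_left a2 h2, mul_le_mul_of_nonneg_left b2 h0]

/-! ### The marginal law of the quantile residual -/

section Residual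

variable {Ω : Type*} [MeasurableSpace Ω] {P : Measure Ω} [IsProbabilityMeasure P]
  {p : ℕ} {X : Ω → Fin p → ℝ} {Y : Ω → ℝ} {m : (Fin p → ℝ) → ℝ} {f b b' : ℝ}

theorem measure_residual (hX : Measurable X) (hY : Measurable Y) (hm : Measurable m) {S : Set ℝ}
    (hS : MeasurableSet S) :
    P {ω | Y ω - m (X ω) ∈ S} =
      ∫⁻ x, condDistrib Y X P x {y | y - m x ∈ S} ∂(P.map X) := by
  have hSm : MeasurableSet {z : (Fin p → ℝ) × ℝ | z.2 - m z.1 ∈ S} :=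
    (measurable_snd.sub (hm.comp measurable_fst)) hS
  have h1 : P {ω | Y ω - m (X ω) ∈ S} =
      P.map (fun ω => (X ω, Y ω)) {z : (Fin p → ℝ) × ℝ | z.2 - m z.1 ∈ S} := by
    rw [Measure.map_apply (hX.prodMk hY) hSm]; rfl
  rw [h1, ← compProd_map_condDistrib hY.aemeasurable, Measure.compProd_apply hSm]
  rfl

theorem le_measure_residual (hX : Measurable X) (hY : Measurable Y) (hm : Measurable m) {S : Set ℝ}
    (hS : MeasurableSet S) {a : ℝ≥0∞}
    (h : ∀ᵐ x ∂(P.map X), a ≤ condDistrib Y X P x {y | y - m x ∈ S}) :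
    a ≤ P {ω | Y ω - m (X ω) ∈ S} := by
  have : IsProbabilityMeasure (P.map X) := Measure.isProbabilityMeasure_map hX.aemeasurable
  rw [measure_residual hX hY hm hS]
  calc a = ∫⁻ _x, a ∂(P.map X) := by simp
    _ ≤ _ := lintegral_mono_ae h

/-- The residual `U` has `τ`-quantile zero and puts enough mass near zero. -/
structure ResidualBounds (P : Measure Ω) (U : Ω → ℝ) (τ f b' : ℝ) : Prop where
  measure_nonpos : P {ω | U ω ≤ 0} = ENNReal.ofReal τ
  right : ∀ r, 0 ≤ r → ENNReal.ofReal (r * (f - b' * r)) ≤ P {ω | U ω ∈ Set.Ioc 0 r}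
  left : ∀ r, 0 ≤ r → ENNReal.ofReal (r * (f - b' * r)) ≤ P {ω | U ω ∈ Set.Ioc (-r) 0}

/-- Once the conditional quantile is subtracted, the conditional bounds no longer depend on `x` and
can be averaged over the law of `X`. -/
theorem residualBounds (hX : Measurable X) (hY : Measurable Y) (hm : Measurable m) {τ : ℝ}
    (hτ0 : 0 < τ) (hτ1 : τ < 1)
    (hq : ∀ᵐ x ∂(P.map X), quantile (condDistrib Y X P x) τ = m x)
    (hd : ∀ᵐ x ∂(P.map X), ∃ g : ℝ → ℝ, IsSmoothDensity (condDistrib Y X P x) g b b' ∧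
      f ≤ g (m x)) :
    ResidualBounds P (fun ω => Y ω - m (X ω)) τ f b' where
  measure_nonpos := by
    have : IsProbabilityMeasure (P.map X) := Measure.isProbabilityMeasure_map hX.aemeasurable
    have h1 := measure_residual (P := P) hX hY hm (S := Set.Iic 0) measurableSet_Iic
    simp only [Set.mem_Iic] at h1
    rw [h1]
    calc _ = ∫⁻ _x, ENNReal.ofReal τ ∂(P.map X) := by
          refine lintegral_congr_ae ?_
          filter_upwards [hq, hd] with x hx ⟨g, hg, _⟩
          have := hg.measure_Iic_quantile hτ0 hτ1
          rw [hx] at this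
          rw [← this]
          congr 1; ext y; simp
      _ = _ := by simp
  right r hr := by
    refine le_measure_residual hX hY hm measurableSet_Ioc ?_
    filter_upwards [hd] with x ⟨g, hg, hgf⟩
    refine (hg.measure_Ioc_right hgf hr).trans_eq ?_
    congr 1; ext y; simp only [Set.mem_Ioc, Set.mem_ofPred_eq]
    constructor <;> rintro ⟨h1, h2⟩ <;> constructor <;> linarith
  left r hr := by
    refine le_measure_residual hX hY hm measurableSet_Ioc ?_
    filter_upwards [hd] with x ⟨g, hg, hgf⟩
    refine (hg.measure_Ioc_left hgf hr).trans_eq ?_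
    congr 1; ext y; simp only [Set.mem_Ioc, Set.mem_ofPred_eq]
    constructor <;> rintro ⟨h1, h2⟩ <;> constructor <;> linarith

theorem sq_le_of_density (hX : Measurable X)
    (hd : ∀ᵐ x ∂(P.map X), ∃ g : ℝ → ℝ, IsSmoothDensity (condDistrib Y X P x) g b b' ∧
      f ≤ g (m x)) (hf : 0 < f) : f ^ 2 / 2 ≤ b' := by
  have : IsProbabilityMeasure (P.map X) := Measure.isProbabilityMeasure_map hX.aemeasurable
  obtain ⟨x, g, hg, hgf⟩ := hd.exists
  exact hg.sq_le hgf hf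

theorem ResidualBounds.integral_sign {U : Ω → ℝ} {τ : ℝ}
    (h : ResidualBounds P U τ f b') (hU : Measurable U) (hτ0 : 0 < τ) :
    ∫ u, (τ - if u ≤ 0 then 1 else 0) ∂(P.map U) = 0 := by
  have : IsProbabilityMeasure (P.map U) := Measure.isProbabilityMeasure_map hU.aemeasurable
  have e : (fun u : ℝ => if u ≤ 0 then (1 : ℝ) else 0) =
      (Set.Iic (0 : ℝ)).indicator fun _ => (1 : ℝ) := by
    funext u; simp [Set.indicator]
  rw [integral_sub (integrable_const _) (by
    rw [e]; exact (integrable_const _).indicator measurableSet_Iic), e,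
    integral_indicator measurableSet_Iic]
  have h1 : (P.map U).real (Set.Iic 0) = τ := by
    rw [Measure.real, Measure.map_apply hU measurableSet_Iic]
    have : U ⁻¹' Set.Iic 0 = {ω | U ω ≤ 0} := rfl
    rw [this, h.measure_nonpos, ENNReal.toReal_ofReal hτ0.le]
  simp [h1]

/-- When `u` lies between 0 and `v / 2`, the remainder is at least `|v| / 2`. The length `r = |v| f
/ (2 b' D)` satisfies `r ≤ |v| / 2` and `b' r ≤ f / 2`, so the interval of that length next to zero,
on the side of `v`, has mass at least `r f / 2`. The product of the two is the quadratic bound. -/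
theorem ResidualBounds.bregman_ge {U : Ω → ℝ} {τ : ℝ} (h : ResidualBounds P U τ f b')
    (hU : Measurable U) (hf : 0 < f) (hb : f ^ 2 / 2 ≤ b') {D v : ℝ} (hD : 2 / f ≤ D)
    (hv : |v| ≤ D) :
    f ^ 2 / (8 * b' * D) * v ^ 2 ≤ ∫ u, bregman u v ∂(P.map U) := by
  have : IsProbabilityMeasure (P.map U) := Measure.isProbabilityMeasure_map hU.aemeasurable
  have hb0 : 0 < b' := lt_of_lt_of_le (by positivity) hb
  have hD0 : 0 < D := lt_of_lt_of_le (by positivity) hD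
  set r := |v| * f / (2 * b' * D) with hr
  have hr0 : 0 ≤ r := by positivity
  have hfD : f ≤ b' * D := by
    have h1 : f = f ^ 2 / 2 * (2 / f) := by field_simp
    rw [h1]
    exact mul_le_mul hb hD (by positivity) hb0.le
  have hr1 : r ≤ |v| / 2 := by
    rw [hr, div_le_div_iff₀ (by positivity) (by norm_num)]
    nlinarith [mul_le_mul_of_nonneg_left hfD (abs_nonneg v)]
  have hr2 : b' * r ≤ f / 2 := by
    have : b' * r = |v| * f / (2 * D) := by rw [hr]; field_simp
    rw [this, div_le_div_iff₀ (by positivity) (by norm_num)]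
    nlinarith [mul_le_mul_of_nonneg_left hv hf.le]
  have hmass : r * (f / 2) ≤ r * (f - b' * r) := mul_le_mul_of_nonneg_left (by linarith) hr0
  have key : ∀ S : Set ℝ, MeasurableSet S → (∀ u ∈ S, |v| / 2 ≤ bregman u v) →
      ENNReal.ofReal (r * (f - b' * r)) ≤ P {ω | U ω ∈ S} →
      f ^ 2 / (8 * b' * D) * v ^ 2 ≤ ∫ u, bregman u v ∂(P.map U) := by
    intro S hS hSb hP
    have h1 : r * (f - b' * r) ≤ (P.map U).real S := by
      rw [Measure.real, Measure.map_apply hU hS]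
      refine (ENNReal.ofReal_le_iff_le_toReal (measure_ne_top _ _)).1 ?_
      exact hP
    have hint : Integrable (fun u => bregman u v) (P.map U) :=
      Integrable.of_bound (measurable_bregman v).aestronglyMeasurable |v| (ae_of_all _ fun u => by
        rw [Real.norm_eq_abs, abs_of_nonneg (bregman_nonneg u v)]; exact bregman_le u v)
    have h2 : ∫ u, S.indicator (fun _ => |v| / 2) u ∂(P.map U) ≤ ∫ u, bregman u v ∂(P.map U) := by
      refine integral_mono ((integrable_const _).indicator hS) hint fun u => ?_
      by_cases hu : u ∈ S
      · simp only [Set.indicator_of_mem hu]; exact hSb u hu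
      · simp only [Set.indicator_of_notMem hu]; exact bregman_nonneg u v
    rw [integral_indicator_const _ hS, smul_eq_mul] at h2
    refine le_trans ?_ h2
    have h3 := mul_le_mul_of_nonneg_right (hmass.trans h1) (by positivity : 0 ≤ |v| / 2)
    refine le_trans (le_of_eq ?_) h3
    rw [hr, ← sq_abs v]
    field_simp; ring
  rcases le_total 0 v with h0 | h0
  · refine key (Set.Ioc 0 r) measurableSet_Ioc (fun u hu => ?_) (h.right r hr0)
    rw [abs_of_nonneg h0] at *
    unfold bregman
    rw [if_neg (not_le.2 hu.1)]
    exact le_trans (by linarith [hu.2]) (le_max_left _ _)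
  · refine key (Set.Ioc (-r) 0) measurableSet_Ioc (fun u hu => ?_) (h.left r hr0)
    rw [abs_of_nonpos h0] at *
    unfold bregman
    rw [if_pos hu.2]
    exact le_trans (by linarith [hu.1]) (le_max_left _ _)

end Residual

/-! ### Maximal inequalities for weakly dependent panels -/

section Panel

open Matrix

/-- The columns congruent to `s` modulo `c`. -/
def colClass (T c s : ℕ) : Finset (Fin T) := {t | (t : ℕ) % c = s}

theorem card_colClass_le {T c s : ℕ} : (colClass T c s).card ≤ T / c + 1 := by
  have : (colClass T c s).card ≤ (Finset.range (T / c + 1)).card := by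
    refine Finset.card_le_card_of_injOn (fun t => (t : ℕ) / c) (fun t _ => ?_) ?_
    · simp only [Finset.coe_range, Set.mem_Iio]
      have := Nat.div_le_div_right (c := c) t.2.le
      omega
    · intro t ht t' ht' h
      simp only [colClass, Finset.coe_filter, Finset.mem_univ, true_and, Set.mem_ofPred_eq] at ht ht'
      have h1 := Nat.div_add_mod (t : ℕ) c
      have h2 := Nat.div_add_mod (t' : ℕ) c
      simp only at h
      rw [h, ht] at h1
      rw [ht'] at h2
      exact Fin.ext (h1.symm.trans h2)
  simpa using this

theorem sum_colClass {T c : ℕ} (hc : 0 < c) (g : Fin T → ℝ) :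
    ∑ s ∈ Finset.range c, ∑ t ∈ colClass T c s, g t = ∑ t, g t :=
  Finset.sum_fiberwise_of_maps_to (fun _ _ => Finset.mem_range.2 (Nat.mod_lt _ hc)) g

theorem sum_card_colClass {T c : ℕ} (hc : 0 < c) :
    ∑ s ∈ Finset.range c, (colClass T c s).card = T := by
  have := sum_colClass (T := T) hc fun _ => 1
  simp only [Finset.sum_const, nsmul_eq_mul, mul_one, Finset.card_univ, Fintype.card_fin] at this
  exact_mod_cast this

theorem colClass_separated {T c s : ℕ} {t t' : Fin T} (ht : t ∈ colClass T c s)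
    (ht' : t' ∈ colClass T c s) (h : t < t') : (t : ℕ) + c ≤ t' := by
  simp only [colClass, Finset.mem_filter, Finset.mem_univ, true_and] at ht ht'
  have h1 := Nat.div_add_mod (t : ℕ) c
  have h2 := Nat.div_add_mod (t' : ℕ) c
  have h3 : (t : ℕ) < t' := h
  have h4 : (t : ℕ) / c < t' / c := by
    by_contra hcon
    have := Nat.mul_le_mul_left c (not_lt.1 hcon)
    omega
  have h5 := Nat.mul_le_mul_left c (Nat.succ_le_of_lt h4)
  rw [Nat.mul_succ] at h5
  omega

/-- Nonnegative statistics of the column classes with small expectation under the product of the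
marginals have a small sum with high probability. -/
theorem measure_sum_ge_le {Ω : Type*} [MeasurableSpace Ω] {P : Measure Ω} [IsProbabilityMeasure P]
    {E : Type*} [MeasurableSpace E] {n T : ℕ}
    {Z : Fin n → Fin T → Ω → E} (hZ : ∀ i t, Measurable (Z i t))
    (hind : iIndepFun (fun i ω t => Z i t ω) P) {c : ℕ} (hc : 0 < c) {δ : ℝ} (hδ : 0 ≤ δ)
    (hmix : ∀ i, betaMixing P (Z i) c ≤ ENNReal.ofReal δ)
    {φ : Fin n × Fin T → E → ℝ} (hφ : ∀ z, Measurable (φ z))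
    {G : ℕ → (Fin n × Fin T → ℝ) → ℝ} (hG : ∀ s, Measurable (G s))
    (hdep : ∀ s x y, (∀ z ∈ Finset.univ ×ˢ colClass T c s, x z = y z) → G s x = G s y)
    {a y : ℝ} (ha0 : 0 ≤ a) (hy : 0 < y)
    (ha : ∀ s, (∫⋯∫⁻_(Finset.univ ×ˢ colClass T c s), (fun x => ENNReal.ofReal (G s x))
      ∂(fun z => P.map fun ω => φ z (Z z.1 z.2 ω))) 0 ≤ ENNReal.ofReal a)
    (hG0 : ∀ s x, 0 ≤ G s x) :
    P {ω | y ≤ ∑ s ∈ Finset.range c, G s fun z => φ z (Z z.1 z.2 ω)} ≤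
      ENNReal.ofReal (c * a / y + n * T * (2 * δ)) := by
  set U : Ω → Fin n × Fin T → ℝ := fun ω z => φ z (Z z.1 z.2 ω) with hU
  have hUm : Measurable U := measurable_pi_iff.2 fun z => (hφ z).comp (hZ _ _)
  -- Decoupling requires integrands bounded by one. Truncation is harmless: when the statistics sum
  -- to at least `y`, either one truncated term equals one, or none is truncated and the sum is at
  -- least one.
  set f : ℕ → (Fin n × Fin T → ℝ) → ℝ≥0∞ := fun s x => min (ENNReal.ofReal (G s x / y)) 1 with hf
  have hfm : ∀ s, Measurable (f s) := fun s =>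
    (((hG s).div_const y).ennreal_ofReal).min measurable_const
  have h1 : ∀ ω, {ω | y ≤ ∑ s ∈ Finset.range c, G s (U ω)}.indicator (1 : Ω → ℝ≥0∞) ω ≤
      ∑ s ∈ Finset.range c, f s (U ω) := by
    intro ω
    by_cases hω : y ≤ ∑ s ∈ Finset.range c, G s (U ω)
    · rw [Set.indicator_of_mem (by exact hω), Pi.one_apply]
      by_cases hs : ∃ s ∈ Finset.range c, 1 ≤ ENNReal.ofReal (G s (U ω) / y)
      · obtain ⟨s, hsc, hs⟩ := hs
        refine le_trans ?_ (Finset.single_le_sum (f := fun s => f s (U ω))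
          (fun _ _ => zero_le) hsc)
        simp only [hf, min_eq_right hs, le_refl]
      · push Not at hs
        have : ∑ s ∈ Finset.range c, f s (U ω) =
            ENNReal.ofReal (∑ s ∈ Finset.range c, G s (U ω) / y) := by
          rw [ENNReal.ofReal_sum_of_nonneg fun s _ => div_nonneg (hG0 s _) hy.le]
          exact Finset.sum_congr rfl fun s hsc => min_eq_left (hs s hsc).le
        rw [this, ← Finset.sum_div, ← ENNReal.ofReal_one]
        exact ENNReal.ofReal_le_ofReal ((one_le_div hy).2 hω)
    · rw [Set.indicator_of_notMem (by exact hω)]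
      exact zero_le
  have hEm : MeasurableSet {ω | y ≤ ∑ s ∈ Finset.range c, G s (U ω)} :=
    measurableSet_le measurable_const (Finset.measurable_sum _ fun s _ => (hG s).comp hUm)
  have h2 : ∀ s, ∫⁻ ω, f s (U ω) ∂P ≤ ENNReal.ofReal (a / y) +
      (n * (colClass T c s).card : ℕ) * ENNReal.ofReal (2 * δ) := by
    intro s
    have key := lintegral_le_lmarginal hZ hind hδ hmix hφ (Finset.univ ×ˢ colClass T c s)
      (fun z hz z' hz' _ hlt => colClass_separated (Finset.mem_product.1 hz).2
        (Finset.mem_product.1 hz').2 hlt) 0 (f s) (hfm s) fun x => min_le_right _ _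
    rw [Finset.card_product, Finset.card_univ, Fintype.card_fin] at key
    refine le_trans (le_of_eq (lintegral_congr fun ω => ?_)) (key.trans (add_le_add_left ?_ _))
    · simp only [hf]
      rw [hdep s (U ω) _ fun z hz => ?_]
      rw [Function.updateFinset, dif_pos hz]
    · calc _ ≤ (∫⋯∫⁻_(Finset.univ ×ˢ colClass T c s),
            (fun x => ENNReal.ofReal y⁻¹ * ENNReal.ofReal (G s x))
            ∂(fun z => P.map fun ω => φ z (Z z.1 z.2 ω))) 0 := by
            refine lmarginal_mono (fun x => ?_) 0
            refine (min_le_left _ _).trans_eq ?_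
            rw [← ENNReal.ofReal_mul (by positivity), div_eq_inv_mul]
        _ = ENNReal.ofReal y⁻¹ * (∫⋯∫⁻_(Finset.univ ×ˢ colClass T c s),
            (fun x => ENNReal.ofReal (G s x))
            ∂(fun z => P.map fun ω => φ z (Z z.1 z.2 ω))) 0 := by
            simp only [lmarginal]
            rw [lintegral_const_mul]
            exact ((hG s).comp measurable_updateFinset).ennreal_ofReal
        _ ≤ ENNReal.ofReal y⁻¹ * ENNReal.ofReal a := by gcongr; exact ha s
        _ = ENNReal.ofReal (a / y) := by
            rw [← ENNReal.ofReal_mul (by positivity), div_eq_inv_mul]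
  calc _ = ∫⁻ ω, {ω | y ≤ ∑ s ∈ Finset.range c, G s (U ω)}.indicator 1 ω ∂P :=
        (lintegral_indicator_one hEm).symm
    _ ≤ ∫⁻ ω, ∑ s ∈ Finset.range c, f s (U ω) ∂P := lintegral_mono h1
    _ = ∑ s ∈ Finset.range c, ∫⁻ ω, f s (U ω) ∂P :=
        lintegral_finsetSum _ fun s _ => (hfm s).comp hUm
    _ ≤ ∑ s ∈ Finset.range c, (ENNReal.ofReal (a / y) +
          (n * (colClass T c s).card : ℕ) * ENNReal.ofReal (2 * δ)) :=
        Finset.sum_le_sum fun s _ => h2 s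
    _ = ENNReal.ofReal (c * a / y + n * T * (2 * δ)) := by
        rw [Finset.sum_add_distrib, ← Finset.sum_mul, ← Nat.cast_sum, ← Finset.mul_sum,
          sum_card_colClass hc, Finset.sum_const, Finset.card_range, nsmul_eq_mul,
          ENNReal.ofReal_add (by positivity) (by positivity), mul_div_assoc,
          ENNReal.ofReal_mul (Nat.cast_nonneg c), ENNReal.ofReal_natCast,
          ENNReal.ofReal_mul (p := (n : ℝ) * T) (by positivity)]
        congr 2
        rw [← Nat.cast_mul, ENNReal.ofReal_natCast]

/-- The bilinear form splits over the classes, and Cauchy–Schwarz over the classes bounds the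
squared operator norm by the sum of the squares. -/
theorem opBound_of_colSub {n T c : ℕ} (hc : 0 < c) (x : Fin n × Fin T → ℝ) {N : ℕ → ℝ} {y : ℝ}
    (h : ∀ s, OpBound (colSub (colClass T c s) x) (N s))
    (hN : ∑ s ∈ Finset.range c, N s ^ 2 ≤ y) :
    OpBound (Matrix.of fun i t => x (i, t)) √y := by
  intro u v
  have e1 : u ⬝ᵥ ((Matrix.of fun i t => x (i, t)) *ᵥ v) = ∑ s ∈ Finset.range c,
      u ⬝ᵥ (colSub (colClass T c s) x *ᵥ fun t : colClass T c s => v t) := by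
    have : ∀ s, u ⬝ᵥ (colSub (colClass T c s) x *ᵥ fun t : colClass T c s => v t) =
        ∑ t ∈ colClass T c s, ∑ i, u i * (x (i, t) * v t) := by
      intro s
      rw [← Finset.sum_coe_sort, Finset.sum_comm]
      simp only [dotProduct, mulVec, colSub, of_apply, Finset.mul_sum]
    simp only [this]
    rw [sum_colClass hc, Finset.sum_comm]
    simp only [dotProduct, mulVec, of_apply, Finset.mul_sum]
  have e2 : v ⬝ᵥ v = ∑ s ∈ Finset.range c, (fun t : colClass T c s => v t) ⬝ᵥ
      fun t : colClass T c s => v t := by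
    have : ∀ s, ((fun t : colClass T c s => v t) ⬝ᵥ fun t : colClass T c s => v t) =
        ∑ t ∈ colClass T c s, v t * v t := by
      intro s
      rw [← Finset.sum_coe_sort]; rfl
    simp only [this]
    rw [sum_colClass hc]; rfl
  set V : ℕ → ℝ := fun s => (fun t : colClass T c s => v t) ⬝ᵥ fun t : colClass T c s => v t
    with hV
  have hV0 : ∀ s, 0 ≤ V s := fun s => Finset.sum_nonneg fun t _ => mul_self_nonneg _
  calc _ ≤ ∑ s ∈ Finset.range c, N s * (√(u ⬝ᵥ u) * √(V s)) := by
        rw [e1]; exact Finset.sum_le_sum fun s _ => h s u _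
    _ = √(u ⬝ᵥ u) * ∑ s ∈ Finset.range c, N s * √(V s) := by
        rw [Finset.mul_sum]; exact Finset.sum_congr rfl fun s _ => by ring
    _ ≤ √(u ⬝ᵥ u) * (√(∑ s ∈ Finset.range c, N s ^ 2) *
          √(∑ s ∈ Finset.range c, √(V s) ^ 2)) := by
        gcongr; exact Real.sum_mul_le_sqrt_mul_sqrt _ _ _
    _ ≤ √(u ⬝ᵥ u) * (√y * √(v ⬝ᵥ v)) := by
        rw [e2]
        simp only [Real.sq_sqrt (hV0 _)]
        gcongr
    _ = _ := by ring

/-- The operator norm of a weakly dependent panel of centred bounded variables. -/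
theorem measure_not_opBound_le {Ω : Type*} [MeasurableSpace Ω] {P : Measure Ω}
    [IsProbabilityMeasure P] {E : Type*} [MeasurableSpace E] {n T : ℕ}
    {Z : Fin n → Fin T → Ω → E} (hZ : ∀ i t, Measurable (Z i t))
    (hind : iIndepFun (fun i ω t => Z i t ω) P) {c : ℕ} (hc : 0 < c) {δ : ℝ} (hδ : 0 ≤ δ)
    (hmix : ∀ i, betaMixing P (Z i) c ≤ ENNReal.ofReal δ)
    {φ : Fin n × Fin T → E → ℝ} (hφ : ∀ z, Measurable (φ z))
    {w : ℝ → ℝ} (hw : Measurable w) (hb : ∀ x, |w x| ≤ 1)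
    (hcen : ∀ z, ∫ x, w x ∂(P.map fun ω => φ z (Z z.1 z.2 ω)) = 0)
    {m : ℝ} (hm : (T / c : ℕ) + 1 ≤ m) {y : ℝ} (hy : 0 < y) :
    P {ω | ¬ OpBound (Matrix.of fun i t => w (φ (i, t) (Z i t ω))) √y} ≤
      ENNReal.ofReal (c * (400 * (n + m)) / y + n * T * (2 * δ)) := by
  have hm0 : 0 ≤ m := le_trans (by positivity) hm
  have hprob : ∀ z : Fin n × Fin T, IsProbabilityMeasure (P.map fun ω => φ z (Z z.1 z.2 ω)) :=
    fun z => Measure.isProbabilityMeasure_map ((hφ z).comp (hZ _ _)).aemeasurable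
  refine le_trans (measure_mono ?_) (measure_sum_ge_le hZ hind hc hδ hmix hφ
    (G := fun s x => netNorm (colSub (colClass T c s) fun z => w (x z)) ^ 2)
    (fun s => Measurable.pow_const (measurable_netNorm fun i j =>
      hw.comp (measurable_pi_apply _)) 2) ?_ (a := 400 * (n + m)) (by positivity) hy ?_
    fun s x => sq_nonneg _)
  · intro ω hω
    by_contra hcon
    simp only [Set.mem_ofPred_eq, not_le] at hω hcon
    exact hω (opBound_of_colSub hc (fun z => w (φ z (Z z.1 z.2 ω)))
      (fun s => opBound_netNorm _) hcon.le)
  · intro s x y h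
    have : (colSub (colClass T c s) fun z => w (x z)) = colSub (colClass T c s) fun z => w (y z) := by
      ext i j
      simp only [colSub, of_apply]
      rw [h (i, j) (by simp)]
    simp only [this]
  · intro s
    refine (lmarginal_netNorm_sq_le _ (fun _ => hw) (fun _ => hb) hcen _ 0).trans ?_
    gcongr
    refine le_trans ?_ hm
    exact_mod_cast card_colClass_le

/-- Uniform deviations of a Lipschitz process over finitely many matrices. -/
theorem measure_process_finset_le {Ω : Type*} [MeasurableSpace Ω] {P : Measure Ω}
    [IsProbabilityMeasure P] {E : Type*} [MeasurableSpace E] {n T : ℕ}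
    {Z : Fin n → Fin T → Ω → E} (hZ : ∀ i t, Measurable (Z i t))
    (hind : iIndepFun (fun i ω t => Z i t ω) P) {c : ℕ} (hc : 0 < c) {δ : ℝ} (hδ : 0 ≤ δ)
    (hmix : ∀ i, betaMixing P (Z i) c ≤ ENNReal.ofReal δ)
    {φ : Fin n × Fin T → E → ℝ} (hφ : ∀ z, Measurable (φ z))
    {k : ℝ → ℝ → ℝ} (hk : ∀ v, Measurable fun u => k u v)
    (hL : ∀ u v v', |k u v - k u v'| ≤ |v - v'|) (hk0 : ∀ u, k u 0 = 0)
    {m : ℝ} (hm : (T / c : ℕ) + 1 ≤ m) {R : ℝ} {F : Finset (Matrix (Fin n) (Fin T) ℝ)}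
    (h0 : 0 ∈ F) (hR : ∀ D ∈ F, nuclearNorm D ≤ R) {y : ℝ} (hy : 0 < y) :
    P {ω | ∃ D ∈ F, y ≤ ∑ i, ∑ t,
      ((∫ u, k u (D i t) ∂(P.map fun ω => φ (i, t) (Z i t ω))) -
        k (φ (i, t) (Z i t ω)) (D i t))} ≤
      ENNReal.ofReal (c * (40 * R * √(n + m)) / y + n * T * (2 * δ)) := by
  have hm0 : 0 ≤ m := le_trans (by positivity) hm
  have hR0 : 0 ≤ R := (nuclearNorm_nonneg _).trans (hR 0 h0)
  have hprob : ∀ z : Fin n × Fin T, IsProbabilityMeasure (P.map fun ω => φ z (Z z.1 z.2 ω)) :=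
    fun z => Measure.isProbabilityMeasure_map ((hφ z).comp (hZ _ _)).aemeasurable
  set g : Matrix (Fin n) (Fin T) ℝ → (Fin n × Fin T → ℝ) → Fin n × Fin T → ℝ := fun D x z =>
    (∫ u, k u (D z.1 z.2) ∂(P.map fun ω => φ z (Z z.1 z.2 ω))) - k (x z) (D z.1 z.2) with hg
  refine le_trans (measure_mono ?_) (measure_sum_ge_le hZ hind hc hδ hmix hφ
    (G := fun s x => F.sup' ⟨0, h0⟩ fun D => ∑ z ∈ Finset.univ ×ˢ colClass T c s, g D x z)
    (fun s => measurable_sup'_fun _ fun D => Finset.measurable_sum _ fun z _ =>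
      measurable_const.sub ((hk _).comp (measurable_pi_apply z))) ?_
    (a := 40 * R * √(n + m)) (by positivity) hy ?_ ?_)
  · rintro ω ⟨D, hD, hω⟩
    refine le_trans hω ?_
    have : ∀ s ∈ Finset.range c, ∑ t ∈ colClass T c s, ∑ i,
        g D (fun z => φ z (Z z.1 z.2 ω)) (i, t) ≤
        F.sup' ⟨0, h0⟩ fun D => ∑ z ∈ Finset.univ ×ˢ colClass T c s,
          g D (fun z => φ z (Z z.1 z.2 ω)) z := by
      intro s _
      rw [Finset.sum_comm, ← Finset.sum_product]
      exact Finset.le_sup' (fun D => ∑ z ∈ Finset.univ ×ˢ colClass T c s,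
          g D (fun z => φ z (Z z.1 z.2 ω)) z) hD
    refine le_trans (le_of_eq ?_) (Finset.sum_le_sum this)
    rw [sum_colClass hc, Finset.sum_comm]
  · intro s x y h
    refine Finset.sup'_congr _ rfl fun D _ => Finset.sum_congr rfl fun z hz => ?_
    simp only [hg, h z hz]
  · intro s
    refine (lmarginal_process_le _ h0 hR hk hL hk0 _ 0).trans ?_
    gcongr
    refine le_trans ?_ hm
    exact_mod_cast card_colClass_le
  · intro s x
    refine le_trans (le_of_eq ?_) (Finset.le_sup' _ h0)
    simp [hg, hk0]

/-- Uniform deviations of a Lipschitz process over a nuclear norm ball. -/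
theorem measure_process_le {Ω : Type*} [MeasurableSpace Ω] {P : Measure Ω}
    [IsProbabilityMeasure P] {E : Type*} [MeasurableSpace E] {n T : ℕ}
    {Z : Fin n → Fin T → Ω → E} (hZ : ∀ i t, Measurable (Z i t))
    (hind : iIndepFun (fun i ω t => Z i t ω) P) {c : ℕ} (hc : 0 < c) {δ : ℝ} (hδ : 0 ≤ δ)
    (hmix : ∀ i, betaMixing P (Z i) c ≤ ENNReal.ofReal δ)
    {φ : Fin n × Fin T → E → ℝ} (hφ : ∀ z, Measurable (φ z))
    {k : ℝ → ℝ → ℝ} (hk : ∀ v, Measurable fun u => k u v)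
    (hL : ∀ u v v', |k u v - k u v'| ≤ |v - v'|) (hk0 : ∀ u, k u 0 = 0)
    {m : ℝ} (hm : (T / c : ℕ) + 1 ≤ m) {R : ℝ} (hR : 0 ≤ R) {y : ℝ} (hy : 0 < y) :
    P {ω | ∃ D : Matrix (Fin n) (Fin T) ℝ, nuclearNorm D ≤ R ∧ y < ∑ i, ∑ t,
      ((∫ u, k u (D i t) ∂(P.map fun ω => φ (i, t) (Z i t ω))) -
        k (φ (i, t) (Z i t ω)) (D i t))} ≤
      ENNReal.ofReal (c * (40 * R * √(n + m)) / y + n * T * (2 * δ)) := by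
  classical
  have hprob : ∀ z : Fin n × Fin T, IsProbabilityMeasure (P.map fun ω => φ z (Z z.1 z.2 ω)) :=
    fun z => Measure.isProbabilityMeasure_map ((hφ z).comp (hZ _ _)).aemeasurable
  set S : (Fin n → Fin T → ℝ) → Ω → ℝ := fun D ω => ∑ i, ∑ t,
      ((∫ u, k u (D i t) ∂(P.map fun ω => φ (i, t) (Z i t ω))) -
        k (φ (i, t) (Z i t ω)) (D i t)) with hS
  have hint : ∀ z v, Integrable (fun u => k u v) (P.map fun ω => φ z (Z z.1 z.2 ω)) :=
    fun z v => Integrable.of_bound (hk v).aestronglyMeasurable |v| (ae_of_all _ fun u => by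
      simpa [hk0] using hL u v 0)
  have hcontk : ∀ u, Continuous (k u) := fun u =>
    (LipschitzWith.of_dist_le_mul (K := 1) fun v v' => by
      simpa [Real.dist_eq] using hL u v v').continuous
  have hconti : ∀ z, Continuous fun v => ∫ u, k u v ∂(P.map fun ω => φ z (Z z.1 z.2 ω)) :=
    fun z => (LipschitzWith.of_dist_le_mul (K := 1) fun v v' => by
      rw [Real.dist_eq, Real.dist_eq, ← integral_sub (hint z v) (hint z v')]
      have := norm_integral_le_of_norm_le_const (f := fun u => k u v - k u v')
        (μ := P.map fun ω => φ z (Z z.1 z.2 ω)) (C := |v - v'|) (ae_of_all _ fun u => hL u v v')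
      simpa using this).continuous
  have hcont : ∀ ω, Continuous fun D => S D ω := fun ω => by
    refine continuous_finsetSum _ fun i _ => continuous_finsetSum _ fun t _ => ?_
    exact ((hconti (i, t)).comp (by fun_prop)).sub ((hcontk _).comp (by fun_prop))
  -- The deviation is continuous in `D` and the ball is separable, so a strict exceedance already
  -- occurs along a dense sequence; the finite-class bound holds for all its initial segments, and
  -- the events increase.
  let B := {D : Fin n → Fin T → ℝ // nuclearNorm (Matrix.of D) ≤ R}
  have hzero : nuclearNorm (Matrix.of (0 : Fin n → Fin T → ℝ)) ≤ R := by
    have : Matrix.of (0 : Fin n → Fin T → ℝ) = 0 := rfl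
    rw [this, nuclearNorm_zero]; exact hR
  have : Nonempty B := ⟨⟨0, hzero⟩⟩
  let q : ℕ → B := TopologicalSpace.denseSeq B
  let F : ℕ → Finset (Matrix (Fin n) (Fin T) ℝ) := fun N =>
    insert 0 ((Finset.range N).image fun j => Matrix.of (q j).1)
  have hsub : {ω | ∃ D : Matrix (Fin n) (Fin T) ℝ, nuclearNorm D ≤ R ∧ y < S D ω} ⊆
      ⋃ N, {ω | ∃ D ∈ F N, y ≤ S D ω} := by
    rintro ω ⟨D, hD, hω⟩
    have hopen : IsOpen {b : B | y < S b.1 ω} :=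
      isOpen_lt continuous_const ((hcont ω).comp continuous_subtype_val)
    obtain ⟨j, hj⟩ := (TopologicalSpace.denseRange_denseSeq B).exists_mem_open hopen
      ⟨⟨D, hD⟩, hω⟩
    refine Set.mem_iUnion.2 ⟨j + 1, Matrix.of (q j).1, ?_, le_of_lt hj⟩
    exact Finset.mem_insert_of_mem (Finset.mem_image_of_mem _ (Finset.self_mem_range_succ j))
  have hmono : Monotone fun N => {ω | ∃ D ∈ F N, y ≤ S D ω} := by
    rintro N N' hN ω ⟨D, hD, hω⟩
    exact ⟨D, Finset.insert_subset_insert _ (Finset.image_subset_image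
      (Finset.range_mono hN)) hD, hω⟩
  refine (measure_mono hsub).trans ?_
  rw [hmono.measure_iUnion]
  refine iSup_le fun N => measure_process_finset_le hZ hind hc hδ hmix hφ hk hL hk0 hm
    (Finset.mem_insert_self _ _) (fun D hD => ?_) hy
  rcases Finset.mem_insert.1 hD with rfl | hD
  · rwa [nuclearNorm_zero]
  · obtain ⟨j, -, rfl⟩ := Finset.mem_image.1 hD
    exact (q j).2

/-- If independent events all occur with probability at least `1/2`, then the number of those
that fail is bounded in probability. -/
theorem measure_card_fail_le {Ω : Type*} [MeasurableSpace Ω] {P : Measure Ω}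
    [IsProbabilityMeasure P] {E : Type*} [MeasurableSpace E] {n : ℕ} {g : Fin n → Ω → E}
    (hg : ∀ i, Measurable (g i)) (hind : iIndepFun g P) {S : Fin n → Set E}
    (hS : ∀ i, MeasurableSet (S i)) (hP : P {ω | ¬ ∀ i, g i ω ∈ S i} ≤ ENNReal.ofReal (1 / 2))
    [∀ i, DecidablePred (· ∈ S i)] {b : ℝ} (hb : 0 < b) :
    P {ω | b ≤ ((Finset.univ.filter fun i => g i ω ∉ S i).card : ℝ)} ≤ ENNReal.ofReal (1 / b) := by
  set q : Fin n → ℝ := fun i => P.real (g i ⁻¹' (S i)ᶜ) with hq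
  have hmI : MeasurableSet {ω | ∀ i, g i ω ∈ S i} := by
    rw [Set.ofPred_forall]
    exact MeasurableSet.iInter fun i => hg i (hS i)
  have h1 : ∏ i, (1 - q i) = P.real {ω | ∀ i, g i ω ∈ S i} := by
    have h := hind.measure_inter_preimage_eq_mul Finset.univ (sets := S) fun i _ => hS i
    have e : (⋂ i ∈ Finset.univ, g i ⁻¹' S i) = {ω | ∀ i, g i ω ∈ S i} := by
      ext ω; simp
    rw [e] at h
    rw [Measure.real, h, ENNReal.toReal_prod]
    refine Finset.prod_congr rfl fun i _ => ?_
    rw [hq]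
    simp only [Set.preimage_compl]
    rw [probReal_compl_eq_one_sub (hg i (hS i))]
    simp [Measure.real]
  have h2 : 1 / 2 ≤ P.real {ω | ∀ i, g i ω ∈ S i} := by
    have e : {ω | ¬ ∀ i, g i ω ∈ S i} = {ω | ∀ i, g i ω ∈ S i}ᶜ := rfl
    have := ENNReal.toReal_mono ENNReal.ofReal_ne_top hP
    rw [ENNReal.toReal_ofReal (by norm_num), e] at this
    have h3 := probReal_compl_eq_one_sub (μ := P) hmI
    rw [Measure.real] at h3
    linarith
  -- The product is at least `1/2 > exp (-1)`, so `∑ q i ≤ 1`: at most one failure is expected, and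
  -- Markov's inequality finishes.
  have h3 : ∏ i, (1 - q i) ≤ Real.exp (-∑ i, q i) := by
    rw [← Finset.sum_neg_distrib, Real.exp_sum]
    refine Finset.prod_le_prod (fun i _ => ?_) fun i _ => ?_
    · have : q i ≤ 1 := measureReal_le_one
      linarith
    · have := Real.add_one_le_exp (-q i); linarith
  have h4 : ∑ i, q i ≤ 1 := by
    by_contra hcon
    have : Real.exp (-∑ i, q i) < Real.exp (-1) := Real.exp_lt_exp.2 (by linarith)
    have h5 : Real.exp (-1) < 1 / 2 := by
      have := Real.exp_neg_one_lt_d9; linarith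
    linarith
  have h6 : ∫⁻ ω, ((Finset.univ.filter fun i => g i ω ∉ S i).card : ℝ≥0∞) ∂P ≤ 1 := by
    have e : ∀ ω, ((Finset.univ.filter fun i => g i ω ∉ S i).card : ℝ≥0∞) =
        ∑ i, (g i ⁻¹' (S i)ᶜ).indicator 1 ω := by
      intro ω
      rw [Finset.card_filter, Nat.cast_sum]
      refine Finset.sum_congr rfl fun i _ => ?_
      by_cases h : g i ω ∈ S i <;> simp [h]
    simp only [e]
    rw [lintegral_finsetSum _ fun i _ => measurable_one.indicator (hg i (hS i).compl)]
    simp only [lintegral_indicator_one (hg _ (hS _).compl)]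
    have : ∑ i, P (g i ⁻¹' (S i)ᶜ) = ENNReal.ofReal (∑ i, q i) := by
      rw [ENNReal.ofReal_sum_of_nonneg fun i _ => measureReal_nonneg]
      refine Finset.sum_congr rfl fun i _ => ?_
      rw [ofReal_measureReal]
    rw [this]
    exact ENNReal.ofReal_le_one.2 h4
  have hmeas : Measurable fun ω => ((Finset.univ.filter fun i => g i ω ∉ S i).card : ℝ≥0∞) := by
    have e : (fun ω => ((Finset.univ.filter fun i => g i ω ∉ S i).card : ℝ≥0∞)) =
        fun ω => ∑ i, (g i ⁻¹' (S i)ᶜ).indicator 1 ω := by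
      funext ω
      rw [Finset.card_filter, Nat.cast_sum]
      refine Finset.sum_congr rfl fun i _ => ?_
      by_cases h : g i ω ∈ S i <;> simp [h]
    rw [e]
    exact Finset.measurable_sum _ fun i _ => measurable_one.indicator (hg i (hS i).compl)
  have h7 := meas_ge_le_lintegral_div (μ := P) hmeas.aemeasurable (ε := ENNReal.ofReal b)
    (by simpa using hb) ENNReal.ofReal_ne_top
  refine le_trans (measure_mono fun ω hω => ?_) (h7.trans ?_)
  · simp only [Set.mem_ofPred_eq] at hω ⊢
    rw [← ENNReal.ofReal_natCast]
    exact ENNReal.ofReal_le_ofReal hω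
  · rw [one_div, ENNReal.ofReal_inv_of_pos hb, ENNReal.div_eq_inv_mul]
    exact mul_le_of_le_one_right' h6

end Panel

/-! ### Deterministic analysis of the estimator -/

section Deterministic

open Matrix

variable {n T p : ℕ}

theorem avgSupNorm_nonneg (x : Fin n → Fin T → Fin p → ℝ) : 0 ≤ avgSupNorm x :=
  mul_nonneg (by positivity) (Finset.sum_nonneg fun i _ => Finset.sum_nonneg fun t _ =>
    norm_nonneg _)

theorem abs_sum_mul_le (x θ : Fin p → ℝ) : |∑ j, x j * θ j| ≤ ‖x‖ * ∑ j, |θ j| := by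
  rw [Finset.mul_sum]
  refine (Finset.abs_sum_le_sum_abs _ _).trans (Finset.sum_le_sum fun j _ => ?_)
  rw [abs_mul]
  gcongr
  exact norm_le_pi_norm x j

/-- Strong penalization of the regression coefficients selects the zero vector. -/
theorem IsEstimate.coef_eq_zero {τ ν₁ ν₂ C : ℝ} (hτ0 : 0 < τ) (hτ1 : τ < 1)
    {y : Fin n → Fin T → ℝ} {x : Fin n → Fin T → Fin p → ℝ} {θ : Fin p → ℝ}
    {A : Matrix (Fin n) (Fin T) ℝ} (hE : IsEstimate τ ν₁ ν₂ C y x θ A)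
    (hσ : ∀ j, |sigmaHatSq x j - 1| ≤ 1 / 4) (hν : 2 * avgSupNorm x ≤ ν₁) : θ = 0 := by
  set a := avgSupNorm x with ha
  set S := ∑ j, |θ j| with hS
  have hS0 : 0 ≤ S := Finset.sum_nonneg fun j _ => abs_nonneg _
  have ha0 : 0 ≤ a := avgSupNorm_nonneg x
  have h1 := hE.minimal 0 A hE.feasible
  have h2 : empiricalRisk τ y x 0 A - empiricalRisk τ y x θ A ≤ a * S := by
    simp only [empiricalRisk, ha, avgSupNorm]
    rw [← mul_sub, mul_assoc, ← Finset.sum_sub_distrib, Finset.sum_mul]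
    refine mul_le_mul_of_nonneg_left (Finset.sum_le_sum fun i _ => ?_) (by positivity)
    rw [← Finset.sum_sub_distrib, Finset.sum_mul]
    refine Finset.sum_le_sum fun t _ => ?_
    refine (le_abs_self _).trans ((checkLoss_lipschitz hτ0 hτ1 _ _).trans ?_)
    refine le_trans (le_of_eq ?_) (abs_sum_mul_le _ _)
    congr 1
    simp
  -- From `σ̂_j² ≥ 3/4 ≥ (3/4)²`. The penalty then wins because `2 · (3/4) > 1`.
  have h3 : 3 / 4 * S ≤ weightedL1 x θ := by
    rw [hS, weightedL1, Finset.mul_sum]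
    refine Finset.sum_le_sum fun j _ => mul_le_mul_of_nonneg_right ?_ (abs_nonneg _)
    refine Real.le_sqrt_of_sq_le ?_
    have := abs_le.1 (hσ j)
    linarith
  have h4 : weightedL1 x (0 : Fin p → ℝ) = 0 := by simp [weightedL1]
  simp only [objective, h4] at h1
  have h5 : ν₁ * (3 / 4 * S) ≤ ν₁ * weightedL1 x θ :=
    mul_le_mul_of_nonneg_left h3 (by linarith)
  have h6 : 2 * a * S ≤ ν₁ * S := mul_le_mul_of_nonneg_right hν hS0
  have h7 : a * S ≤ 0 := by linarith
  -- If every covariate were zero, the empirical second moments would vanish, contrary to `hσ`.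
  rcases ha0.eq_or_lt with h0 | h0
  · funext j
    exfalso
    have : sigmaHatSq x j = 0 := by
      rw [ha, avgSupNorm] at h0
      rcases mul_eq_zero.1 h0.symm with h | h
      · rw [sigmaHatSq, h, zero_mul]
      · rw [Finset.sum_eq_zero_iff_of_nonneg fun i _ => Finset.sum_nonneg fun t _ =>
          norm_nonneg _] at h
        rw [sigmaHatSq, Finset.sum_eq_zero, mul_zero]
        intro i hi
        refine Finset.sum_eq_zero fun t ht => ?_
        have h8 := (Finset.sum_eq_zero_iff_of_nonneg fun t _ => norm_nonneg _).1 (h i hi) t ht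
        rw [norm_eq_zero.1 h8]; simp
    have h9 := hσ j
    rw [this] at h9
    norm_num at h9
  · have hS1 : S ≤ 0 := by
      by_contra hcon
      exact absurd (mul_pos h0 (not_le.1 hcon)) (not_lt.2 h7)
    funext j
    have := (Finset.sum_eq_zero_iff_of_nonneg fun j _ => abs_nonneg _).1
      (le_antisymm hS1 hS0) j (Finset.mem_univ j)
    simpa using this

/-- The matrix part of the estimator when the regression coefficients vanish. -/
theorem IsEstimate.sum_checkLoss_le {τ ν₁ ν₂ C : ℝ} (hN : 0 < (n : ℝ) * T)
    {y : Fin n → Fin T → ℝ} {x : Fin n → Fin T → Fin p → ℝ}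
    {A : Matrix (Fin n) (Fin T) ℝ} (hE : IsEstimate τ ν₁ ν₂ C y x 0 A)
    {A' : Matrix (Fin n) (Fin T) ℝ} (hA' : maxNorm A' ≤ C) :
    ∑ i, ∑ t, checkLoss τ (y i t - A i t) + n * T * ν₂ * nuclearNorm A ≤
      ∑ i, ∑ t, checkLoss τ (y i t - A' i t) + n * T * ν₂ * nuclearNorm A' := by
  have h := hE.minimal 0 A' hA'
  simp only [objective, empiricalRisk, Pi.zero_apply, mul_zero, Finset.sum_const_zero,
    sub_zero] at h
  have h2 := mul_le_mul_of_nonneg_left h hN.le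
  have e : (n : ℝ) * T * (1 / ((n : ℝ) * T)) = 1 := mul_one_div_cancel hN.ne'
  simp only [mul_add, ← mul_assoc, e, one_mul] at h2
  linarith

theorem abs_le_maxNorm (A : Matrix (Fin n) (Fin T) ℝ) (i : Fin n) (t : Fin T) :
    |A i t| ≤ maxNorm A := by
  have h1 := norm_le_pi_norm (fun i t => A i t : Fin n → Fin T → ℝ) i
  have h2 := norm_le_pi_norm (fun t => A i t : Fin T → ℝ) t
  exact h2.trans h1

theorem maxNorm_le {A : Matrix (Fin n) (Fin T) ℝ} {C : ℝ} (hC : 0 ≤ C)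
    (h : ∀ i t, |A i t| ≤ C) : maxNorm A ≤ C :=
  (pi_norm_le_iff_of_nonneg hC).2 fun i => (pi_norm_le_iff_of_nonneg hC).2 fun t => h i t

theorem sum_bregman_sub_frobInner (τ : ℝ) (U D : Matrix (Fin n) (Fin T) ℝ) :
    ∑ i, ∑ t, (checkLoss τ (U i t - D i t) - checkLoss τ (U i t)) =
      ∑ i, ∑ t, bregman (U i t) (D i t) -
        frobInner (Matrix.of fun i t => τ - if U i t ≤ 0 then 1 else 0) D := by
  simp only [frobInner, ← Finset.sum_sub_distrib, checkLoss_sub, of_apply]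

/-- If the signal vanishes, then so does the estimator. -/
theorem eq_zero_of_minimal {τ w v : ℝ} {U A : Matrix (Fin n) (Fin T) ℝ}
    (hW : OpBound (Matrix.of fun i t => τ - if U i t ≤ 0 then 1 else 0) w) (hw : w < v)
    (hmin : ∑ i, ∑ t, checkLoss τ (U i t - A i t) + v * nuclearNorm A ≤
      ∑ i, ∑ t, checkLoss τ (U i t)) : A = 0 := by
  have h1 := sum_bregman_sub_frobInner τ U A
  simp only [Finset.sum_sub_distrib] at h1
  have h2 : 0 ≤ ∑ i, ∑ t, bregman (U i t) (A i t) :=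
    Finset.sum_nonneg fun i _ => Finset.sum_nonneg fun t _ => bregman_nonneg _ _
  have h3 := hW.frobInner_le (A := A)
  refine eq_zero_of_nuclearNorm_le ?_
  by_contra hcon
  have := mul_lt_mul_of_pos_right hw (not_le.1 hcon)
  linarith

theorem maskRows_apply (G : Finset (Fin n)) (M : Matrix (Fin n) (Fin T) ℝ) (i : Fin n)
    (t : Fin T) : ((diagonal fun i => if i ∈ G then (1 : ℝ) else 0) * M) i t =
      if i ∈ G then M i t else 0 := by
  rw [diagonal_mul]; split_ifs <;> simp

/-- Convexity of the penalized check loss. -/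
theorem penalized_segment_le {τ v : ℝ} (hv : 0 ≤ v) {Y A B : Matrix (Fin n) (Fin T) ℝ}
    (hAB : ∑ i, ∑ t, checkLoss τ (Y i t - A i t) + v * nuclearNorm A ≤
      ∑ i, ∑ t, checkLoss τ (Y i t - B i t) + v * nuclearNorm B)
    {l : ℝ} (hl0 : 0 ≤ l) (hl1 : l ≤ 1) :
    ∑ i, ∑ t, checkLoss τ (Y i t - (B + l • (A - B)) i t) + v * nuclearNorm (B + l • (A - B)) ≤
      ∑ i, ∑ t, checkLoss τ (Y i t - B i t) + v * nuclearNorm B := by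
  have h2 : nuclearNorm (B + l • (A - B)) ≤ (1 - l) * nuclearNorm B + l * nuclearNorm A := by
    have e1 : B + l • (A - B) = (1 - l) • B + l • A := by module
    rw [e1]
    exact (nuclearNorm_add_le _ _).trans
      (add_le_add (nuclearNorm_smul_le (sub_nonneg.2 hl1) _) (nuclearNorm_smul_le hl0 _))
  have h3 : ∑ i, ∑ t, checkLoss τ (Y i t - (B + l • (A - B)) i t) ≤
      (1 - l) * ∑ i, ∑ t, checkLoss τ (Y i t - B i t) +
        l * ∑ i, ∑ t, checkLoss τ (Y i t - A i t) := by
    simp only [Finset.mul_sum, ← Finset.sum_add_distrib]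
    refine Finset.sum_le_sum fun i _ => Finset.sum_le_sum fun t _ => ?_
    refine le_trans (le_of_eq ?_) (checkLoss_convex τ hl0 hl1 _ _)
    congr 1
    simp only [Matrix.add_apply, Matrix.smul_apply, Matrix.sub_apply, smul_eq_mul]
    ring
  have h4 := mul_le_mul_of_nonneg_left h2 hv
  have h5 := mul_le_mul_of_nonneg_left hAB hl0
  linarith

/-- The loss difference is hardly affected by setting a few rows of the signal to zero. -/
theorem sum_checkLoss_mask_le {τ C b : ℝ} (hτ0 : 0 < τ) (hτ1 : τ < 1) (hC : 0 ≤ C)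
    (U M D : Matrix (Fin n) (Fin T) ℝ) (G : Finset (Fin n)) (hb : ((Gᶜ).card : ℝ) ≤ b)
    (hD : ∀ i t, |D i t| ≤ 2 * C) {M' : Matrix (Fin n) (Fin T) ℝ}
    (hM' : ∀ i ∈ G, ∀ t, M' i t = M i t) :
    ∑ i, ∑ t, (checkLoss τ (U i t - D i t) - checkLoss τ (U i t)) ≤
      ∑ i, ∑ t, (checkLoss τ (U i t + M i t - (M' + D) i t) -
        checkLoss τ (U i t + M i t - M' i t)) + 4 * C * T * b := by
  have h1 : ∀ i, ∑ t, (checkLoss τ (U i t - D i t) - checkLoss τ (U i t)) ≤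
      ∑ t, (checkLoss τ (U i t + M i t - (M' + D) i t) -
      checkLoss τ (U i t + M i t - M' i t)) + if i ∈ Gᶜ then 4 * C * T else 0 := by
    intro i
    by_cases hi : i ∈ G
    · rw [if_neg (by simpa using hi), add_zero]
      refine le_of_eq (Finset.sum_congr rfl fun t _ => ?_)
      simp only [Matrix.add_apply, hM' i hi t]
      congr 2 <;> ring
    · rw [if_pos (by simpa using hi)]
      have e2 : 4 * C * (T : ℝ) = ∑ _t : Fin T, 4 * C := by simp; ring
      rw [e2, ← Finset.sum_add_distrib]
      refine Finset.sum_le_sum fun t _ => ?_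
      -- On a masked row each of the two increments is at most `2C` in absolute value, hence `4C`
      -- per entry.
      have h2 := abs_le.1 ((checkLoss_lipschitz hτ0 hτ1 (U i t - D i t) (U i t)).trans
        (show |U i t - D i t - U i t| ≤ 2 * C by
          rw [sub_sub_cancel_left, abs_neg]; exact hD i t))
      have h3 := abs_le.1 ((checkLoss_lipschitz hτ0 hτ1 (U i t + M i t - (M' + D) i t)
        (U i t + M i t - M' i t)).trans
        (show |U i t + M i t - (M' + D) i t - (U i t + M i t - M' i t)| ≤ 2 * C by
          rw [sub_sub_sub_cancel_left, Matrix.add_apply, sub_add_cancel_left, abs_neg]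
          exact hD i t))
      linarith [h2.2, h3.1]
  refine (Finset.sum_le_sum fun i _ => h1 i).trans ?_
  rw [Finset.sum_add_distrib, Finset.sum_ite_mem, Finset.univ_inter, Finset.sum_const,
    nsmul_eq_mul]
  have : ((Gᶜ).card : ℝ) * (4 * C * T) ≤ b * (4 * C * T) := by gcongr
  linarith

/-- A descent direction of the penalized loss at a matrix that is nearly of low rank lies in a
nuclear norm ball, and its Bregman divergence is small. -/
theorem descent_bounds {τ w v C e b k H : ℝ} (hτ0 : 0 < τ) (hτ1 : τ < 1)
    {U M ξ D : Matrix (Fin n) (Fin T) ℝ} (G : Finset (Fin n))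
    (hW : OpBound (Matrix.of fun i t => τ - if U i t ≤ 0 then 1 else 0) w)
    (hw : 0 < w) (hv : 2 * w ≤ v) (hC : 0 ≤ C)
    (hb : ((Gᶜ).card : ℝ) ≤ b) (hk : ((M + ξ).rank : ℝ) ≤ k) (he : nuclearNorm ξ ≤ e)
    (hH : 0 ≤ H) (hDD : frobInner D D = H ^ 2) (hDC : ∀ i t, |D i t| ≤ 2 * C)
    {M' : Matrix (Fin n) (Fin T) ℝ}
    (hM' : M' = (diagonal fun i => if i ∈ G then (1 : ℝ) else 0) * M)
    (hdesc : ∑ i, ∑ t, checkLoss τ (U i t + M i t - (M' + D) i t) + v * nuclearNorm (M' + D) ≤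
      ∑ i, ∑ t, checkLoss τ (U i t + M i t - M' i t) + v * nuclearNorm M') :
    nuclearNorm D ≤ 8 * √k * H + 4 * e + 4 * C * T * b / w ∧
      ∑ i, ∑ t, bregman (U i t) (D i t) ≤
        v / 2 * (8 * √k * H + 4 * e + 4 * C * T * b / w) := by
  have hb0 : 0 ≤ b := le_trans (Nat.cast_nonneg _) hb
  have he0 : 0 ≤ e := (nuclearNorm_nonneg _).trans he
  have hv0 : 0 < v := by linarith
  have hloss := sum_checkLoss_mask_le hτ0 hτ1 hC U M D G hb hDC (M' := M') fun i hi t => by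
    rw [hM', maskRows_apply, if_pos hi]
  set Q : Matrix (Fin n) (Fin n) ℝ := diagonal fun i => if i ∈ G then 1 else 0 with hQ
  -- The cone inequality is used at `M' = Q (M + ξ) - Q ξ`; masking increases neither the rank nor
  -- the nuclear norm of `ξ`.
  obtain ⟨N₁, N₂, hN₁, hN₂, hD1, hD2, hD3⟩ := nuclearNorm_cone (Q * (M + ξ)) (Q * ξ) D
  have eB : Q * (M + ξ) - Q * ξ = M' := by rw [Matrix.mul_add, add_sub_cancel_right, hM']
  rw [eB] at hD2
  rw [hDD, Real.sqrt_sq hH] at hD3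
  have hrk : (Q * (M + ξ)).rank ≤ (M + ξ).rank := Matrix.rank_mul_le_right _ _
  have hrank : √((Q * (M + ξ)).rank : ℝ) ≤ √k := Real.sqrt_le_sqrt ((Nat.cast_le.2 hrk).trans hk)
  have hξ : nuclearNorm (Q * ξ) ≤ e := (nuclearNorm_mask_le G ξ).trans he
  have hN₁' : N₁ ≤ 2 * √k * H := hD3.trans (by gcongr)
  rw [sum_bregman_sub_frobInner] at hloss
  simp only [Finset.sum_sub_distrib] at hloss
  have hWD := hW.frobInner_le (A := D)
  have hvD := mul_le_mul_of_nonneg_left hD2 hv0.le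
  have hbreg : 0 ≤ ∑ i, ∑ t, bregman (U i t) (D i t) :=
    Finset.sum_nonneg fun i _ => Finset.sum_nonneg fun t _ => bregman_nonneg _ _
  have hw1 : w * nuclearNorm D ≤ v / 2 * (N₁ + N₂) :=
    mul_le_mul (by linarith) hD1 (nuclearNorm_nonneg D) (by linarith)
  have hve : v * nuclearNorm (Q * ξ) ≤ v * e := mul_le_mul_of_nonneg_left hξ hv0.le
  have h0 : 0 ≤ 4 * C * T * b := by positivity
  obtain ⟨q₀, hq₀⟩ : ∃ q₀, q₀ = 4 * C * T * b := ⟨_, rfl⟩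
  rw [← hq₀] at h0 hloss ⊢
  obtain ⟨q, hq⟩ : ∃ q, q = q₀ / w := ⟨_, rfl⟩
  rw [← hq]
  have hq0 : 0 ≤ q := by rw [hq]; exact div_nonneg h0 hw.le
  have hvb : q₀ ≤ v / 2 * q := by
    rw [hq, mul_div_assoc', le_div_iff₀ hw, mul_comm]
    exact mul_le_mul_of_nonneg_right (by linarith) h0
  -- The score contributes `v/2 (N₁ + N₂)`, the penalty `v (N₁ - N₂ + 2e)` and the masked rows at
  -- most `v/2 q`. Since the left side is nonnegative, `N₂ ≤ 3 N₁ + 4e + q`, so the nuclear norm of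
  -- `D` is at most `4 N₁ + 4e + q`.
  have hb1 : ∑ i, ∑ t, bregman (U i t) (D i t) ≤ v / 2 * (3 * N₁ - N₂ + 4 * e + q) := by
    linarith
  have hpos : 0 ≤ 3 * N₁ - N₂ + 4 * e + q := by
    by_contra hneg
    have := mul_neg_of_pos_of_neg (half_pos hv0) (not_le.1 hneg)
    linarith
  refine ⟨by linarith, hb1.trans (mul_le_mul_of_nonneg_left ?_ (by linarith))⟩
  linarith

/-- On the masked rows `(a - m)² ≤ 2a² + 2m²` is used, and these rows have at most `b T` entries. -/
theorem frobeniusNorm_sub_sq_le_of_mask {b C₁ H : ℝ} {A M : Matrix (Fin n) (Fin T) ℝ}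
    (G : Finset (Fin n)) (hb : ((Gᶜ).card : ℝ) ≤ b) (hM : ∀ i t, |M i t| ≤ C₁)
    {M' : Matrix (Fin n) (Fin T) ℝ}
    (hM' : M' = (diagonal fun i => if i ∈ G then (1 : ℝ) else 0) * M)
    (hle : frobInner (A - M') (A - M') ≤ H ^ 2) :
    frobeniusNorm (A - M) ^ 2 ≤ 2 * H ^ 2 + 2 * (b * T * C₁ ^ 2) := by
  have eM' : ∀ i t, M' i t = if i ∈ G then M i t else 0 := fun i t => by
    rw [hM', maskRows_apply]
  have hentry : ∀ i, ∑ t, (A - M) i t ^ 2 ≤ 2 * ∑ t, (A - M') i t ^ 2 +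
      if i ∈ Gᶜ then 2 * (T * C₁ ^ 2) else 0 := by
    intro i
    by_cases hi : i ∈ G
    · rw [if_neg (by simpa using hi), add_zero]
      have : ∑ t, (A - M') i t ^ 2 = ∑ t, (A - M) i t ^ 2 :=
        Finset.sum_congr rfl fun t _ => by simp only [Matrix.sub_apply, eM', if_pos hi]
      rw [this]
      have : 0 ≤ ∑ t, (A - M) i t ^ 2 := Finset.sum_nonneg fun t _ => sq_nonneg _
      linarith
    · rw [if_pos (by simpa using hi)]
      have e2 : 2 * ((T : ℝ) * C₁ ^ 2) = ∑ _t : Fin T, 2 * C₁ ^ 2 := by simp; ring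
      rw [e2, Finset.mul_sum, ← Finset.sum_add_distrib]
      refine Finset.sum_le_sum fun t _ => ?_
      simp only [Matrix.sub_apply, eM', if_neg hi]
      have h1 : M i t ^ 2 ≤ C₁ ^ 2 := sq_le_sq.2 ((hM i t).trans (le_abs_self _))
      nlinarith [sq_nonneg (A i t + M i t)]
  rw [frobeniusNorm_sq]
  have e1 : ∀ B : Matrix (Fin n) (Fin T) ℝ, frobInner B B = ∑ i, ∑ t, B i t ^ 2 := fun B => by
    simp only [frobInner, sq]
  rw [e1] at hle ⊢
  refine (Finset.sum_le_sum fun i _ => hentry i).trans ?_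
  rw [Finset.sum_add_distrib, ← Finset.mul_sum, Finset.sum_ite_mem, Finset.univ_inter,
    Finset.sum_const, nsmul_eq_mul]
  have : ((Gᶜ).card : ℝ) * (2 * (T * C₁ ^ 2)) ≤ b * (2 * (T * C₁ ^ 2)) := by gcongr
  linarith

/-- The estimation error of the penalized matrix quantile regression. -/
theorem frobeniusNorm_sub_sq_le {τ w v v₁ C e b H R z γ C₁ k : ℝ} (hτ0 : 0 < τ) (hτ1 : τ < 1)
    {U A M ξ : Matrix (Fin n) (Fin T) ℝ} (G : Finset (Fin n))
    (hW : OpBound (Matrix.of fun i t => τ - if U i t ≤ 0 then 1 else 0) w)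
    (hw : 0 < w) (hv : 2 * w ≤ v) (hv₁ : v ≤ v₁) (hC : 0 ≤ C) (hA : maxNorm A ≤ C)
    (hmin : ∀ A' : Matrix (Fin n) (Fin T) ℝ, maxNorm A' ≤ C →
      ∑ i, ∑ t, checkLoss τ ((U + M) i t - A i t) + v * nuclearNorm A ≤
        ∑ i, ∑ t, checkLoss τ ((U + M) i t - A' i t) + v * nuclearNorm A')
    (hG : ∀ i ∈ G, ∀ t, |M i t| ≤ C) (hb : ((Gᶜ).card : ℝ) ≤ b)
    (hM : ∀ i t, |M i t| ≤ C₁) (hk : ((M + ξ).rank : ℝ) ≤ k) (he : nuclearNorm ξ ≤ e)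
    (hH : 0 ≤ H) (hR : 8 * √k * H + 4 * e + 4 * C * T * b / w ≤ R)
    (hproc : ∀ D : Matrix (Fin n) (Fin T) ℝ, nuclearNorm D ≤ R → (∀ i t, |D i t| ≤ 2 * C) →
      γ * frobInner D D ≤ ∑ i, ∑ t, bregman (U i t) (D i t) + z)
    (hcon : v₁ / 2 * R + z < γ * H ^ 2) :
    frobeniusNorm (A - M) ^ 2 ≤ 2 * H ^ 2 + 2 * (b * T * C₁ ^ 2) := by
  obtain ⟨M', hM'⟩ : ∃ M', M' = (diagonal fun i => if i ∈ G then (1 : ℝ) else 0) * M := ⟨_, rfl⟩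
  have hM'C : ∀ i t, |M' i t| ≤ C := fun i t => by
    rw [hM', maskRows_apply]; split_ifs with h
    · exact hG i h t
    · simpa using hC
  have hv0 : 0 < v := by linarith
  refine frobeniusNorm_sub_sq_le_of_mask G hb hM hM' ?_
  -- By convexity the point of the segment from `M'` to `A` at Frobenius distance exactly `H` is
  -- still no worse than `M'`; there `hcon` says that curvature exceeds penalty and noise.
  by_contra hlt
  have hlt := not_le.1 hlt
  have hpos : 0 < frobInner (A - M') (A - M') := lt_of_le_of_lt (sq_nonneg H) hlt
  set l := H / √(frobInner (A - M') (A - M')) with hl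
  have hl0 : 0 ≤ l := by positivity
  have hl1 : l ≤ 1 := by
    rw [hl, div_le_one (Real.sqrt_pos.2 hpos)]
    exact Real.le_sqrt_of_sq_le hlt.le
  have hDD : frobInner (l • (A - M')) (l • (A - M')) = H ^ 2 := by
    rw [frobInner_smul_right, frobInner_comm, frobInner_smul_right, ← mul_assoc, ← sq, hl,
      div_pow, Real.sq_sqrt hpos.le, div_mul_cancel₀ _ hpos.ne']
  have hDC : ∀ i t, |(l • (A - M')) i t| ≤ 2 * C := fun i t => by
    have h1 := (abs_le_maxNorm A i t).trans hA
    have h2 := hM'C i t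
    have h3 : |A i t - M' i t| ≤ 2 * C := (abs_sub _ _).trans (by linarith)
    have h4 : (l • (A - M')) i t = l * (A i t - M' i t) := rfl
    rw [h4, abs_mul, abs_of_nonneg hl0]
    exact (mul_le_of_le_one_left (abs_nonneg _) hl1).trans h3
  obtain ⟨h1, h2⟩ := descent_bounds hτ0 hτ1 G hW hw hv hC hb hk he hH hDD hDC hM'
    (penalized_segment_le hv0.le (hmin M' (maxNorm_le hC hM'C)) hl0 hl1)
  have h3 := hproc _ (h1.trans hR) hDC
  rw [hDD] at h3
  have hR0 : 0 ≤ R := (nuclearNorm_nonneg _).trans (h1.trans hR)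
  have h4 : v / 2 * (8 * √k * H + 4 * e + 4 * C * T * b / w) ≤ v₁ / 2 * R :=
    (mul_le_mul_of_nonneg_left hR (by linarith)).trans
      (mul_le_mul_of_nonneg_right (by linarith) hR0)
  linarith

end Deterministic

/-! ### A panel with fixed dimensions -/

section FixedPanel

open Matrix

variable {Ω : Type*} [MeasurableSpace Ω] {n T p : ℕ}

/-- The residuals `Y_{it} - X_{it}' θ - Π_{it}`. -/
noncomputable def residual (X : Fin n → Fin T → Ω → Fin p → ℝ) (Y : Fin n → Fin T → Ω → ℝ)
    (θ : Fin p → ℝ) (Pi : Matrix (Fin n) (Fin T) ℝ) (ω : Ω) : Matrix (Fin n) (Fin T) ℝ :=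
  Matrix.of fun i t => Y i t ω - ((∑ j, X i t ω j * θ j) + Pi i t)

/-- A panel that is independent across rows, with `β`-mixing coefficient at lag `c` at most `δ`,
whose residuals have `τ`-quantile zero and densities bounded below near zero. -/
structure PanelLaw (P : Measure Ω) (X : Fin n → Fin T → Ω → Fin p → ℝ) (Y : Fin n → Fin T → Ω → ℝ)
    (τ : ℝ) (θ : Fin p → ℝ) (Pi : Matrix (Fin n) (Fin T) ℝ) (f b' δ : ℝ) (c : ℕ) : Prop where
  measurable_X : ∀ i t, Measurable (X i t)
  measurable_Y : ∀ i t, Measurable (Y i t)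
  tau_pos : 0 < τ
  tau_lt : τ < 1
  indep : iIndepFun (fun (i : Fin n) (ω : Ω) (t : Fin T) => (Y i t ω, X i t ω)) P
  lag_pos : 0 < c
  delta_nonneg : 0 ≤ δ
  mixing : ∀ i : Fin n, betaMixing P (fun t ω => (Y i t ω, X i t ω)) c ≤ ENNReal.ofReal δ
  bounds : ∀ i t, ResidualBounds P (fun ω => residual X Y θ Pi ω i t) τ f b'
  low_pos : 0 < f
  sq_le : f ^ 2 / 2 ≤ b'

variable {P : Measure Ω} {X : Fin n → Fin T → Ω → Fin p → ℝ}
  {Y : Fin n → Fin T → Ω → ℝ} {τ : ℝ} {θ : Fin p → ℝ} {Pi : Matrix (Fin n) (Fin T) ℝ}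
  {f b' δ : ℝ} {c d : ℕ}

theorem measurable_residual_fun (θ : Fin p → ℝ) (Pi : Matrix (Fin n) (Fin T) ℝ)
    (z : Fin n × Fin T) :
    Measurable fun e : ℝ × (Fin p → ℝ) => e.1 - ((∑ j, e.2 j * θ j) + Pi z.1 z.2) := by
  fun_prop

theorem PanelLaw.measurable_residual (h : PanelLaw P X Y τ θ Pi f b' δ c) (i : Fin n)
    (t : Fin T) : Measurable fun ω => residual X Y θ Pi ω i t :=
  (measurable_residual_fun θ Pi (i, t)).comp ((h.measurable_Y i t).prodMk (h.measurable_X i t))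

theorem measurable_sign (τ : ℝ) : Measurable fun u : ℝ => τ - if u ≤ 0 then 1 else 0 :=
  measurable_const.sub (Measurable.ite measurableSet_Iic measurable_const measurable_const)

/-- The second moments of the `c` classes add up to at most `400 c (n + 4d)`, which is at most `1600
/ c` times the squared level. The level thus exceeds the typical size by a factor `√c`, and this
makes the probability vanish as the blocks grow. -/
theorem PanelLaw.measure_not_opBound_le [IsProbabilityMeasure P] (h : PanelLaw P X Y τ θ Pi f b' δ c) (hd : 1 ≤ d)
    (hn : 1 ≤ n) (hm : T / c + 1 ≤ 4 * d) :
    P {ω | ¬ OpBound (Matrix.of fun i t => τ - if residual X Y θ Pi ω i t ≤ 0 then 1 else 0)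
      (c * (√(n : ℝ) + √(d : ℝ)))} ≤ ENNReal.ofReal (1600 / c + n * T * (2 * δ)) := by
  have hc : (0 : ℝ) < c := Nat.cast_pos.2 h.lag_pos
  have hn0 : (0 : ℝ) < n := Nat.cast_pos.2 hn
  have hd0 : (0 : ℝ) < d := Nat.cast_pos.2 hd
  have hy : 0 < (c * (√(n : ℝ) + √(d : ℝ))) ^ 2 := by positivity
  have key := PanelQR.measure_not_opBound_le (Z := fun i t ω => (Y i t ω, X i t ω)) (P := P)
    (fun i t => (h.measurable_Y i t).prodMk (h.measurable_X i t)) h.indep h.lag_pos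
    h.delta_nonneg h.mixing (φ := fun z e => e.1 - ((∑ j, e.2 j * θ j) + Pi z.1 z.2))
    (measurable_residual_fun θ Pi) (measurable_sign τ)
    (fun x => by
      have h0 := h.tau_pos
      have h1 := h.tau_lt
      split_ifs <;> exact abs_le.2 ⟨by linarith, by linarith⟩)
    (fun z => (h.bounds z.1 z.2).integral_sign (h.measurable_residual z.1 z.2) h.tau_pos)
    (m := 4 * d) (by exact_mod_cast hm) hy
  rw [Real.sqrt_sq (by positivity)] at key
  refine key.trans (ENNReal.ofReal_le_ofReal (add_le_add_left ?_ _))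
  rw [div_le_div_iff₀ hy hc]
  have e1 : (n : ℝ) + d ≤ (√(n : ℝ) + √(d : ℝ)) ^ 2 := by
    have h1 := Real.sq_sqrt hn0.le
    have h2 := Real.sq_sqrt hd0.le
    nlinarith [mul_nonneg (Real.sqrt_nonneg (n : ℝ)) (Real.sqrt_nonneg (d : ℝ))]
  have h3 : c ^ 2 * ((n : ℝ) + d) ≤ c ^ 2 * (√(n : ℝ) + √(d : ℝ)) ^ 2 := by gcongr
  rw [mul_pow]
  nlinarith [mul_nonneg (sq_nonneg (c : ℝ)) hn0.le]

/-- The expected suprema over the `c` classes total `c · 40 R √(n + 4d)`; dividing by `ε` is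
Markov's inequality at probability `ε`. -/
theorem PanelLaw.measure_process_le [IsProbabilityMeasure P] (h : PanelLaw P X Y τ θ Pi f b' δ c) (hd : 1 ≤ d)
    (hm : T / c + 1 ≤ 4 * d) {R ε D : ℝ} (hR : 0 < R) (hε : 0 < ε) (hD : 2 / f ≤ D) :
    P {ω | ¬ ∀ A : Matrix (Fin n) (Fin T) ℝ, nuclearNorm A ≤ R → (∀ i t, |A i t| ≤ D) →
      f ^ 2 / (8 * b' * D) * frobInner A A ≤
        ∑ i, ∑ t, bregman (residual X Y θ Pi ω i t) (A i t) +
          c * (40 * R * √((n : ℝ) + 4 * d)) / ε} ≤ ENNReal.ofReal (ε + n * T * (2 * δ)) := by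
  have hc : (0 : ℝ) < c := Nat.cast_pos.2 h.lag_pos
  have hd0 : (0 : ℝ) < d := Nat.cast_pos.2 hd
  have hs : 0 < √((n : ℝ) + 4 * d) := Real.sqrt_pos.2 (by positivity)
  have hy : 0 < c * (40 * R * √((n : ℝ) + 4 * d)) / ε := by positivity
  have key := PanelQR.measure_process_le (Z := fun i t ω => (Y i t ω, X i t ω)) (P := P)
    (fun i t => (h.measurable_Y i t).prodMk (h.measurable_X i t)) h.indep h.lag_pos
    h.delta_nonneg h.mixing (φ := fun z e => e.1 - ((∑ j, e.2 j * θ j) + Pi z.1 z.2))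
    (measurable_residual_fun θ Pi) measurable_bregman bregman_lipschitz bregman_zero
    (m := 4 * d) (by exact_mod_cast hm) hR.le hy
  rw [div_div_cancel₀ (by positivity)] at key
  refine (measure_mono fun ω hω => ?_).trans key
  simp only [Set.mem_ofPred_eq, not_forall, not_le] at hω
  obtain ⟨A, hA, hAD, hlt⟩ := hω
  refine ⟨A, hA, ?_⟩
  have h1 : f ^ 2 / (8 * b' * D) * frobInner A A ≤ ∑ i, ∑ t,
      ∫ u, bregman u (A i t) ∂(P.map fun ω => residual X Y θ Pi ω i t) := by
    simp only [frobInner, Finset.mul_sum]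
    refine Finset.sum_le_sum fun i _ => Finset.sum_le_sum fun t _ => ?_
    rw [← sq]
    exact (h.bounds i t).bregman_ge (h.measurable_residual i t) h.low_pos h.sq_le hD (hAD i t)
  simp only [Finset.sum_sub_distrib]
  exact lt_sub_iff_add_lt'.2 (hlt.trans_le h1)

/-- For a fixed `C` one cannot expect all rows to be good with high probability, but independence
turns probability 1/2 for all rows into a bounded number of bad ones. -/
theorem PanelLaw.measure_rows_le [IsProbabilityMeasure P] (h : PanelLaw P X Y τ θ Pi f b' δ c) {C : ℝ}
    (hC : P {ω | C < maxNorm (tensorMul (fun i t => X i t ω) θ + Pi)} ≤ ENNReal.ofReal (1 / 2))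
    {b : ℝ} (hb : 0 < b) :
    P {ω | ¬ ∃ G : Finset (Fin n), ((Gᶜ).card : ℝ) ≤ b ∧
      ∀ i ∈ G, ∀ t, |(tensorMul (fun i t => X i t ω) θ + Pi) i t| ≤ C} ≤
        ENNReal.ofReal (1 / b) := by
  classical
  set S : Fin n → Set (Fin T → ℝ × (Fin p → ℝ)) := fun i =>
    {e | ∀ t, |(∑ j, (e t).2 j * θ j) + Pi i t| ≤ C} with hS
  have key := measure_card_fail_le (P := P) (g := fun i ω t => (Y i t ω, X i t ω)) (S := S)
    (fun i => measurable_pi_iff.2 fun t => (h.measurable_Y i t).prodMk (h.measurable_X i t))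
    h.indep (fun i => by
      simp only [hS, Set.ofPred_forall]
      exact MeasurableSet.iInter fun t => measurableSet_le (by fun_prop) measurable_const)
    ((measure_mono fun ω hω => ?_).trans hC) hb
  · refine (measure_mono fun ω hω => ?_).trans key
    simp only [Set.mem_ofPred_eq] at hω ⊢
    by_contra hcon
    refine hω ⟨Finset.univ.filter fun i => (fun t => (Y i t ω, X i t ω)) ∈ S i, ?_, ?_⟩
    · rw [Finset.compl_filter]; exact (not_le.1 hcon).le
    · intro i hi t
      exact (Finset.mem_filter.1 hi).2 t
  · simp only [Set.mem_ofPred_eq] at hω ⊢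
    by_contra hcon
    exact hω fun i t => (abs_le_maxNorm _ i t).trans (not_lt.1 hcon)

end FixedPanel

/-! ### The rate -/

/-- Matches the penalty level with the rate: `(√n + √d)² ≤ 2 (n + d)`, and `2 c d ≤ T` absorbs the 2
and one block length. -/
theorem rank_mul_penalty_sq_le {n T c d r : ℝ} (hn : 0 < n) (hc : 0 < c) (hd : 0 < d)
    (hr : 0 < r) (hcd : 2 * (c * d) ≤ T) :
    r * (c * (√n + √d)) ^ 2 ≤ n * T * (c * r * (1 / n + 1 / d)) := by
  have h1 := Real.sq_sqrt hn.le
  have h2 := Real.sq_sqrt hd.le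
  have h3 : (√n + √d) ^ 2 ≤ 2 * (n + d) := by nlinarith [sq_nonneg (√n - √d)]
  have h4 : n * T * (c * r * (1 / n + 1 / d)) = T * (c * r * (n + d)) / d := by
    field_simp; ring
  rw [h4, le_div_iff₀ hd]
  calc r * (c * (√n + √d)) ^ 2 * d = r * c ^ 2 * d * (√n + √d) ^ 2 := by ring
    _ ≤ r * c ^ 2 * d * (2 * (n + d)) := by gcongr
    _ = 2 * (c * d) * (c * r * (n + d)) := by ring
    _ ≤ T * (c * r * (n + d)) := by gcongr

theorem one_div_le_rate {n c d r : ℝ} (hn : 0 < n) (hc : 1 ≤ c) (hd : 0 < d) (hr : 1 ≤ r) :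
    1 / n ≤ c * r * (1 / n + 1 / d) := by
  have h1 : 1 ≤ c * r := one_le_mul_of_one_le_of_one_le hc hr
  calc 1 / n ≤ 1 * (1 / n + 1 / d) := by
        have : 0 < 1 / d := by positivity
        linarith
    _ ≤ _ := by gcongr

/-- The curvature of the expected loss beats the penalty and the noise at the radius `H`. -/
theorem noise_lt_curvature {N T r f f₀ b' φ w k e H R C b D B L M₁ ρ : ℝ}
    (hN : 0 < N) (hr : 1 ≤ r) (hρ : 0 < ρ) (hf₀ : 0 < f₀) (hf : f₀ ≤ f) (hb' : f ^ 2 / 2 ≤ b')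
    (hφ : 1 ≤ φ) (hw : 0 < w) (hk : 0 ≤ k) (hM₁ : 0 ≤ M₁) (hC : 0 ≤ C) (hb : 0 ≤ b)
    (hD : 0 < D) (hL : 0 ≤ L) (he : e = M₁ * φ * √r * w / f)
    (hB : B = 1 + 64 * D * L * (√k + M₁ / f₀ + C * b))
    (hH : H = √N * (B * φ * ρ * b' / f ^ 2))
    (hR : R = 8 * √(k * r) * H + 4 * e + 4 * C * T * b / w)
    (hrw : r * w ^ 2 ≤ N * ρ ^ 2) (hTN : T ≤ N * ρ ^ 2) :
    L * w * R < f ^ 2 / (8 * b' * D) * H ^ 2 := by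
  have hf0 : 0 < f := hf₀.trans_le hf
  have hr0 : 0 < r := by linarith
  have hφ0 : 0 < φ := by linarith
  have hb'0 : 0 < b' := lt_of_lt_of_le (by positivity) hb'
  have hN2 := Real.sq_sqrt hN.le
  have hsN : 0 < √N := Real.sqrt_pos.2 hN
  obtain ⟨s, hs⟩ : ∃ s, s = √k + M₁ / f₀ + C * b := ⟨_, rfl⟩
  rw [← hs] at hB
  have hs0 : 0 ≤ s := by rw [hs]; positivity
  have hB1 : 1 ≤ B := by
    rw [hB]; have : 0 ≤ 64 * D * L * s := by positivity
    linarith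
  have hB0 : 0 < B := by linarith
  have hsrw : √r * w ≤ √N * ρ := by
    refine abs_le_of_sq_le_sq' ?_ (by positivity) |>.2
    rw [mul_pow, mul_pow, hN2, Real.sq_sqrt hr0.le]; exact hrw
  obtain ⟨x, hx⟩ : ∃ x, x = b' / f ^ 2 := ⟨_, rfl⟩
  have hx0 : 0 < x := by rw [hx]; positivity
  have hx1 : 1 / 2 ≤ x := by rw [hx, le_div_iff₀ (by positivity)]; linarith
  have hHx : H = √N * ρ * (B * (φ * x)) := by rw [hH, hx]; ring
  have t1 : w * (8 * √(k * r) * H) ≤ N * ρ ^ 2 * (8 * √k * B * (φ * x)) := by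
    calc w * (8 * √(k * r) * H) = (√r * w) * (8 * √k * (√N * ρ) * (B * (φ * x))) := by
          rw [Real.sqrt_mul hk, hHx]; ring
      _ ≤ (√N * ρ) * (8 * √k * (√N * ρ) * (B * (φ * x))) :=
          mul_le_mul_of_nonneg_right hsrw (by positivity)
      _ = √N ^ 2 * ρ ^ 2 * (8 * √k * B * (φ * x)) := by ring
      _ = _ := by rw [hN2]
  have hhalf : φ * (1 / 2) ≤ φ * x := by gcongr
  have t2 : w * (4 * e) ≤ N * ρ ^ 2 * (8 * (M₁ / f₀) * (φ * x)) := by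
    have hsr : √r ≤ r := by
      rw [Real.sqrt_le_left hr0.le]; nlinarith
    have h1 : √r * w ^ 2 ≤ N * ρ ^ 2 :=
      (mul_le_mul_of_nonneg_right hsr (sq_nonneg w)).trans hrw
    calc w * (4 * e) = (√r * w ^ 2) * (4 * M₁ * φ / f) := by rw [he]; ring
      _ ≤ (N * ρ ^ 2) * (4 * M₁ * φ / f₀) := by gcongr
      _ = N * ρ ^ 2 * (8 * (M₁ / f₀) * (φ * (1 / 2))) := by ring
      _ ≤ _ := by gcongr
  have t3 : w * (4 * C * T * b / w) ≤ N * ρ ^ 2 * (8 * (C * b) * (φ * x)) := by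
    have h1 : 1 * (1 / 2) ≤ φ * x := le_trans (by gcongr) hhalf
    calc w * (4 * C * T * b / w) = T * (8 * (C * b) * (1 * (1 / 2))) := by
          rw [mul_div_cancel₀ _ hw.ne']; ring
      _ ≤ _ := by gcongr
  -- Low rank part, approximation error and masked rows are all of order `N ρ² φ x`; only the first
  -- carries the factor `B`, and `B ≥ 1` covers the others.
  have t4 : w * R ≤ N * ρ ^ 2 * (φ * x) * (8 * B * s) := by
    have h1 : w * R ≤ N * ρ ^ 2 * (φ * x) * (8 * √k * B + 8 * (M₁ / f₀) + 8 * (C * b)) := by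
      rw [hR]; linarith
    refine h1.trans (mul_le_mul_of_nonneg_left ?_ (by positivity))
    have h2 : 0 ≤ M₁ / f₀ + C * b := by positivity
    have h3 := mul_le_mul_of_nonneg_right hB1 h2
    rw [hs]; linarith
  -- This is where `B` comes from: `64 D L s = B - 1`. The noise grows like `(B - 1) B`, while the
  -- curvature, quadratic in `H`, carries `φ B²`.
  have t5 : L * w * R ≤ N * ρ ^ 2 * (φ * x) * ((B - 1) * B / (8 * D)) := by
    calc L * w * R = L * (w * R) := by ring
      _ ≤ L * (N * ρ ^ 2 * (φ * x) * (8 * B * s)) := by gcongr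
      _ = N * ρ ^ 2 * (φ * x) * ((64 * D * L * s) * B / (8 * D)) := by field_simp; ring
      _ = N * ρ ^ 2 * (φ * x) * ((B - 1) * B / (8 * D)) := by
          have : 64 * D * L * s = B - 1 := by rw [hB]; ring
          rw [this]
  have t6 : f ^ 2 / (8 * b' * D) * H ^ 2 = N * ρ ^ 2 * (φ * x) * (φ * B ^ 2 / (8 * D)) := by
    have e1 : f ^ 2 / (8 * b' * D) * x = 1 / (8 * D) := by rw [hx]; field_simp
    calc f ^ 2 / (8 * b' * D) * H ^ 2
        = √N ^ 2 * ρ ^ 2 * (φ * x) * (φ * B ^ 2) * (f ^ 2 / (8 * b' * D) * x) := by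
          rw [hHx]; ring
      _ = _ := by rw [e1, hN2]; ring
  rw [t6]
  refine t5.trans_lt (mul_lt_mul_of_pos_left ?_ (by positivity))
  rw [div_lt_div_iff_of_pos_right (by positivity)]
  have h1 := mul_le_mul_of_nonneg_right hφ (sq_nonneg B)
  linarith

/-- The masked rows leave a term of order `1 / n`, at most four times the rate because `b' / f² ≥
1/2` and `φ`, `c`, `r` are at least one. -/
theorem rate_conclusion {n T c d r f b' φ C₁ b H B ρ : ℝ}
    (hn : 1 ≤ n) (hT : 0 < T) (hc : 1 ≤ c) (hd : 1 ≤ d) (hr : 1 ≤ r)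
    (hf : 0 < f) (hb' : f ^ 2 / 2 ≤ b') (hφ : 1 ≤ φ)
    (hρ : ρ = √(c * r * (1 / n + 1 / d))) (hb : 0 ≤ b)
    (hH : H = √(n * T) * (B * φ * ρ * b' / f ^ 2)) :
    1 / (n * T) * (2 * H ^ 2 + 2 * (b * T * C₁ ^ 2)) ≤
      (2 * B ^ 2 + 8 * b * C₁ ^ 2) * (b' ^ 2 * φ ^ 2 * c * r / f ^ 4 * (1 / n + 1 / d)) := by
  have hn0 : 0 < n := by linarith
  have hd0 : 0 < d := by linarith
  have hρ2 : ρ ^ 2 = c * r * (1 / n + 1 / d) := by rw [hρ, Real.sq_sqrt (by positivity)]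
  have e1 : H ^ 2 = n * T * (B ^ 2 * (b' ^ 2 * φ ^ 2 * c * r / f ^ 4 * (1 / n + 1 / d))) := by
    rw [hH, mul_pow, Real.sq_sqrt (by positivity)]
    have : (B * φ * ρ * b' / f ^ 2) ^ 2 = B ^ 2 * (b' ^ 2 * φ ^ 2 / f ^ 4 * ρ ^ 2) := by
      field_simp
    rw [this, hρ2]; ring
  have e2 : 1 / n ≤ 4 * (b' ^ 2 * φ ^ 2 * c * r / f ^ 4 * (1 / n + 1 / d)) := by
    have h1 : 1 ≤ 4 * (b' ^ 2 * φ ^ 2 * c * r / f ^ 4) := by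
      have h2 : f ^ 4 ≤ 4 * b' ^ 2 := by
        have := mul_self_le_mul_self (by positivity) hb'
        nlinarith
      have h3 : 1 ≤ φ ^ 2 * c * r :=
        one_le_mul_of_one_le_of_one_le (one_le_mul_of_one_le_of_one_le
          (one_le_pow₀ hφ) hc) hr
      rw [mul_div_assoc', le_div_iff₀ (by positivity), one_mul]
      calc f ^ 4 ≤ 4 * b' ^ 2 * 1 := by linarith
        _ ≤ 4 * b' ^ 2 * (φ ^ 2 * c * r) := by gcongr
        _ = _ := by ring
    calc 1 / n ≤ 1 * (1 / n + 1 / d) := by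
          have : 0 < 1 / d := by positivity
          linarith
      _ ≤ 4 * (b' ^ 2 * φ ^ 2 * c * r / f ^ 4) * (1 / n + 1 / d) := by gcongr
      _ = _ := by ring
  set rate := b' ^ 2 * φ ^ 2 * c * r / f ^ 4 * (1 / n + 1 / d) with hrate
  calc 1 / (n * T) * (2 * H ^ 2 + 2 * (b * T * C₁ ^ 2))
      = 2 * B ^ 2 * rate + 2 * b * C₁ ^ 2 * (1 / n) := by rw [e1]; field_simp
    _ ≤ 2 * B ^ 2 * rate + 2 * b * C₁ ^ 2 * (4 * rate) := by gcongr
    _ = _ := by ring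

/-! ### Error bound at a sample point of the good event. -/

section Error

open Matrix

theorem eq_zero_of_rank_le_zero {n T : ℕ} {A : Matrix (Fin n) (Fin T) ℝ} (h : A.rank ≤ 0) :
    A = 0 := by
  have h1 : A.rank = 0 := Nat.le_zero.1 h
  rw [Matrix.rank, Submodule.finrank_eq_zero, LinearMap.range_eq_bot] at h1
  exact Matrix.mulVec_injective (funext fun v => by
    rw [Matrix.zero_mulVec]; exact LinearMap.congr_fun h1 v)

theorem matrix_rank_add_le {n T : ℕ} (A B : Matrix (Fin n) (Fin T) ℝ) :
    (A + B).rank ≤ A.rank + B.rank := by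
  have h : LinearMap.range (A + B).mulVecLin ≤
      LinearMap.range A.mulVecLin ⊔ LinearMap.range B.mulVecLin := by
    rintro _ ⟨v, rfl⟩
    rw [Matrix.mulVecLin_apply, Matrix.add_mulVec]
    exact Submodule.add_mem_sup ⟨v, rfl⟩ ⟨v, rfl⟩
  exact (Submodule.finrank_mono h).trans (Submodule.finrank_add_le_finrank_add_finrank _ _)

theorem sqrt_add_four_mul_le {n d : ℝ} (hn : 0 ≤ n) (hd : 0 ≤ d) :
    √(n + 4 * d) ≤ 2 * (√n + √d) := by
  refine Real.sqrt_le_iff.2 ⟨by positivity, ?_⟩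
  have h1 := Real.sq_sqrt hn
  have h2 := Real.sq_sqrt hd
  nlinarith [mul_nonneg (Real.sqrt_nonneg n) (Real.sqrt_nonneg d)]

/-- The error bound for the estimator at a sample point of the good event. -/
theorem estimate_error_le {n T p c d K : ℕ} {τ ν₁ ν₂ C b b₂ f f₀ b' φ w H R D B M₁ C₁ ε ρ : ℝ}
    {y : Fin n → Fin T → ℝ} {x : Fin n → Fin T → Fin p → ℝ} {θ θhat : Fin p → ℝ}
    {Pi ξ A U : Matrix (Fin n) (Fin T) ℝ}
    (hU : U = Matrix.of fun i t => y i t - ((∑ j, x i t j * θ j) + Pi i t))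
    (hτ0 : 0 < τ) (hτ1 : τ < 1) (hn : 1 ≤ n) (hT : 1 ≤ T) (hc : 1 ≤ c) (hd : 1 ≤ d)
    (hcd : 2 * (c * d) ≤ T) (hf₀ : 0 < f₀) (hf : f₀ ≤ f) (hb' : f ^ 2 / 2 ≤ b') (hφ : 1 ≤ φ)
    (hC : 0 < C) (hb : 0 < b) (hε : 0 < ε) (hM₁ : 0 < M₁)
    (hw : w = c * (√(n : ℝ) + √(d : ℝ))) (hρ : ρ = √(c * Pi.rank * (1 / (n : ℝ) + 1 / d)))
    (hD : D = max (2 * C) (2 / f₀))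
    (hB : B = 1 + 64 * D * (b₂ / 2 + 80 / ε) * (√(K + 1 : ℝ) + M₁ / f₀ + C * b))
    (hH : H = √((n : ℝ) * T) * (B * φ * ρ * b' / f ^ 2))
    (hR : R = 8 * √((K + 1 : ℝ) * Pi.rank) * H + 4 * (M₁ * φ * √(Pi.rank : ℝ) * w / f) +
      4 * C * T * b / w)
    (hE : IsEstimate τ ν₁ ν₂ C y x θhat A) (hν : 2 * avgSupNorm x ≤ ν₁)
    (hν₂ : 2 * (c / ((n : ℝ) * T) * (√(n : ℝ) + √(d : ℝ))) ≤ ν₂)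
    (hν₂' : ν₂ ≤ b₂ * (c / ((n : ℝ) * T) * (√(n : ℝ) + √(d : ℝ))))
    (hσ : ∀ j, |sigmaHatSq x j - 1| ≤ 1 / 4)
    (hrank : (tensorMul x θ + ξ).rank ≤ K * Pi.rank)
    (hξ : |nuclearNorm ξ / √((n : ℝ) * T)| ≤ M₁ * (c * φ * √(Pi.rank : ℝ) *
      (√(n : ℝ) + √(d : ℝ)) / (√((n : ℝ) * T) * f)))
    (hmax : |maxNorm (tensorMul x θ + Pi)| ≤ C₁)
    (hW : OpBound (Matrix.of fun i t => τ - if U i t ≤ 0 then 1 else 0) w)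
    (hG : ∃ G : Finset (Fin n), ((Gᶜ).card : ℝ) ≤ b ∧
      ∀ i ∈ G, ∀ t, |(tensorMul x θ + Pi) i t| ≤ C)
    (hproc : ∀ A : Matrix (Fin n) (Fin T) ℝ, nuclearNorm A ≤ R → (∀ i t, |A i t| ≤ D) →
      f ^ 2 / (8 * b' * D) * frobInner A A ≤ ∑ i, ∑ t, bregman (U i t) (A i t) +
        c * (40 * R * √((n : ℝ) + 4 * d)) / ε) :
    |1 / ((n : ℝ) * T) * frobeniusNorm (A - (tensorMul x θ + Pi)) ^ 2| ≤
      (2 * B ^ 2 + 8 * b * C₁ ^ 2) *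
        (b' ^ 2 * φ ^ 2 * c * Pi.rank / f ^ 4 * (1 / (n : ℝ) + 1 / d)) := by
  have hn1 : (1 : ℝ) ≤ n := by exact_mod_cast hn
  have hT1 : (1 : ℝ) ≤ T := by exact_mod_cast hT
  have hc1 : (1 : ℝ) ≤ c := by exact_mod_cast hc
  have hd1 : (1 : ℝ) ≤ d := by exact_mod_cast hd
  have hn0 : (0 : ℝ) < n := by linarith
  have hT0 : (0 : ℝ) < T := by linarith
  have hd0 : (0 : ℝ) < d := by linarith
  have hc0 : (0 : ℝ) < c := by linarith
  have hf0 : 0 < f := hf₀.trans_le hf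
  have hN : 0 < (n : ℝ) * T := by positivity
  have hsN : 0 < √((n : ℝ) * T) := Real.sqrt_pos.2 hN
  have hw0 : 0 < w := by rw [hw]; positivity
  obtain rfl : θhat = 0 := hE.coef_eq_zero hτ0 hτ1 hσ hν
  have ew : (n : ℝ) * T * (c / ((n : ℝ) * T) * (√(n : ℝ) + √(d : ℝ))) = w := by
    rw [hw, ← mul_assoc, mul_div_cancel₀ _ hN.ne']
  have hv : 2 * w ≤ n * T * ν₂ := by
    have := mul_le_mul_of_nonneg_left hν₂ hN.le
    rw [mul_left_comm, ew] at this
    exact this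
  have hv₁ : n * T * ν₂ ≤ b₂ * w := by
    have := mul_le_mul_of_nonneg_left hν₂' hN.le
    rwa [mul_left_comm ((n : ℝ) * T) b₂, ew] at this
  set M := tensorMul x θ + Pi with hM
  have eY : ∀ i t, (U + M) i t = y i t := fun i t => by
    simp only [hU, hM, tensorMul, Matrix.add_apply, Matrix.of_apply]; ring
  have hmin : ∀ A' : Matrix (Fin n) (Fin T) ℝ, maxNorm A' ≤ C →
      ∑ i, ∑ t, checkLoss τ ((U + M) i t - A i t) + n * T * ν₂ * nuclearNorm A ≤
        ∑ i, ∑ t, checkLoss τ ((U + M) i t - A' i t) + n * T * ν₂ * nuclearNorm A' := by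
    intro A' hA'
    simp only [eY]
    exact hE.sum_checkLoss_le hN hA'
  have hξ' : nuclearNorm ξ ≤ M₁ * φ * √(Pi.rank : ℝ) * w / f := by
    have h1 := (le_abs_self _).trans hξ
    rw [div_le_iff₀ hsN] at h1
    refine h1.trans_eq ?_
    rw [hw]; field_simp
  rw [abs_of_nonneg (by positivity)]
  -- For rank zero the rate is zero and the estimate must be exact: `ξ` and then `M` vanish, and a
  -- penalty above the operator norm of the score forces `A = 0`.
  rcases Nat.eq_zero_or_pos Pi.rank with h0 | h0
  · have hPi : Pi = 0 := eq_zero_of_rank_le_zero h0.le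
    rw [h0] at hrank hξ'
    have hξ0 : ξ = 0 := eq_zero_of_nuclearNorm_le (by simpa using hξ')
    have hM0 : M = 0 := by
      rw [hM, hPi, add_zero]
      rw [hξ0, add_zero] at hrank
      exact eq_zero_of_rank_le_zero (by simpa using hrank)
    have hA0 : A = 0 := by
      refine eq_zero_of_minimal (v := n * T * ν₂) hW (by linarith) ?_
      have h1 := hmin 0 (maxNorm_le hC.le fun i t => by simpa using hC.le)
      simpa [hM0, nuclearNorm_zero] using h1
    rw [hA0, hM0, h0]
    simp [frobeniusNorm]
  have hr1 : (1 : ℝ) ≤ (Pi.rank : ℝ) := by exact_mod_cast h0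
  have hr0 : (0 : ℝ) < (Pi.rank : ℝ) := by linarith
  obtain ⟨G, hGb, hGM⟩ := hG
  have hk : ((M + ξ).rank : ℝ) ≤ (K + 1 : ℝ) * Pi.rank := by
    have e1 : M + ξ = (tensorMul x θ + ξ) + Pi := by rw [hM]; abel
    have h1 : (M + ξ).rank ≤ K * Pi.rank + Pi.rank := by
      rw [e1]; exact (matrix_rank_add_le _ _).trans (Nat.add_le_add_right hrank _)
    have h2 : ((M + ξ).rank : ℝ) ≤ ((K * Pi.rank + Pi.rank : ℕ) : ℝ) := Nat.cast_le.2 h1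
    push_cast at h2
    linarith
  have hρ0 : 0 < ρ := by rw [hρ]; exact Real.sqrt_pos.2 (by positivity)
  have hρ2 : ρ ^ 2 = c * Pi.rank * (1 / (n : ℝ) + 1 / d) := by
    rw [hρ, Real.sq_sqrt (by positivity)]
  have hD0 : 0 < D := by
    rw [hD]; exact lt_max_of_lt_left (by positivity)
  have hb₂ : 0 ≤ b₂ := by
    by_contra hneg
    have := mul_neg_of_neg_of_pos (not_le.1 hneg) hw0
    linarith
  have hL : 0 ≤ b₂ / 2 + 80 / ε := by positivity
  have hB0 : 0 ≤ B := by rw [hB]; positivity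
  have hb'0 : 0 < b' := lt_of_lt_of_le (by positivity) hb'
  have hH0 : 0 ≤ H := by rw [hH]; positivity
  have hR0 : 0 ≤ R := by rw [hR]; positivity
  have hcd' : 2 * ((c : ℝ) * d) ≤ T := by exact_mod_cast hcd
  have hcurv := noise_lt_curvature (T := (T : ℝ)) hN hr1 hρ0 hf₀ hf hb' hφ hw0
    (by positivity) hM₁.le hC.le hb.le hD0 hL rfl hB hH hR
    (by rw [hρ2, hw]; exact rank_mul_penalty_sq_le hn0 hc0 hd0 hr0 hcd')
    (by
      rw [hρ2]
      have h1 := mul_le_mul_of_nonneg_left (one_div_le_rate hn0 hc1 hd0 hr1) hN.le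
      refine le_trans (le_of_eq ?_) h1
      field_simp)
  -- The noise term, which joins the penalty term `(b₂ / 2) w R` in the coefficient `b₂ / 2 + 80 /
  -- ε` of `B`.
  have hz : c * (40 * R * √((n : ℝ) + 4 * d)) / ε ≤ 80 / ε * w * R := by
    have h1 := sqrt_add_four_mul_le hn0.le hd0.le
    calc c * (40 * R * √((n : ℝ) + 4 * d)) / ε ≤
        c * (40 * R * (2 * (√(n : ℝ) + √(d : ℝ)))) / ε := by gcongr
      _ = _ := by rw [hw]; ring
  have herr := frobeniusNorm_sub_sq_le (C₁ := C₁) hτ0 hτ1 G hW hw0 hv hv₁ hC.le hE.feasible hmin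
    hGM hGb (fun i t => (abs_le_maxNorm M i t).trans ((le_abs_self _).trans hmax)) hk hξ' hH0 hR.ge
    (fun A hA hAC => hproc A hA fun i t => (hAC i t).trans (hD ▸ le_max_left _ _))
    (lt_of_le_of_lt (by linarith) hcurv)
  refine (mul_le_mul_of_nonneg_left herr (by positivity)).trans ?_
  exact rate_conclusion hn1 hT0 hc1 hd1 hr1 hf0 hb' hφ hρ hb.le hH

end Error

/-! ### Asymptotics -/

section Asymptotics

theorem measure_le_of_events {Ω : Type*} [MeasurableSpace Ω] {P : Measure Ω} {k : ℕ}
    {E : Fin k → Ω → Prop} {ε : ℝ} (hE : ∀ i, P {ω | ¬ E i ω} ≤ ENNReal.ofReal ε)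
    {S : Set Ω} (hS : ∀ ω, (∀ i, E i ω) → ω ∉ S) : P S ≤ ENNReal.ofReal (k * ε) := by
  have h1 : S ⊆ ⋃ i, {ω | ¬ E i ω} := by
    intro ω hω
    by_contra hcon
    simp only [Set.mem_iUnion, Set.mem_ofPred_eq, not_exists, not_not] at hcon
    exact hS ω hcon hω
  refine (measure_mono h1).trans ((measure_iUnion_fintype_le _ _).trans ?_)
  refine (Finset.sum_le_sum fun i _ => hE i).trans_eq ?_
  rw [Finset.sum_const, Finset.card_univ, Fintype.card_fin, nsmul_eq_mul,
    ENNReal.ofReal_mul (Nat.cast_nonneg k), ENNReal.ofReal_natCast]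

theorem eventually_le_ofReal {u : ℕ → ℝ≥0∞} (hu : Tendsto u atTop (𝓝 0)) {ε : ℝ} (hε : 0 < ε) :
    ∀ᶠ n in atTop, u n ≤ ENNReal.ofReal ε :=
  (hu.eventually_lt_const (ENNReal.ofReal_pos.2 hε)).mono fun _ h => h.le

variable {Ω : ℕ → Type*} [∀ n, MeasurableSpace (Ω n)] {P : ∀ n, Measure (Ω n)} {T p : ℕ → ℕ}
  {X : ∀ n, Fin n → Fin (T n) → Ω n → Fin (p n) → ℝ} {Y : ∀ n, Fin n → Fin (T n) → Ω n → ℝ}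
  {μ μ' : ℝ}

theorem floor_le_blockLength (μ' : ℝ) (T : ℕ) :
    ⌊(T : ℝ) ^ (1 / (1 + μ'))⌋₊ ≤ blockLength μ' T :=
  Nat.floor_le_ceil _

theorem one_le_rpow_block {μ' : ℝ} (hμ : 0 < μ') {T : ℕ} (hT : 1 ≤ T) :
    1 ≤ (T : ℝ) ^ (1 / (1 + μ')) :=
  Real.one_le_rpow (by exact_mod_cast hT) (by positivity)

theorem one_le_blockLength {μ' : ℝ} (hμ : 0 < μ') {T : ℕ} (hT : 1 ≤ T) :
    1 ≤ blockLength μ' T :=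
  Nat.one_le_ceil_iff.2 (lt_of_lt_of_le one_pos (one_le_rpow_block hμ hT))

/-- As `n p T ≥ 1` for `n ≥ 1`, the growth condition alone drives `⌊T^(1/(1+μ'))⌋^(-μ)` to zero;
hence the blocks, and with them `T`, grow without bound. -/
theorem WeakDependence.tendsto_floor (h : WeakDependence P T p X Y μ μ') (hT : ∀ n, 1 ≤ T n)
    (hp : ∀ n, 1 ≤ p n) :
    Tendsto (fun n => ((⌊(T n : ℝ) ^ (1 / (1 + μ'))⌋₊ : ℕ) : ℝ)) atTop atTop := by
  have hμ : 0 < μ := h.pos.trans h.lt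
  have hk : ∀ n, (1 : ℝ) ≤ ((⌊(T n : ℝ) ^ (1 / (1 + μ'))⌋₊ : ℕ) : ℝ) := fun n => by
    exact_mod_cast Nat.le_floor (by simpa using one_le_rpow_block h.pos (hT n))
  have h1 : Tendsto (fun n => ((⌊(T n : ℝ) ^ (1 / (1 + μ'))⌋₊ : ℕ) : ℝ) ^ (-μ)) atTop (𝓝 0) := by
    refine squeeze_zero' (Eventually.of_forall fun n => by positivity) ?_ h.growth
    filter_upwards [eventually_ge_atTop 1] with n hn
    have h2 : (1 : ℝ) ≤ (n : ℝ) * p n * T n := by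
      exact_mod_cast Nat.mul_pos (Nat.mul_pos hn (hp n)) (hT n)
    exact le_mul_of_one_le_left (by positivity) h2
  have h2 : Tendsto (fun n => ((⌊(T n : ℝ) ^ (1 / (1 + μ'))⌋₊ : ℕ) : ℝ) ^ (-μ))
      atTop (𝓝[>] 0) :=
    tendsto_nhdsWithin_iff.2 ⟨h1, Eventually.of_forall fun n =>
      Real.rpow_pos_of_pos (lt_of_lt_of_le one_pos (hk n)) _⟩
  have h3 := (tendsto_rpow_atTop (inv_pos.2 hμ)).comp h2.inv_tendsto_nhdsGT_zero
  refine h3.congr fun n => ?_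
  have h0 : (0 : ℝ) ≤ ((⌊(T n : ℝ) ^ (1 / (1 + μ'))⌋₊ : ℕ) : ℝ) := Nat.cast_nonneg _
  simp only [Function.comp, Pi.inv_apply]
  rw [Real.rpow_neg h0, inv_inv, Real.rpow_rpow_inv h0 hμ.ne']

theorem WeakDependence.tendsto_blockLength (h : WeakDependence P T p X Y μ μ')
    (hT : ∀ n, 1 ≤ T n) (hp : ∀ n, 1 ≤ p n) :
    Tendsto (fun n => (blockLength μ' (T n) : ℝ)) atTop atTop :=
  tendsto_atTop_mono (fun n => Nat.cast_le.2 (floor_le_blockLength μ' (T n)))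
    (h.tendsto_floor hT hp)

/-- With `a = 1 / (1 + μ') < 1` the block length is at most `2 T^a`, and `4 T^a ≤ T` once `T` is
large. -/
theorem WeakDependence.eventually_one_le_numBlocks (h : WeakDependence P T p X Y μ μ')
    (hT : ∀ n, 1 ≤ T n) (hp : ∀ n, 1 ≤ p n) : ∀ᶠ n in atTop, 1 ≤ numBlocks μ' (T n) := by
  have hT1 : ∀ n, (1 : ℝ) ≤ T n := fun n => by exact_mod_cast hT n
  have ha : 0 < 1 / (1 + μ') := by have := h.pos; positivity
  have ha1 : 1 / (1 + μ') < 1 := by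
    have := h.pos
    rw [div_lt_one (by positivity)]; linarith
  have h1 : Tendsto (fun n => (T n : ℝ)) atTop atTop := by
    refine tendsto_atTop_mono (fun n => ?_) (h.tendsto_floor hT hp)
    refine (Nat.floor_le (by positivity)).trans ?_
    exact (Real.rpow_le_rpow_of_exponent_le (hT1 n) ha1.le).trans_eq (Real.rpow_one _)
  have h2 := (tendsto_rpow_atTop (sub_pos.2 ha1)).comp h1
  filter_upwards [h2.eventually_ge_atTop 4] with n hn
  have hT0 : (0 : ℝ) < T n := by linarith [hT1 n]
  rw [numBlocks, Nat.le_div_iff_mul_le (by have := one_le_blockLength h.pos (hT n); omega),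
    one_mul]
  have h3 : (blockLength μ' (T n) : ℝ) ≤ (T n : ℝ) ^ (1 / (1 + μ')) + 1 :=
    (Nat.ceil_lt_add_one (by positivity)).le
  have h4 := one_le_rpow_block h.pos (hT n)
  have h5 : 4 * (T n : ℝ) ^ (1 / (1 + μ')) ≤ T n := by
    calc 4 * (T n : ℝ) ^ (1 / (1 + μ'))
        ≤ (T n : ℝ) ^ (1 - 1 / (1 + μ')) * (T n : ℝ) ^ (1 / (1 + μ')) :=
          mul_le_mul_of_nonneg_right hn (by positivity)
      _ = T n := by rw [← Real.rpow_add hT0, sub_add_cancel, Real.rpow_one]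
  have h6 : 2 * (blockLength μ' (T n) : ℝ) ≤ T n := by linarith
  exact_mod_cast h6

/-- This is the total cost of decoupling, `2δ` for each of the `n T` entries. -/
theorem WeakDependence.tendsto_mixing (h : WeakDependence P T p X Y μ μ') (hT : ∀ n, 1 ≤ T n)
    (hp : ∀ n, 1 ≤ p n) {B : ℝ} (hB : 0 ≤ B) :
    Tendsto (fun n : ℕ => (n : ℝ) * T n * (2 * (B * (blockLength μ' (T n) : ℝ) ^ (-μ))))
      atTop (𝓝 0) := by
  have hμ : 0 < μ := h.pos.trans h.lt
  have h1 := h.growth.const_mul (2 * B)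
  rw [mul_zero] at h1
  refine squeeze_zero (fun n => by positivity) (fun n => ?_) h1
  have hk : (1 : ℝ) ≤ ((⌊(T n : ℝ) ^ (1 / (1 + μ'))⌋₊ : ℕ) : ℝ) := by
    exact_mod_cast Nat.le_floor (by simpa using one_le_rpow_block h.pos (hT n))
  have h2 : (blockLength μ' (T n) : ℝ) ^ (-μ) ≤
      ((⌊(T n : ℝ) ^ (1 / (1 + μ'))⌋₊ : ℕ) : ℝ) ^ (-μ) :=
    Real.rpow_le_rpow_of_nonpos (by linarith)
      (Nat.cast_le.2 (floor_le_blockLength μ' (T n))) (by linarith)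
  have h3 : (1 : ℝ) ≤ p n := by exact_mod_cast hp n
  calc (n : ℝ) * T n * (2 * (B * (blockLength μ' (T n) : ℝ) ^ (-μ)))
      = 2 * B * ((n : ℝ) * 1 * T n * (blockLength μ' (T n) : ℝ) ^ (-μ)) := by ring
    _ ≤ _ := by gcongr

/-- Bounds the size of a residue class by a multiple of `d_T`; flooring costs at most a factor 2
because `d_T ≥ 1`. -/
theorem div_blockLength_add_one_le {μ' : ℝ} {T : ℕ} (hc : 1 ≤ blockLength μ' T)
    (hd : 1 ≤ numBlocks μ' T) : T / blockLength μ' T + 1 ≤ 4 * numBlocks μ' T := by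
  have h1 : T / blockLength μ' T < 2 * (numBlocks μ' T + 1) := by
    rw [Nat.div_lt_iff_lt_mul hc]
    have := Nat.lt_mul_div_succ T (show 0 < 2 * blockLength μ' T by omega)
    rw [numBlocks]
    nlinarith
  omega

theorem two_mul_blockLength_mul_le (μ' : ℝ) (T : ℕ) :
    2 * (blockLength μ' T * numBlocks μ' T) ≤ T := by
  rw [← mul_assoc]; exact Nat.mul_div_le T _

/-- The denominator stays above `√f₀ log 2`, so divergence of the ratio forces `φ` past one. -/
theorem eventually_one_le_phi {fLow φ : ℕ → ℝ} {c : ℕ → ℕ} {f₀ : ℝ} (hf₀ : 0 < f₀)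
    (hf : ∀ n, f₀ ≤ fLow n) (hc : ∀ n, 1 ≤ c n)
    (hφ : Tendsto (fun n => φ n / (√(fLow n) * Real.log (1 + (c n : ℝ)))) atTop atTop) :
    ∀ᶠ n in atTop, 1 ≤ φ n := by
  have hlog : 0 < Real.log 2 := Real.log_pos (by norm_num)
  have hs : 0 < √f₀ := Real.sqrt_pos.2 hf₀
  filter_upwards [hφ.eventually_ge_atTop (1 / (√f₀ * Real.log 2))] with n hn
  have h1 : √f₀ * Real.log 2 ≤ √(fLow n) * Real.log (1 + (c n : ℝ)) := by
    have : (1 : ℝ) ≤ c n := by exact_mod_cast hc n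
    have h2 : Real.log 2 ≤ Real.log (1 + (c n : ℝ)) := Real.log_le_log (by norm_num) (by linarith)
    have h3 : √f₀ ≤ √(fLow n) := Real.sqrt_le_sqrt (hf n)
    gcongr
  have h2 : 0 < √f₀ * Real.log 2 := by positivity
  rw [le_div_iff₀ (h2.trans_le h1)] at hn
  refine le_trans ?_ hn
  rw [one_div, inv_mul_eq_div, le_div_iff₀ h2, one_mul]
  exact h1

theorem panelLaw [∀ n, IsProbabilityMeasure (P n)] {τ : ℝ} (hτ0 : 0 < τ) (hτ1 : τ < 1)
    {θ : ∀ n, Fin (p n) → ℝ} {Pi : ∀ n, Matrix (Fin n) (Fin (T n)) ℝ} {fLow fUp fUp' : ℕ → ℝ}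
    (hq : QuantileModel P T p X Y τ θ Pi) (hw : WeakDependence P T p X Y μ μ')
    (hd : DensityBounds P T p X Y θ Pi fLow fUp fUp') (hT : ∀ n, 1 ≤ T n) {B : ℝ} (hB0 : 0 ≤ B)
    (hB : ∀ n (i : Fin n) (k : ℕ), 1 ≤ k →
      betaMixing (P n) (fun t ω => (Y n i t ω, X n i t ω)) k ≤ ENNReal.ofReal (B * (k : ℝ) ^ (-μ)))
    {n : ℕ} (hn : 1 ≤ n) :
    PanelLaw (P n) (X n) (Y n) τ (θ n) (Pi n) (fLow n) (fUp' n)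
      (B * (blockLength μ' (T n) : ℝ) ^ (-μ)) (blockLength μ' (T n)) := by
  obtain ⟨f₀, hf₀, hf⟩ := hd.low_pos
  have hf0 : 0 < fLow n := hf₀.trans_le (hf n)
  have hc := one_le_blockLength hw.pos (hT n)
  have hm : ∀ i t, Measurable fun x : Fin (p n) → ℝ => (∑ j, x j * θ n j) + Pi n i t :=
    fun i t => by fun_prop
  exact
    { measurable_X := hq.measurable_X n
      measurable_Y := hq.measurable_Y n
      tau_pos := hτ0
      tau_lt := hτ1
      indep := hw.indep n
      lag_pos := hc
      delta_nonneg := by positivity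
      mixing := fun i => hB n i _ hc
      bounds := fun i t => residualBounds (hq.measurable_X n i t) (hq.measurable_Y n i t) (hm i t)
        hτ0 hτ1 (hq.quantile_eq n i t) (hd.density n i t)
      low_pos := hf0
      sq_le := sq_le_of_density (m := fun x : Fin (p n) → ℝ =>
        (∑ j, x j * θ n j) + Pi n ⟨0, hn⟩ ⟨0, hT n⟩)
        (hq.measurable_X n ⟨0, hn⟩ ⟨0, hT n⟩) (hd.density n ⟨0, hn⟩ ⟨0, hT n⟩) hf0 }

theorem coef_eq_zero_tendsto {τ C : ℝ} (hτ0 : 0 < τ) (hτ1 : τ < 1)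
    {ν₁ : ∀ n, Ω n → ℝ} {ν₂ : ℕ → ℝ} (hX : CovariateMoments P T p X)
    (hν₁ : ∀ᶠ n in atTop, ∀ᵐ ω ∂(P n), 2 * avgSupNorm (fun i t => X n i t ω) ≤ ν₁ n ω)
    {θhat : ∀ n, Ω n → Fin (p n) → ℝ} {Pihat : ∀ n, Ω n → Matrix (Fin n) (Fin (T n)) ℝ}
    (hE : ∀ᶠ n in atTop, ∀ᵐ ω ∂(P n), IsEstimate τ (ν₁ n ω) (ν₂ n) C (fun i t => Y n i t ω)
      (fun i t => X n i t ω) (θhat n ω) (Pihat n ω)) :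
    WithProbTendingToOne P fun n ω => θhat n ω = 0 := by
  refine tendsto_of_tendsto_of_tendsto_of_le_of_le' tendsto_const_nhds hX.empirical
    (Eventually.of_forall fun n => zero_le) ?_
  filter_upwards [hν₁, hE] with n h1 h2
  refine measure_mono_ae ?_
  filter_upwards [h1, h2] with ω h1 h2 h3 h4
  exact h3 (h2.coef_eq_zero hτ0 hτ1 h4 h1)

end Asymptotics

end PanelQR

/-! ### Assembly over the array. -/

theorem theorem2 : ∃ a₁ a₂ : ℝ, 0 < a₁ ∧ 0 < a₂ ∧
    ∀ (Ω : ℕ → Type*) [∀ n, MeasurableSpace (Ω n)]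
      (P : ∀ n, Measure (Ω n)) [∀ n, IsProbabilityMeasure (P n)]
      (T p : ℕ → ℕ) (_ : ∀ n, 1 ≤ T n) (_ : ∀ n, 1 ≤ p n)
      (X : ∀ n, Fin n → Fin (T n) → Ω n → Fin (p n) → ℝ)
      (Y : ∀ n, Fin n → Fin (T n) → Ω n → ℝ)
      (τ : ℝ) (_ : 0 < τ) (_ : τ < 1)
      (θ : ∀ n, Fin (p n) → ℝ) (Pi : ∀ n, Matrix (Fin n) (Fin (T n)) ℝ)
      (μ μ' : ℝ) (fLow fUp fUp' φ : ℕ → ℝ)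
      (ξ : ∀ n, Ω n → Matrix (Fin n) (Fin (T n)) ℝ)
      (_ : PanelQR.QuantileModel P T p X Y τ θ Pi)
      (_ : PanelQR.WeakDependence P T p X Y μ μ')
      (_ : PanelQR.DensityBounds P T p X Y θ Pi fLow fUp fUp')
      (_ : PanelQR.CovariateMoments P T p X)
      (_ : PanelQR.ApproxLowRank P T p X θ Pi ξ fLow φ μ')
      (_ : Tendsto (fun n => φ n / (√(fLow n) *
        Real.log (1 + (PanelQR.blockLength μ' (T n) : ℝ)))) atTop atTop),
      ∃ C₀ : ℝ, 0 < C₀ ∧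
        ∀ (C : ℝ) (_ : C₀ ≤ C) (b₁ b₂ : ℝ) (ν₁ : ∀ n, Ω n → ℝ) (ν₂ : ℕ → ℝ)
          (_ : ∀ᶠ n in atTop, ∀ᵐ ω ∂(P n),
            a₁ * PanelQR.avgSupNorm (fun i t => X n i t ω) ≤ ν₁ n ω ∧
              ν₁ n ω ≤ b₁ * PanelQR.avgSupNorm (fun i t => X n i t ω))
          (_ : ∀ᶠ n in atTop, a₂ * PanelQR.nuclearTuning μ' n (T n) ≤ ν₂ n ∧
            ν₂ n ≤ b₂ * PanelQR.nuclearTuning μ' n (T n))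
          (θhat : ∀ n, Ω n → Fin (p n) → ℝ)
          (Pihat : ∀ n, Ω n → Matrix (Fin n) (Fin (T n)) ℝ)
          (_ : ∀ᶠ n in atTop, ∀ᵐ ω ∂(P n),
            PanelQR.IsEstimate τ (ν₁ n ω) (ν₂ n) C (fun i t => Y n i t ω)
              (fun i t => X n i t ω) (θhat n ω) (Pihat n ω)),
          PanelQR.WithProbTendingToOne P (fun n ω => θhat n ω = 0) ∧
          PanelQR.IsBigOP P
            (fun n ω => 1 / ((n : ℝ) * T n) * PanelQR.frobeniusNorm (Pihat n ω -
              (PanelQR.tensorMul (fun i t => X n i t ω) (θ n) + Pi n)) ^ 2)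
            (fun n => fUp' n ^ 2 * φ n ^ 2 * (PanelQR.blockLength μ' (T n) : ℝ) *
              ((Pi n).rank : ℝ) / fLow n ^ 4 *
              (1 / (n : ℝ) + 1 / (PanelQR.numBlocks μ' (T n) : ℝ))) := by
  -- The first 2 lets the ℓ₁ penalty dominate the Lipschitz bound, the second makes `n T ν₂` twice
  -- the operator norm bound of the score.
  refine ⟨2, 2, two_pos, two_pos, ?_⟩
  intro Ω _ P _ T p hT hp X Y τ hτ0 hτ1 θ Pi μ μ' fLow fUp fUp' φ ξ hq hw hd hX hA hφ
  -- Probability 1/2 is enough for `C₀`, which may not depend on the precision `ε`; the offending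
  -- rows are masked.
  obtain ⟨C₀, hC₀, hC₀P⟩ := hA.bounded (1 / 2) (by norm_num)
  refine ⟨C₀, hC₀, ?_⟩
  intro C hC b₁ b₂ ν₁ ν₂ hν₁ hν₂ θhat Pihat hE
  refine ⟨PanelQR.coef_eq_zero_tendsto hτ0 hτ1 hX
    (hν₁.mono fun n h => h.mono fun ω h => h.1) hE, ?_⟩
  intro ε' hε'
  -- The good event is the intersection of eight events, each failing with probability at most `ε`.
  obtain ⟨ε, hε, rfl⟩ : ∃ ε : ℝ, 0 < ε ∧ ε' = (8 : ℕ) * ε := ⟨ε' / 8, by positivity, by simp; ring⟩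
  have hC0 : 0 < C := hC₀.trans_le hC
  obtain ⟨f₀, hf₀, hf⟩ := hd.low_pos
  obtain ⟨K, hK⟩ := hA.rank_le
  obtain ⟨M₁, hM₁, hξ⟩ := hA.error ε hε
  obtain ⟨C₁, hC₁, hmax⟩ := hA.bounded ε hε
  obtain ⟨B₀, hB₀⟩ := hw.mixing
  have hmix : ∀ n (i : Fin n) (k : ℕ), 1 ≤ k →
      PanelQR.betaMixing (P n) (fun t ω => (Y n i t ω, X n i t ω)) k ≤
        ENNReal.ofReal (max B₀ 0 * (k : ℝ) ^ (-μ)) := fun n i k hk =>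
    (hB₀ n i k hk).trans (ENNReal.ofReal_le_ofReal (by gcongr; exact le_max_left _ _))
  obtain ⟨D, hD⟩ : ∃ D, D = max (2 * C) (2 / f₀) := ⟨_, rfl⟩
  obtain ⟨B, hB⟩ : ∃ B, B = 1 + 64 * D * (b₂ / 2 + 80 / (ε / 2)) *
    (√(K + 1 : ℝ) + M₁ / f₀ + C * (1 / ε)) := ⟨_, rfl⟩
  refine ⟨2 * B ^ 2 + 8 * (1 / ε) * C₁ ^ 2, by positivity, ?_⟩
  have hnoise := hw.tendsto_mixing hT hp (le_max_right B₀ 0)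
  have hop : Tendsto (fun n : ℕ => 1600 / (PanelQR.blockLength μ' (T n) : ℝ) +
      (n : ℝ) * T n * (2 * (max B₀ 0 * (PanelQR.blockLength μ' (T n) : ℝ) ^ (-μ))))
      atTop (𝓝 0) := by
    simpa using ((hw.tendsto_blockLength hT hp).const_div_atTop 1600).add hnoise
  have hc : ∀ n, 1 ≤ PanelQR.blockLength μ' (T n) := fun n =>
    PanelQR.one_le_blockLength hw.pos (hT n)
  filter_upwards [eventually_ge_atTop 1, hw.eventually_one_le_numBlocks hT hp,
    PanelQR.eventually_one_le_phi hf₀ hf hc hφ, hC₀P, hν₁, hν₂, hE, hξ, hmax,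
    PanelQR.eventually_le_ofReal hK hε, PanelQR.eventually_le_ofReal hX.empirical hε,
    hop.eventually_le_const hε, hnoise.eventually_le_const (half_pos hε)] with n hn hd1 hφ1 hC₀n
    hν₁n hν₂n hEn hξn hmaxn hKn hXn hopn hnoisen
  have law := PanelQR.panelLaw hτ0 hτ1 hq hw hd hT (le_max_right B₀ 0) hmix hn
  have hm := PanelQR.div_blockLength_add_one_le (hc n) hd1
  obtain ⟨c, hcdef⟩ : ∃ c, c = PanelQR.blockLength μ' (T n) := ⟨_, rfl⟩
  obtain ⟨d, hddef⟩ : ∃ d, d = PanelQR.numBlocks μ' (T n) := ⟨_, rfl⟩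
  have hcd : 2 * (c * d) ≤ T n := by
    rw [hcdef, hddef]; exact PanelQR.two_mul_blockLength_mul_le μ' (T n)
  have hcn := hc n
  simp only [PanelQR.nuclearTuning] at hν₂n
  rw [← hcdef] at law hm hcn hopn hnoisen hξn hν₂n ⊢
  rw [← hddef] at hd1 hm hξn hν₂n ⊢
  obtain ⟨w, hwdef⟩ : ∃ w, w = c * (√(n : ℝ) + √(d : ℝ)) := ⟨_, rfl⟩
  obtain ⟨ρ, hρ⟩ : ∃ ρ, ρ = √(c * (Pi n).rank * (1 / (n : ℝ) + 1 / d)) := ⟨_, rfl⟩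
  obtain ⟨H, hH⟩ : ∃ H, H = √((n : ℝ) * T n) * (B * φ n * ρ * fUp' n / fLow n ^ 2) := ⟨_, rfl⟩
  obtain ⟨R, hR⟩ : ∃ R, R = 8 * √((K + 1 : ℝ) * (Pi n).rank) * H +
      4 * (M₁ * φ n * √((Pi n).rank : ℝ) * w / fLow n) + 4 * C * T n * (1 / ε) / w := ⟨_, rfl⟩
  have hf0 : 0 < fLow n := hf₀.trans_le (hf n)
  have hf' : 0 < fUp' n := lt_of_lt_of_le (by positivity) law.sq_le
  have hn0 : (0 : ℝ) < n := by exact_mod_cast hn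
  have hT0 : (0 : ℝ) < T n := by exact_mod_cast hT n
  have hc0 : (0 : ℝ) < c := by exact_mod_cast hcn
  have hw0 : 0 < w := by rw [hwdef]; positivity
  have hφ0 : 0 < φ n := by linarith
  have hD2 : 2 / fLow n ≤ D := by
    rw [hD]; exact le_max_of_le_right (div_le_div_of_nonneg_left zero_le_two hf₀ (hf n))
  have hD0 : 0 < D := lt_of_lt_of_le (by positivity) hD2
  have hb₂ : 0 ≤ b₂ := by
    have h1 : 0 < c / ((n : ℝ) * T n) * (√(n : ℝ) + √(d : ℝ)) := by positivity
    have h2 := hν₂n.1.trans hν₂n.2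
    have h3 := le_of_mul_le_mul_right h2 h1
    linarith
  have hB0 : 0 ≤ B := by rw [hB]; positivity
  have hH0 : 0 ≤ H := by rw [hH, hρ]; positivity
  have hR0 : 0 < R := by rw [hR]; positivity
  have hmax2 : P n {ω | C < PanelQR.maxNorm (PanelQR.tensorMul (fun i t => X n i t ω) (θ n) +
      Pi n)} ≤ ENNReal.ofReal (1 / 2) := by
    refine (measure_mono fun ω hω => ?_).trans hC₀n
    rw [Set.mem_ofPred_eq, mul_one]
    exact hC.trans_lt (lt_of_lt_of_le hω (le_abs_self _))
  have hrows := law.measure_rows_le hmax2 (b := 1 / ε) (by positivity)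
  rw [one_div_one_div] at hrows
  have hopb := (law.measure_not_opBound_le hd1 hn hm).trans (ENNReal.ofReal_le_ofReal hopn)
  rw [← hwdef] at hopb
  -- One half of `ε` is spent on Markov's inequality and the other on decoupling.
  have hproc := (law.measure_process_le hd1 hm hR0 (half_pos hε) hD2).trans
    (ENNReal.ofReal_le_ofReal (show _ ≤ ε by linarith))
  refine PanelQR.measure_le_of_events (k := 8) (E := ![
    fun ω => 2 * PanelQR.avgSupNorm (fun i t => X n i t ω) ≤ ν₁ n ω ∧
      PanelQR.IsEstimate τ (ν₁ n ω) (ν₂ n) C (fun i t => Y n i t ω)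
        (fun i t => X n i t ω) (θhat n ω) (Pihat n ω),
    fun ω => ∀ j, |PanelQR.sigmaHatSq (fun i t => X n i t ω) j - 1| ≤ 1 / 4,
    fun ω => (PanelQR.tensorMul (fun i t => X n i t ω) (θ n) + ξ n ω).rank ≤ K * (Pi n).rank,
    fun ω => ¬ M₁ * (c * φ n * √((Pi n).rank : ℝ) * (√(n : ℝ) + √(d : ℝ)) /
      (√((n : ℝ) * T n) * fLow n)) < |PanelQR.nuclearNorm (ξ n ω) / √((n : ℝ) * T n)|,
    fun ω => ¬ C₁ * 1 <
      |PanelQR.maxNorm (PanelQR.tensorMul (fun i t => X n i t ω) (θ n) + Pi n)|,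
    fun ω => PanelQR.OpBound (Matrix.of fun i t => τ -
      if PanelQR.residual (X n) (Y n) (θ n) (Pi n) ω i t ≤ 0 then 1 else 0) w,
    fun ω => ∃ G : Finset (Fin n), ((Gᶜ).card : ℝ) ≤ 1 / ε ∧
      ∀ i ∈ G, ∀ t, |(PanelQR.tensorMul (fun i t => X n i t ω) (θ n) + Pi n) i t| ≤ C,
    fun ω => ∀ A : Matrix (Fin n) (Fin (T n)) ℝ, PanelQR.nuclearNorm A ≤ R →
      (∀ i t, |A i t| ≤ D) →
      fLow n ^ 2 / (8 * fUp' n * D) * PanelQR.frobInner A A ≤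
        ∑ i, ∑ t, PanelQR.bregman (PanelQR.residual (X n) (Y n) (θ n) (Pi n) ω i t) (A i t) +
          c * (40 * R * √((n : ℝ) + 4 * d)) / (ε / 2)]) (ε := ε) ?_ ?_
  · have h0 : P n {ω | ¬ (2 * PanelQR.avgSupNorm (fun i t => X n i t ω) ≤ ν₁ n ω ∧
        PanelQR.IsEstimate τ (ν₁ n ω) (ν₂ n) C (fun i t => Y n i t ω)
          (fun i t => X n i t ω) (θhat n ω) (Pihat n ω))} = 0 :=
      ae_iff.1 (by filter_upwards [hν₁n, hEn] with ω h1 h2 using ⟨h1.1, h2⟩)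
    intro i
    fin_cases i
    · exact h0.trans_le zero_le
    · exact hXn
    · exact hKn
    · exact (measure_mono fun ω h => not_not.1 h).trans hξn
    · exact (measure_mono fun ω h => not_not.1 h).trans hmaxn
    · exact hopb
    · exact hrows
    · exact hproc
  · intro ω hω
    have h0 := hω 0
    have h3 := hω 3
    have h4 := hω 4
    rw [Set.mem_ofPred_eq, not_lt]
    exact PanelQR.estimate_error_le rfl hτ0 hτ1 hn (hT n) hcn hd1 hcd hf₀ (hf n) law.sq_le hφ1 hC0
      (by positivity) (half_pos hε) hM₁ hwdef hρ hD hB hH hR h0.2 h0.1 hν₂n.1 hν₂n.2 (hω 1) (hω 2)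
      (not_lt.1 h3) ((not_lt.1 h4).trans_eq (mul_one _)) (hω 5) (hω 6) (hω 7)
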